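/- **Theorem 1.1 (Total absence of eigenvalues).** Let $d\ge 5$, write $r(x)=|x|$ and let $C_{\mathrm H}=(d-2)^2/4$ be the Hardy constant. Let $V\colon\mathbb R^d\to\mathbb C$ satisfy $V\in L^1_{\mathrm{loc}}(\mathbb R^d)$ and $r^2V\in L^2_{\mathrm{loc}}(\mathbb R^d)$, and suppose that $$\int_{\mathbb R^d} r^4|V|^2|\psi|^2\le a^2\int_{\mathbb R^d}\frac{|\nabla\psi|^2}{r^2}\qquad\text{for all }\psi\in H^2(\mathbb R^d),$$ where $a\ge 0$ is such that $$\frac{4d^2(d-3)}{(d-2)(d-4)}\,\frac{a}{\sqrt{C_{\mathrm H}}}+\frac{4d\sqrt d}{(d-4)\sqrt{(d-2)(d-4)}}\,\frac{a^{3/2}}{\sqrt{C_{\mathrm H}}^{\,3/2}}<1 .$$ Let $H_V=\Delta^2+V$ be the operator in $L^2(\mathbb R^d)$ associated with the form $(u,v)\mapsto\int\Delta u\,\overline{\Delta v}+\int Vu\,\overline v$ on $H^2(\mathbb R^d)$. Then $\sigma_{\mathrm p}(H_V)=\varnothing$: for no $z\in\mathbb C$ is there a non-zero $u\in H^2(\mathbb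 R^d)$ with $$\int\Delta u\,\overline{\Delta v}+\int V u\,\overline v=z\int u\,\overline v\qquad\text{for all }v\in H^2(\mathbb R^d).$$ Moreover, small Rellich-type potentials are covered: for every $d\ge5$ there is $\varepsilon>0$ such that for every $\alpha\in\mathbb C$ with $|\alpha|<\varepsilon$ the potential $V_\alpha(x)=\alpha/|x|^4$ satisfies all of the above hypotheses for some $a\ge0$. -/

import Mathlib

noncomputable section

namespace Biharmonic

open MeasureTheory TemperedDistribution Laplacian LineDeriv SchwartzMap
open scoped ENNReal ComplexConjugate

/-- The space `ℝ^d` with its Euclidean norm, so that `r x = ‖x‖`. -/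
abbrev Space (d : ℕ) : Type := EuclideanSpace ℝ (Fin d)

/-- The complex Hilbert space `L²(ℝ^d)`. -/
abbrev L2 (d : ℕ) : Type := Lp ℂ 2 (volume : Measure (Space d))

/-- An `L²` function, regarded as a tempered distribution. -/
abbrev toDist {d : ℕ} (u : L2 d) : 𝓢'(Space d, ℂ) := Lp.toTemperedDistribution u

theorem toDist_injective {d : ℕ} : Function.Injective (toDist (d := d)) := by
  have h : Function.Injective
      (Lp.toTemperedDistributionCLM ℂ (volume : Measure (Space d)) 2).toLinearMap :=
    LinearMap.ker_eq_bot.1 Lp.ker_toTemperedDistributionCLM_eq_bot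
  exact h

theorem toDist_add {d : ℕ} (u v : L2 d) : toDist (u + v) = toDist u + toDist v :=
  map_add (Lp.toTemperedDistributionCLM ℂ (volume : Measure (Space d)) 2) u v

theorem toDist_smul {d : ℕ} (c : ℂ) (u : L2 d) : toDist (c • u) = c • toDist u :=
  map_smul (Lp.toTemperedDistributionCLM ℂ (volume : Measure (Space d)) 2) c u

theorem toDist_zero {d : ℕ} : toDist (0 : L2 d) = 0 :=
  map_zero (Lp.toTemperedDistributionCLM ℂ (volume : Measure (Space d)) 2)

/-- The Sobolev space `H²(ℝ^d)`, as a subspace of `L²(ℝ^d)`. -/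
def H2 (d : ℕ) : Submodule ℂ (L2 d) where
  carrier := {u | MemSobolev 2 2 (toDist u)}
  add_mem' {u v} hu hv := by
    change MemSobolev 2 2 (toDist (u + v))
    rw [toDist_add]
    exact MemSobolev.add hu hv
  zero_mem' := by
    change MemSobolev 2 2 (toDist (0 : L2 d))
    rw [toDist_zero]
    exact memSobolev_fun_zero _ _ 2 2
  smul_mem' c u hu := by
    change MemSobolev 2 2 (toDist (c • u))
    rw [toDist_smul]
    exact MemSobolev.smul c hu

theorem exists_lap {d : ℕ} (u : H2 d) : ∃ w : L2 d, toDist w = Δ (toDist (u : L2 d)) := by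
  have h : MemSobolev 2 2 (toDist (u : L2 d)) := u.2
  have h' := h.laplacian
  rw [sub_self] at h'
  obtain ⟨w, hw⟩ := memSobolev_zero_iff.1 h'
  exact ⟨w, hw.symm⟩

theorem exists_partial {d : ℕ} (u : H2 d) (i : Fin d) :
    ∃ w : L2 d, toDist w = ∂_{(EuclideanSpace.single i (1 : ℝ) : Space d)} (toDist (u : L2 d)) := by
  have h : MemSobolev 2 2 (toDist (u : L2 d)) := u.2
  have h' := (h.lineDerivOp (m := (EuclideanSpace.single i (1 : ℝ) : Space d))).mono
    (s' := 0) (by norm_num)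
  obtain ⟨w, hw⟩ := memSobolev_zero_iff.1 h'
  exact ⟨w, hw.symm⟩

/-- The distributional Laplacian `Δu ∈ L²(ℝ^d)` of `u ∈ H²(ℝ^d)`. -/
def lap {d : ℕ} (u : H2 d) : L2 d := (exists_lap u).choose

theorem toDist_lap {d : ℕ} (u : H2 d) : toDist (lap u) = Δ (toDist (u : L2 d)) :=
  (exists_lap u).choose_spec

/-- The distributional partial derivative `∂ᵢu ∈ L²(ℝ^d)` of `u ∈ H²(ℝ^d)`. -/
def partialDeriv {d : ℕ} (u : H2 d) (i : Fin d) : L2 d := (exists_partial u i).choose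

theorem toDist_partialDeriv {d : ℕ} (u : H2 d) (i : Fin d) :
    toDist (partialDeriv u i) =
      ∂_{(EuclideanSpace.single i (1 : ℝ) : Space d)} (toDist (u : L2 d)) :=
  (exists_partial u i).choose_spec

theorem lap_add {d : ℕ} (u v : H2 d) : lap (u + v) = lap u + lap v := by
  apply toDist_injective
  rw [toDist_lap, toDist_add, toDist_lap, toDist_lap, Submodule.coe_add, toDist_add]
  simp only [← laplacianCLM_apply]
  exact map_add _ _ _

theorem lap_smul {d : ℕ} (c : ℂ) (u : H2 d) : lap (c • u) = c • lap u := by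
  apply toDist_injective
  rw [toDist_lap, toDist_smul, toDist_lap, Submodule.coe_smul, toDist_smul]
  simp only [← laplacianCLM_apply]
  exact map_smul _ _ _

/-- `|∇u(x)|² = ∑ᵢ |∂ᵢu(x)|²`. -/
def gradSq {d : ℕ} (u : H2 d) (x : Space d) : ℝ := ∑ i, ‖partialDeriv u i x‖ ^ 2

theorem H2_dense {d : ℕ} : Dense (H2 d : Set (L2 d)) := by
  refine (SchwartzMap.denseRange_toLpCLM (E := Space d) (F := ℂ) (p := 2)
    (μ := volume) (by norm_num)).mono ?_
  rintro _ ⟨f, rfl⟩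
  change MemSobolev 2 2 (toDist (f.toLp 2 volume))
  rw [toDist, Lp.toTemperedDistribution_toLp_eq]
  exact f.memSobolev

theorem eq_of_forall_inner {d : ℕ} {g g' : L2 d}
    (h : ∀ v : H2 d, inner ℂ (v : L2 d) g = inner ℂ (v : L2 d) g') : g = g' :=
  H2_dense.eq_of_inner_right ℂ fun v hv => h ⟨v, hv⟩

/-- `u ∈ H²(ℝ^d)` lies in the domain of `Δ² + V` and is mapped to `g ∈ L²(ℝ^d)`:
the products `V u v̄` are integrable and
`∫ Δu Δv̄ + ∫ V u v̄ = ∫ g v̄` for all `v ∈ H²(ℝ^d)`.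
(Inner products are conjugate-linear in the first argument.) -/
def IsImage {d : ℕ} (V : Space d → ℂ) (u : H2 d) (g : L2 d) : Prop :=
  ∀ v : H2 d, Integrable (fun x => V x * (u : L2 d) x * conj ((v : L2 d) x)) ∧
    inner ℂ (lap v) (lap u) + ∫ x, V x * (u : L2 d) x * conj ((v : L2 d) x)
      = inner ℂ (v : L2 d) g

theorem IsImage.unique {d : ℕ} {V : Space d → ℂ} {u : H2 d} {g g' : L2 d}
    (h : IsImage V u g) (h' : IsImage V u g') : g = g' :=
  eq_of_forall_inner fun v => (h v).2.symm.trans (h' v).2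

theorem IsImage.add {d : ℕ} {V : Space d → ℂ} {u u' : H2 d} {g g' : L2 d}
    (h : IsImage V u g) (h' : IsImage V u' g') : IsImage V (u + u') (g + g') := by
  intro v
  have e : (fun x => V x * ((u + u' : H2 d) : L2 d) x * conj ((v : L2 d) x)) =ᵐ[volume]
      fun x => V x * (u : L2 d) x * conj ((v : L2 d) x)
        + V x * (u' : L2 d) x * conj ((v : L2 d) x) := by
    filter_upwards [Lp.coeFn_add (u : L2 d) (u' : L2 d)] with x hx
    rw [Submodule.coe_add, hx, Pi.add_apply]
    ring
  refine ⟨((h v).1.add (h' v).1).congr e.symm, ?_⟩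
  rw [integral_congr_ae e, integral_add (h v).1 (h' v).1, lap_add, inner_add_right,
    inner_add_right, ← (h v).2, ← (h' v).2]
  ring

theorem IsImage.smul {d : ℕ} {V : Space d → ℂ} {u : H2 d} {g : L2 d} (c : ℂ)
    (h : IsImage V u g) : IsImage V (c • u) (c • g) := by
  intro v
  have e : (fun x => V x * ((c • u : H2 d) : L2 d) x * conj ((v : L2 d) x)) =ᵐ[volume]
      fun x => c * (V x * (u : L2 d) x * conj ((v : L2 d) x)) := by
    filter_upwards [Lp.coeFn_smul c (u : L2 d)] with x hx
    rw [Submodule.coe_smul, hx, Pi.smul_apply, smul_eq_mul]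
    ring
  refine ⟨((h v).1.const_mul c).congr e.symm, ?_⟩
  rw [integral_congr_ae e, integral_const_mul, lap_smul, inner_smul_right,
    inner_smul_right, ← (h v).2]
  ring

theorem IsImage.zero {d : ℕ} (V : Space d → ℂ) : IsImage V (0 : H2 d) 0 := by
  intro v
  have e : (fun x => V x * ((0 : H2 d) : L2 d) x * conj ((v : L2 d) x)) =ᵐ[volume]
      fun _ => (0 : ℂ) := by
    filter_upwards [Lp.coeFn_zero ℂ 2 (volume : Measure (Space d))] with x hx
    rw [Submodule.coe_zero, hx]
    simp
  have l : lap (0 : H2 d) = 0 := by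
    have := lap_smul (0 : ℂ) (0 : H2 d)
    rwa [zero_smul, zero_smul] at this
  refine ⟨(integrable_zero _ _ _).congr e.symm, ?_⟩
  rw [integral_congr_ae e, l]
  simp

/-- The domain of `Δ² + V`: all `u ∈ H²(ℝ^d)` that have an image `g ∈ L²(ℝ^d)`. -/
def InDomain {d : ℕ} (V : Space d → ℂ) (u : L2 d) : Prop :=
  ∃ w : H2 d, (w : L2 d) = u ∧ ∃ g : L2 d, IsImage V w g

theorem InDomain.add {d : ℕ} {V : Space d → ℂ} {u u' : L2 d} (h : InDomain V u)
    (h' : InDomain V u') : InDomain V (u + u') := by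
  obtain ⟨w, hw, g, hg⟩ := h
  obtain ⟨w', hw', g', hg'⟩ := h'
  exact ⟨w + w', by rw [Submodule.coe_add, hw, hw'], g + g', hg.add hg'⟩

theorem InDomain.zero {d : ℕ} (V : Space d → ℂ) : InDomain V (0 : L2 d) :=
  ⟨0, rfl, 0, IsImage.zero V⟩

theorem InDomain.smul {d : ℕ} {V : Space d → ℂ} (c : ℂ) {u : L2 d} (h : InDomain V u) :
    InDomain V (c • u) := by
  obtain ⟨w, hw, g, hg⟩ := h
  exact ⟨c • w, by rw [Submodule.coe_smul, hw], c • g, hg.smul c⟩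

theorem InDomain.mem_H2 {d : ℕ} {V : Space d → ℂ} {u : L2 d} (h : InDomain V u) : u ∈ H2 d := by
  obtain ⟨w, hw, -⟩ := h
  rw [← hw]
  exact w.2

theorem InDomain.exists_image {d : ℕ} {V : Space d → ℂ} {u : L2 d} (h : InDomain V u) :
    ∃ g : L2 d, IsImage V ⟨u, h.mem_H2⟩ g := by
  obtain ⟨w, hw, g, hg⟩ := h
  subst hw
  exact ⟨g, hg⟩

/-- The domain of `Δ² + V` as a subspace of `L²(ℝ^d)`. -/
def opDomain {d : ℕ} (V : Space d → ℂ) : Submodule ℂ (L2 d) where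
  carrier := {u | InDomain V u}
  add_mem' h h' := InDomain.add h h'
  zero_mem' := InDomain.zero V
  smul_mem' c _ h := InDomain.smul c h

theorem opDomain_le {d : ℕ} (V : Space d → ℂ) : opDomain V ≤ H2 d :=
  fun _ hu => InDomain.mem_H2 hu

theorem exists_image {d : ℕ} {V : Space d → ℂ} (u : opDomain V) :
    ∃ g : L2 d, IsImage V ⟨u, opDomain_le V u.2⟩ g :=
  InDomain.exists_image u.2

/-- The value `Δ²u + Vu ∈ L²(ℝ^d)` at `u` in the domain. -/
def opValue {d : ℕ} {V : Space d → ℂ} (u : opDomain V) : L2 d := (exists_image u).choose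

theorem isImage_opValue {d : ℕ} {V : Space d → ℂ} (u : opDomain V) :
    IsImage V ⟨u, opDomain_le V u.2⟩ (opValue u) := (exists_image u).choose_spec

theorem opValue_eq {d : ℕ} {V : Space d → ℂ} {u : opDomain V} {w : H2 d} {g : L2 d}
    (hw : (w : L2 d) = (u : L2 d)) (h : IsImage V w g) : opValue u = g := by
  have hw' : w = ⟨(u : L2 d), opDomain_le V u.2⟩ := Subtype.ext hw
  rw [hw'] at h
  exact (isImage_opValue u).unique h

theorem opValue_add {d : ℕ} {V : Space d → ℂ} (u u' : opDomain V) :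
    opValue (u + u') = opValue u + opValue u' := by
  refine opValue_eq ?_ ((isImage_opValue u).add (isImage_opValue u'))
  rw [Submodule.coe_add, Submodule.coe_add]

theorem opValue_smul {d : ℕ} {V : Space d → ℂ} (c : ℂ) (u : opDomain V) :
    opValue (c • u) = c • opValue u := by
  refine opValue_eq ?_ ((isImage_opValue u).smul c)
  rw [Submodule.coe_smul, Submodule.coe_smul]

/-- The operator `H_V = Δ² + V` in `L²(ℝ^d)`: the operator associated with the sesquilinear form
`(u, v) ↦ ∫ Δu Δv̄ + ∫ V u v̄` on `H²(ℝ^d)`. -/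
def biharmonicOp {d : ℕ} (V : Space d → ℂ) : L2 d →ₗ.[ℂ] L2 d where
  domain := opDomain V
  toFun :=
    { toFun := opValue
      map_add' := opValue_add
      map_smul' := opValue_smul }

/-- The point spectrum (set of eigenvalues) of an operator in `L²(ℝ^d)`. -/
def pointSpectrum {d : ℕ} (A : L2 d →ₗ.[ℂ] L2 d) : Set ℂ :=
  {z | ∃ u : A.domain, (u : L2 d) ≠ 0 ∧ A u = z • (u : L2 d)}

/-- `z` is an eigenvalue of `H_V` if and only if the equation `Δ²u + Vu = zu` has a non-trivial
weak solution `u ∈ H²(ℝ^d)`. -/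
theorem mem_pointSpectrum_biharmonicOp {d : ℕ} (V : Space d → ℂ) (z : ℂ) :
    z ∈ pointSpectrum (biharmonicOp V) ↔
      ∃ u : H2 d, (u : L2 d) ≠ 0 ∧ IsImage V u (z • (u : L2 d)) := by
  constructor
  · rintro ⟨u, h0, h⟩
    have key := isImage_opValue u
    have h' : opValue u = z • (u : L2 d) := h
    rw [h'] at key
    exact ⟨⟨u, opDomain_le V u.2⟩, h0, key⟩
  · rintro ⟨u, h0, h⟩
    let w : opDomain V := ⟨u, u, rfl, z • (u : L2 d), h⟩
    exact ⟨w, h0, opValue_eq (u := w) rfl h⟩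

/-- `f ∈ L²_loc(ℝ^d)`. -/
def MemL2Loc {d : ℕ} (f : Space d → ℂ) : Prop :=
  ∀ K : Set (Space d), IsCompact K → MemLp f 2 (volume.restrict K)

/-- The sharp constant `(d - 2)² / 4` in the Hardy inequality on `ℝ^d`, `d ≥ 3`. -/
def hardyConst (d : ℕ) : ℝ := ((d : ℝ) - 2) ^ 2 / 4

/-- `∫ r⁴ |V|² |ψ|² ≤ a² ∫ |∇ψ|² / r²` for all `ψ ∈ H²(ℝ^d)`
(integrals of non-negative functions, with values in `[0, ∞]`). -/
def GradientBound (d : ℕ) (a : ℝ) (V : Space d → ℂ) : Prop :=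
  ∀ ψ : H2 d,
    ∫⁻ x, ENNReal.ofReal (‖x‖ ^ 4 * ‖V x‖ ^ 2 * ‖(ψ : L2 d) x‖ ^ 2) ≤
      ENNReal.ofReal (a ^ 2) * ∫⁻ x, ENNReal.ofReal (gradSq ψ x / ‖x‖ ^ 2)

/-- The explicit smallness condition on the constant `a ≥ 0`. -/
def IsSmall (d : ℕ) (a : ℝ) : Prop :=
  4 * (d : ℝ) ^ 2 * ((d : ℝ) - 3) / (((d : ℝ) - 2) * ((d : ℝ) - 4)) * (a / √(hardyConst d))
    + 4 * (d : ℝ) * √(d : ℝ) / (((d : ℝ) - 4) * √(((d : ℝ) - 2) * ((d : ℝ) - 4)))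
      * (a ^ (3 / 2 : ℝ) / √(hardyConst d) ^ (3 / 2 : ℝ)) < 1

/-- The potential `α / |x|⁴`. -/
def rellichPotential (d : ℕ) (α : ℂ) (x : Space d) : ℂ := α / ((‖x‖ ^ 4 : ℝ) : ℂ)

end Biharmonic

end

/-!
The eigenvalue equation `Δ²u + Vu = zu` is tested with `v = (Δ² - μ)⁻¹ div g`, where `μ` is not
real and `g` is a field of Schwartz functions. Moving `Δ²` onto `v` leaves

  `∑ⱼ ∫ gⱼ ∂ⱼu = ∫ V u v - (z - μ) ∫ u v`   (`eigen_identity`).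

The last term vanishes as `μ → z`, because `Δ²` has no eigenvalues: on the Fourier side, the symbol
`(z - μ) / ((2π)⁴|ξ|⁴ - μ)` is bounded by `1` and tends to `0` off a sphere
(`exists_norm_resolventS_le`). The potential term is at most `‖r² V u‖ ‖r⁻² v‖`; the first factor
is bounded by `a ‖∇u / r‖`, and the second one by the weighted resolvent estimate
`‖r⁻² (Δ² - μ)⁻¹ div g‖ ≤ C ‖r g‖`, uniform in `μ` (`resolvent_estimate`). With `g` close to the
conjugate of `∇u / r²` this gives `‖∇u / r‖ ≤ a C ‖∇u / r‖`, where the norm is finite by Hardy's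
inequality. The smallness condition implies `a C < 1` (`resolventConst_mul_lt_one`), so `∇u = 0`,
and then `u = 0` by Rellich's inequality (`eq_zero_of_isImage`).

The resolvent estimate comes from duality. Under the Fourier transform `𝓕`, with
`φ = 𝓕 (r⁻⁴ v)`, `η = 𝓕 g` and `λ = μ / (2π)⁴`, the square of its left-hand side is, up to a
constant, the integral of `φ̄ (ξ · η) / (|ξ|⁴ - λ)`. The symbol is a radial derivative,
`4 λ / (|ξ|⁴ - λ) = ξ · ∇ log (1 - λ / |ξ|⁴)`, so an integration by parts trades the non-integrable
singularity on the sphere `|ξ|⁴ = λ` for a logarithmic one (`resolvent_integration_by_parts`), at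
the cost of one derivative of `φ` or `η`. A logarithmic weight is harmless in Hardy's inequality:
the usual proof with the vector field `x / |x|^(2k+2)` goes through with an additional factor that
increases steeply across the sphere, and the divergence of the field then controls the square of the
logarithm (`log_hardy`). Second derivatives of `φ` correspond to the weight `r²` on `r⁻⁴ v`, and
first derivatives of `η` to the weight `r` on `g`.

All weights are regularised by replacing `r²` with `r² + ε`; the regularisation is removed by
dominated convergence or Fatou's lemma.
-/

noncomputable section

namespace Biharmonic

open MeasureTheory TemperedDistribution Laplacian LineDeriv SchwartzMap
open scoped ENNReal ComplexConjugate

/-! ### Radial vector fields and the weighted Hardy inequality -/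

/-- The `i`-th vector of the standard basis of `ℝ^d`. -/
abbrev stdVec (d : ℕ) (i : Fin d) : Space d := EuclideanSpace.single i (1 : ℝ)

/-- The complex conjugate of a Schwartz function. -/
def conjS {d : ℕ} (φ : 𝓢(Space d, ℂ)) : 𝓢(Space d, ℂ) :=
  φ.postcompCLM (Complex.conjCLE : ℂ →L[ℝ] ℂ)

/-- The pointwise product of two Schwartz functions. -/
def mulS {d : ℕ} (φ ψ : 𝓢(Space d, ℂ)) : 𝓢(Space d, ℂ) :=
  SchwartzMap.pairing (ContinuousLinearMap.mul ℂ ℂ) φ ψ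

/-- The pointwise square `|∇φ|²` for a Schwartz function `φ`. -/
def gradSqS {d : ℕ} (φ : 𝓢(Space d, ℂ)) (x : Space d) : ℝ :=
  ∑ i, ‖(∂_{stdVec d i} φ) x‖ ^ 2

@[simp] theorem conjS_apply {d : ℕ} (φ : 𝓢(Space d, ℂ)) (x : Space d) :
    conjS φ x = conj (φ x) := rfl

@[simp] theorem mulS_apply {d : ℕ} (φ ψ : 𝓢(Space d, ℂ)) (x : Space d) :
    mulS φ ψ x = φ x * ψ x := rfl

theorem lineDeriv_conjS {d : ℕ} (φ : 𝓢(Space d, ℂ)) (m x : Space d) :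
    (∂_{m} (conjS φ)) x = conj ((∂_{m} φ) x) := by
  rw [SchwartzMap.lineDerivOp_apply_eq_fderiv, SchwartzMap.lineDerivOp_apply_eq_fderiv]
  have h := (Complex.conjCLE : ℂ →L[ℝ] ℂ).hasFDerivAt.comp x (φ.hasFDerivAt x)
  have h2 : HasFDerivAt (conjS φ) ((Complex.conjCLE : ℂ →L[ℝ] ℂ).comp (fderiv ℝ φ x)) x := h
  rw [h2.fderiv]
  rfl

theorem lineDeriv_mulS {d : ℕ} (φ ψ : 𝓢(Space d, ℂ)) (m x : Space d) :
    (∂_{m} (mulS φ ψ)) x = (∂_{m} φ) x * ψ x + φ x * (∂_{m} ψ) x := by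
  simp only [SchwartzMap.lineDerivOp_apply_eq_fderiv]
  have h2 : HasFDerivAt (mulS φ ψ) (φ x • fderiv ℝ ψ x + ψ x • fderiv ℝ φ x) x :=
    (φ.hasFDerivAt x).mul (ψ.hasFDerivAt x)
  rw [h2.fderiv]
  simp
  ring

/-- A function dominated by a Schwartz function times a polynomial is integrable. -/
theorem integrable_of_le_schwartz {d : ℕ} {F : Type*} [NormedAddCommGroup F] {h : Space d → F}
    (hm : AEStronglyMeasurable h volume) (φ : 𝓢(Space d, ℂ)) (C : ℝ) (k : ℕ)
    (hb : ∀ x, ‖h x‖ ≤ C * (1 + ‖x‖ ^ k) * ‖φ x‖) : Integrable h := by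
  have h1 : Integrable (fun x => C * (‖x‖ ^ 0 * ‖φ x‖ + ‖x‖ ^ k * ‖φ x‖)) volume :=
    ((φ.integrable_pow_mul volume 0).add (φ.integrable_pow_mul volume k)).const_mul C
  refine h1.mono' hm (.of_forall fun x => (hb x).trans (le_of_eq ?_))
  ring

theorem integrable_bounded_mul {d : ℕ} {c : Space d → ℂ}
    (hm : AEStronglyMeasurable c volume) (φ : 𝓢(Space d, ℂ)) {C : ℝ}
    (hb : ∀ x, ‖c x‖ ≤ C) : Integrable (fun x => c x * φ x) := by
  refine (φ.integrable (μ := volume)).bdd_mul hm (c := C) (.of_forall hb)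

theorem abs_coord_le {d : ℕ} (x : Space d) (i : Fin d) : |x i| ≤ ‖x‖ := by
  simpa using EuclideanSpace.norm_eq x ▸ PiLp.norm_apply_le x i

theorem sum_coord_sq {d : ℕ} (x : Space d) : ∑ i, (x i) ^ 2 = ‖x‖ ^ 2 := by
  rw [EuclideanSpace.norm_sq_eq]; simp

theorem hasFDerivAt_radial {d : ℕ} {b : ℝ → ℂ} {b' : ℂ} {x : Space d}
    (hb : HasDerivAt b b' (‖x‖ ^ 2)) (i : Fin d) :
    ∃ A : Space d →L[ℝ] ℂ, HasFDerivAt (fun x : Space d => (x i : ℂ) * b (‖x‖ ^ 2)) A x ∧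
      A (stdVec d i) = b (‖x‖ ^ 2) + 2 * (x i : ℂ) ^ 2 * b' := by
  have h1 : HasFDerivAt (fun x : Space d => ‖x‖ ^ 2) (2 • innerSL ℝ x) x :=
    (hasStrictFDerivAt_norm_sq x).hasFDerivAt
  have h2 : HasFDerivAt (fun x : Space d => b (‖x‖ ^ 2)) _ x := hb.hasFDerivAt.comp x h1
  have h3 : HasFDerivAt (fun x : Space d => ((x i : ℝ) : ℂ))
      (Complex.ofRealCLM.comp (EuclideanSpace.proj i : Space d →L[ℝ] ℝ)) x :=
    (Complex.ofRealCLM.comp (EuclideanSpace.proj i : Space d →L[ℝ] ℝ)).hasFDerivAt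
  refine ⟨_, h3.mul h2, ?_⟩
  simp [EuclideanSpace.inner_single_right]
  ring

/-- Integration by parts against the radial vector field `b(|x|²) x`, whose divergence is
`d b + 2 |x|² b'`. -/
theorem integral_radial_euler {d : ℕ} (Φ : 𝓢(Space d, ℂ)) {b b' : ℝ → ℂ} {C : ℝ}
    (hb : ∀ s, 0 ≤ s → HasDerivAt b (b' s) s) (hC : ∀ s, 0 ≤ s → ‖b s‖ ≤ C)
    (hC' : ∀ s, 0 ≤ s → ‖b' s‖ ≤ C) :
    Integrable (fun x => b (‖x‖ ^ 2) * ∑ i, (x i : ℂ) * (∂_{stdVec d i} Φ) x) ∧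
    Integrable (fun x => (d * b (‖x‖ ^ 2) + 2 * ‖x‖ ^ 2 * b' (‖x‖ ^ 2)) * Φ x) ∧
    ∫ x, b (‖x‖ ^ 2) * ∑ i, (x i : ℂ) * (∂_{stdVec d i} Φ) x =
      - ∫ x, (d * b (‖x‖ ^ 2) + 2 * ‖x‖ ^ 2 * b' (‖x‖ ^ 2)) * Φ x := by
  have hC0 : 0 ≤ C := (norm_nonneg _).trans (hC 0 le_rfl)
  have hcont : Continuous fun x : Space d => b (‖x‖ ^ 2) := by
    refine continuous_iff_continuousAt.2 fun x => ?_
    exact (hb (‖x‖ ^ 2) (by positivity)).continuousAt.comp_of_eq (by fun_prop) rfl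
  have hmeas' : Measurable fun x : Space d => b' (‖x‖ ^ 2) := by
    have : (fun x : Space d => b' (‖x‖ ^ 2)) = fun x : Space d => deriv b (‖x‖ ^ 2) := by
      ext x; exact ((hb (‖x‖ ^ 2) (by positivity)).deriv).symm
    rw [this]
    exact (measurable_deriv b).comp (by fun_prop)
  choose A hA hA' using fun (i : Fin d) (x : Space d) =>
    hasFDerivAt_radial (hb (‖x‖ ^ 2) (by positivity)) i
  have hpow : ∀ x : Space d, ‖x‖ ≤ 1 + ‖x‖ ^ 2 := fun x => by nlinarith [sq_nonneg (‖x‖ - 1)]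
  have key : ∀ i : Fin d,
      Integrable (fun x => ((x i : ℂ) * b (‖x‖ ^ 2)) * (∂_{stdVec d i} Φ) x) ∧
      Integrable (fun x => (b (‖x‖ ^ 2) + 2 * (x i : ℂ) ^ 2 * b' (‖x‖ ^ 2)) * Φ x) ∧
      ∫ x, ((x i : ℂ) * b (‖x‖ ^ 2)) * (∂_{stdVec d i} Φ) x =
        - ∫ x, (b (‖x‖ ^ 2) + 2 * (x i : ℂ) ^ 2 * b' (‖x‖ ^ 2)) * Φ x := by
    intro i
    have hc : Continuous fun x : Space d => ((x i : ℝ) : ℂ) := by fun_prop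
    have i1 : Integrable (fun x => ((x i : ℂ) * b (‖x‖ ^ 2)) * (∂_{stdVec d i} Φ) x) := by
      refine integrable_of_le_schwartz
        ((hc.mul hcont).mul (∂_{stdVec d i} Φ).continuous).aestronglyMeasurable
        (∂_{stdVec d i} Φ) C 2 fun x => ?_
      rw [norm_mul, norm_mul, Complex.norm_real, Real.norm_eq_abs]
      have := (abs_coord_le x i).trans (hpow x)
      have h2 := hC (‖x‖ ^ 2) (by positivity)
      rw [mul_comm C]
      gcongr
    have i2 : Integrable (fun x => ((x i : ℂ) * b (‖x‖ ^ 2)) * Φ x) := by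
      refine integrable_of_le_schwartz ((hc.mul hcont).mul Φ.continuous).aestronglyMeasurable
        Φ C 2 fun x => ?_
      rw [norm_mul, norm_mul, Complex.norm_real, Real.norm_eq_abs]
      have := (abs_coord_le x i).trans (hpow x)
      have h2 := hC (‖x‖ ^ 2) (by positivity)
      rw [mul_comm C]
      gcongr
    have i3 : Integrable (fun x => (b (‖x‖ ^ 2) + 2 * (x i : ℂ) ^ 2 * b' (‖x‖ ^ 2)) * Φ x) := by
      refine integrable_of_le_schwartz
        (((hcont.measurable.add ((hc.measurable.pow_const 2).const_mul 2 |>.mul hmeas')).mul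
          Φ.continuous.measurable).aestronglyMeasurable) Φ (3 * C) 2 fun x => ?_
      have h2 := hC (‖x‖ ^ 2) (by positivity)
      have h3 := hC' (‖x‖ ^ 2) (by positivity)
      have h4 : |x i| ^ 2 ≤ ‖x‖ ^ 2 := by gcongr; exact abs_coord_le x i
      rw [norm_mul]
      gcongr
      refine (norm_add_le _ _).trans ?_
      rw [norm_mul, norm_mul, norm_pow, Complex.norm_real, Real.norm_eq_abs]
      calc _ ≤ C + ‖(2 : ℂ)‖ * ‖x‖ ^ 2 * C := by gcongr
        _ ≤ _ := by simp; nlinarith [mul_nonneg hC0 (sq_nonneg ‖x‖)]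
    refine ⟨i1, i3, ?_⟩
    have e1 : ∀ x, fderiv ℝ (fun x : Space d => (x i : ℂ) * b (‖x‖ ^ 2)) x (stdVec d i) =
        b (‖x‖ ^ 2) + 2 * (x i : ℂ) ^ 2 * b' (‖x‖ ^ 2) := fun x => by
      rw [(hA i x).fderiv, hA']
    have := integral_mul_fderiv_eq_neg_fderiv_mul_of_integrable (μ := (volume : Measure (Space d)))
      (f := fun x : Space d => (x i : ℂ) * b (‖x‖ ^ 2)) (g := Φ) (v := stdVec d i)
      (by simpa only [e1] using i3) (by simpa only [SchwartzMap.lineDerivOp_apply_eq_fderiv] using i1)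
      i2 (fun x _ => (hA i x).differentiableAt) (fun x _ => Φ.differentiableAt)
    simpa only [e1, SchwartzMap.lineDerivOp_apply_eq_fderiv] using this
  have e1 : (fun x : Space d => b (‖x‖ ^ 2) * ∑ i, (x i : ℂ) * (∂_{stdVec d i} Φ) x) =
      fun x => ∑ i, ((x i : ℂ) * b (‖x‖ ^ 2)) * (∂_{stdVec d i} Φ) x := by
    ext x; rw [Finset.mul_sum]; exact Finset.sum_congr rfl fun i _ => by ring
  have e2 : (fun x : Space d => (d * b (‖x‖ ^ 2) + 2 * ‖x‖ ^ 2 * b' (‖x‖ ^ 2)) * Φ x) =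
      fun x => ∑ i, (b (‖x‖ ^ 2) + 2 * (x i : ℂ) ^ 2 * b' (‖x‖ ^ 2)) * Φ x := by
    ext x
    rw [← Finset.sum_mul, Finset.sum_add_distrib, ← Finset.sum_mul, ← Finset.mul_sum]
    have : ∑ i, (x i : ℂ) ^ 2 = (‖x‖ : ℂ) ^ 2 := by exact_mod_cast sum_coord_sq x
    rw [this]; simp
  rw [e1, e2]
  refine ⟨integrable_finsetSum _ fun i _ => (key i).1,
    integrable_finsetSum _ fun i _ => (key i).2.1, ?_⟩
  rw [integral_finsetSum _ fun i _ => (key i).1, integral_finsetSum _ fun i _ => (key i).2.1,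
    ← Finset.sum_neg_distrib]
  exact Finset.sum_congr rfl fun i _ => (key i).2.2

theorem norm_sum_mul_le {d : ℕ} (a b : Fin d → ℂ) :
    ‖∑ i, a i * b i‖ ≤ √(∑ i, ‖a i‖ ^ 2) * √(∑ i, ‖b i‖ ^ 2) := by
  refine (norm_sum_le _ _).trans ?_
  simp only [norm_mul]
  exact Real.sum_mul_le_sqrt_mul_sqrt _ _ _

theorem norm_sum_coord_mul_le {d : ℕ} (x : Space d) (b : Fin d → ℂ) :
    ‖∑ i, (x i : ℂ) * b i‖ ≤ ‖x‖ * √(∑ i, ‖b i‖ ^ 2) := by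
  refine (norm_sum_mul_le _ _).trans (le_of_eq ?_)
  congr 1
  simp only [Complex.norm_real, Real.norm_eq_abs, sq_abs]
  rw [sum_coord_sq, Real.sqrt_sq (norm_nonneg _)]

theorem gradSqS_nonneg {d : ℕ} (φ : 𝓢(Space d, ℂ)) (x : Space d) : 0 ≤ gradSqS φ x :=
  Finset.sum_nonneg fun _ _ => by positivity

theorem integrable_bounded_mul_sq {d : ℕ} {c : Space d → ℝ}
    (hm : AEStronglyMeasurable c volume) (φ : 𝓢(Space d, ℂ)) {C : ℝ}
    (hb : ∀ x, |c x| ≤ C) : Integrable (fun x => c x * ‖φ x‖ ^ 2) := by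
  have h : Integrable (fun x => ‖φ x‖ ^ 2) := by
    have := (φ.memLp 2 (volume : Measure (Space d)))
    exact this.integrable_norm_pow (by norm_num)
  exact h.bdd_mul hm (c := C) (.of_forall hb)

theorem integrable_bounded_mul_gradSqS {d : ℕ} {c : Space d → ℝ}
    (hm : AEStronglyMeasurable c volume) (φ : 𝓢(Space d, ℂ)) {C : ℝ}
    (hb : ∀ x, |c x| ≤ C) : Integrable (fun x => c x * gradSqS φ x) := by
  simp only [gradSqS, Finset.mul_sum]
  exact integrable_finsetSum _ fun i _ => integrable_bounded_mul_sq hm _ hb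

/-- A weighted Hardy inequality: if the radial vector field `X = b(|x|²) x` has divergence `W > 0`
and `|X|² ≤ M p W`, then `∫ W |φ|² ≤ 4 M ∫ p |∇φ|²`. -/
theorem weighted_hardy {d : ℕ} (φ : 𝓢(Space d, ℂ)) {b b' p : ℝ → ℝ} {C M : ℝ}
    (hb : ∀ s, 0 ≤ s → HasDerivAt b (b' s) s) (hC : ∀ s, 0 ≤ s → |b s| ≤ C)
    (hC' : ∀ s, 0 ≤ s → |b' s| ≤ C)
    (hp : Integrable (fun x => p (‖x‖ ^ 2) * gradSqS φ x))
    (hW : ∀ s, 0 ≤ s → 0 < d * b s + 2 * s * b' s)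
    (hM : ∀ s, 0 ≤ s → s * b s ^ 2 ≤ M * p s * (d * b s + 2 * s * b' s)) :
    Integrable (fun x => (d * b (‖x‖ ^ 2) + 2 * ‖x‖ ^ 2 * b' (‖x‖ ^ 2)) * ‖φ x‖ ^ 2) ∧
    ∫ x, (d * b (‖x‖ ^ 2) + 2 * ‖x‖ ^ 2 * b' (‖x‖ ^ 2)) * ‖φ x‖ ^ 2 ≤
      4 * M * ∫ x, p (‖x‖ ^ 2) * gradSqS φ x := by
  obtain ⟨h1, h2, h3⟩ := integral_radial_euler (mulS (conjS φ) φ) (b := fun s => (b s : ℂ))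
    (b' := fun s => (b' s : ℂ)) (C := C) (fun s hs => (hb s hs).ofReal_comp)
    (fun s hs => by simpa using hC s hs) (fun s hs => by simpa using hC' s hs)
  have e2 : ∀ x : Space d, ((d : ℂ) * (b (‖x‖ ^ 2) : ℂ) + 2 * (‖x‖ : ℂ) ^ 2 * (b' (‖x‖ ^ 2) : ℂ)) *
      mulS (conjS φ) φ x =
      (((d * b (‖x‖ ^ 2) + 2 * ‖x‖ ^ 2 * b' (‖x‖ ^ 2)) * ‖φ x‖ ^ 2 : ℝ) : ℂ) := fun x => by
    simp only [mulS_apply, conjS_apply, Complex.conj_mul']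
    push_cast
    ring
  simp only [e2] at h2 h3
  have i2 := h2.re
  simp only [RCLike.re_to_complex, Complex.ofReal_re] at i2
  refine ⟨i2, ?_⟩
  have h4 : ∫ x, (d * b (‖x‖ ^ 2) + 2 * ‖x‖ ^ 2 * b' (‖x‖ ^ 2)) * ‖φ x‖ ^ 2 ≤
      ∫ x, ‖(b (‖x‖ ^ 2) : ℂ) * ∑ i, (x i : ℂ) * (∂_{stdVec d i} (mulS (conjS φ) φ)) x‖ := by
    rw [integral_complex_ofReal] at h3
    refine le_trans (le_trans (le_abs_self _) (le_of_eq ?_)) (norm_integral_le_integral_norm _)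
    rw [h3, norm_neg, Complex.norm_real, Real.norm_eq_abs]
  have h5 : ∫ x, ‖(b (‖x‖ ^ 2) : ℂ) * ∑ i, (x i : ℂ) * (∂_{stdVec d i} (mulS (conjS φ) φ)) x‖ ≤
      ∫ x, ((1 / 2) * ((d * b (‖x‖ ^ 2) + 2 * ‖x‖ ^ 2 * b' (‖x‖ ^ 2)) * ‖φ x‖ ^ 2) +
        2 * M * (p (‖x‖ ^ 2) * gradSqS φ x)) := by
    refine integral_mono h1.norm ((i2.const_mul _).add (hp.const_mul _)) fun x => ?_
    have e : ∑ i, (x i : ℂ) * (∂_{stdVec d i} (mulS (conjS φ) φ)) x =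
        conj (∑ i, (x i : ℂ) * (∂_{stdVec d i} φ) x) * φ x +
          conj (φ x) * ∑ i, (x i : ℂ) * (∂_{stdVec d i} φ) x := by
      rw [map_sum, Finset.sum_mul, Finset.mul_sum, ← Finset.sum_add_distrib]
      refine Finset.sum_congr rfl fun i _ => ?_
      rw [lineDeriv_mulS, lineDeriv_conjS, map_mul, Complex.conj_ofReal, conjS_apply]
      ring
    have hn := norm_sum_coord_mul_le x fun i => (∂_{stdVec d i} φ) x
    change _ ≤ ‖x‖ * √(gradSqS φ x) at hn
    have hn2 : ‖∑ i, (x i : ℂ) * (∂_{stdVec d i} (mulS (conjS φ) φ)) x‖ ≤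
        2 * (‖x‖ * √(gradSqS φ x)) * ‖φ x‖ := by
      rw [e]
      refine (norm_add_le _ _).trans ?_
      rw [norm_mul, norm_mul, RCLike.norm_conj, RCLike.norm_conj]
      nlinarith [mul_le_mul_of_nonneg_right hn (norm_nonneg (φ x))]
    simp only [norm_mul, Complex.norm_real, Real.norm_eq_abs]
    have hs : 0 ≤ ‖x‖ ^ 2 := by positivity
    have hw := hW _ hs
    have hm := hM _ hs
    set W := d * b (‖x‖ ^ 2) + 2 * ‖x‖ ^ 2 * b' (‖x‖ ^ 2) with hWdef
    set B := b (‖x‖ ^ 2) with hB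
    set P := p (‖x‖ ^ 2) with hP
    have hg := gradSqS_nonneg φ x
    set g := √(gradSqS φ x) with hgdef
    have hg2 : gradSqS φ x = g ^ 2 := (Real.sq_sqrt hg).symm
    rw [hg2]
    refine (mul_le_mul_of_nonneg_left hn2 (abs_nonneg _)).trans ?_
    have hB2 : |B| ^ 2 = B ^ 2 := sq_abs B
    -- Young's inequality with the factor `W`
    have hy : 0 ≤ (W * ‖φ x‖ - 2 * |B| * ‖x‖ * g) ^ 2 := sq_nonneg _
    have hm' := mul_le_mul_of_nonneg_right hm (sq_nonneg g)
    refine le_of_mul_le_mul_left ?_ hw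
    have hB3 : (2 * |B| * ‖x‖ * g) ^ 2 = 4 * (‖x‖ ^ 2 * B ^ 2 * g ^ 2) := by
      rw [mul_pow, mul_pow, mul_pow, hB2]; ring
    linarith [sub_sq (W * ‖φ x‖) (2 * |B| * ‖x‖ * g), hB3]
  rw [integral_add (i2.const_mul _) (hp.const_mul _), integral_const_mul, integral_const_mul] at h5
  linarith [h4.trans h5]

/-! ### Hardy inequalities with power and logarithmic weights -/

/-- The increasing function `y (y² + δ²)^(-1/4)`, bounded by `1` on `[-1, 1]`. Its derivative is
comparable to `|y|^(-1/2)` down to the scale `|y| ∼ δ`. -/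
def spike (δ y : ℝ) : ℝ := y * (y ^ 2 + δ ^ 2) ^ (-(1 / 4) : ℝ)

/-- The derivative of `spike δ`. -/
def spikeDeriv (δ y : ℝ) : ℝ :=
  (y ^ 2 + δ ^ 2) ^ (-(1 / 4) : ℝ) - 1 / 2 * (y ^ 2 * (y ^ 2 + δ ^ 2) ^ (-(5 / 4) : ℝ))

theorem hasDerivAt_spike {δ : ℝ} (hδ : 0 < δ) (y : ℝ) :
    HasDerivAt (spike δ) (spikeDeriv δ y) y := by
  have h0 : (0 : ℝ) < y ^ 2 + δ ^ 2 := by positivity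
  have h1 : HasDerivAt (fun y : ℝ => y ^ 2 + δ ^ 2) (2 * y) y := by
    simpa using (hasDerivAt_pow 2 y).add_const (δ ^ 2)
  have h2 := (hasDerivAt_id y).mul (h1.rpow_const (p := (-(1 / 4) : ℝ)) (Or.inl h0.ne'))
  refine h2.congr_deriv ?_
  rw [spikeDeriv, show (-(1 / 4) : ℝ) - 1 = -(5 / 4) by norm_num]
  simp
  ring

theorem spikeDeriv_bounds {δ : ℝ} (hδ : 0 < δ) (y : ℝ) :
    1 / 2 * (y ^ 2 + δ ^ 2) ^ (-(1 / 4) : ℝ) ≤ spikeDeriv δ y ∧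
      spikeDeriv δ y ≤ (δ ^ 2) ^ (-(1 / 4) : ℝ) := by
  have h0 : (0 : ℝ) < y ^ 2 + δ ^ 2 := by positivity
  have h1 : (0 : ℝ) < δ ^ 2 := by positivity
  have hle : y ^ 2 * (y ^ 2 + δ ^ 2) ^ (-(5 / 4) : ℝ) ≤ (y ^ 2 + δ ^ 2) ^ (-(1 / 4) : ℝ) := by
    have : (y ^ 2 + δ ^ 2) ^ (-(1 / 4) : ℝ) =
        (y ^ 2 + δ ^ 2) * (y ^ 2 + δ ^ 2) ^ (-(5 / 4) : ℝ) := by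
      nth_rewrite 2 [← Real.rpow_one (y ^ 2 + δ ^ 2)]
      rw [← Real.rpow_add h0]; norm_num
    rw [this]
    gcongr
    linarith
  have hpos : 0 ≤ y ^ 2 * (y ^ 2 + δ ^ 2) ^ (-(5 / 4) : ℝ) := by positivity
  have hδle : (y ^ 2 + δ ^ 2) ^ (-(1 / 4) : ℝ) ≤ (δ ^ 2) ^ (-(1 / 4) : ℝ) :=
    Real.rpow_le_rpow_of_nonpos h1 (by nlinarith) (by norm_num)
  unfold spikeDeriv
  constructor <;> linarith

theorem abs_spike_le {δ y : ℝ} (hδ : 0 < δ) (hy : |y| ≤ 1) : |spike δ y| ≤ 1 := by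
  have h0 : (0 : ℝ) < y ^ 2 + δ ^ 2 := by positivity
  rw [spike, abs_mul, abs_of_pos (Real.rpow_pos_of_pos h0 _), Real.rpow_neg h0.le,
    ← div_eq_mul_inv, div_le_one (by positivity)]
  have hy2 : y ^ 2 ≤ 1 := by rw [← sq_abs]; nlinarith [abs_nonneg y]
  calc |y| = √(y ^ 2) := (Real.sqrt_sq_eq_abs y).symm
    _ = (y ^ 2) ^ (1 / 2 : ℝ) := Real.sqrt_eq_rpow _
    _ ≤ (y ^ 2) ^ (1 / 4 : ℝ) := by
        rcases (sq_nonneg y).eq_or_lt' with h | h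
        · rw [h]; norm_num
        · exact Real.rpow_le_rpow_of_exponent_ge h hy2 (by norm_num)
    _ ≤ _ := by gcongr; nlinarith

/-- A square of a logarithm is dominated by a square root. -/
theorem log_sq_le {x : ℝ} (hx : 1 ≤ x) : Real.log x ^ 2 ≤ (11 / 5) * x ^ (1 / 2 : ℝ) := by
  have hx0 : 0 < x := by linarith
  have h1 : Real.log x = 4 * Real.log (x ^ (1 / 4 : ℝ)) := by
    rw [Real.log_rpow hx0]; ring
  set w := x ^ (1 / 4 : ℝ) with hw
  have hw1 : 1 ≤ w := Real.one_le_rpow hx (by norm_num)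
  have hw2 : x ^ (1 / 2 : ℝ) = w ^ 2 := by
    rw [hw, ← Real.rpow_natCast, ← Real.rpow_mul hx0.le]; norm_num
  have he : Real.log w ≤ w / Real.exp 1 := by
    have := Real.log_le_sub_one_of_pos (show 0 < w / Real.exp 1 by positivity)
    rw [Real.log_div (by positivity) (by positivity), Real.log_exp] at this
    linarith
  have he2 : w / Real.exp 1 ≤ w * (100 / 271) := by
    rw [div_eq_mul_inv]
    gcongr
    rw [inv_le_comm₀ (by positivity) (by norm_num)]
    have := Real.exp_one_gt_d9
    norm_num at *
    linarith
  have hl0 : 0 ≤ Real.log w := Real.log_nonneg hw1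
  rw [h1, hw2, mul_pow]
  have : Real.log w ^ 2 ≤ (w * (100 / 271)) ^ 2 := by gcongr; exact he.trans he2
  nlinarith [sq_nonneg w]

/-- The size of `log (1 - z)` relative to `|z| = 1 / t`: its square is bounded except for a
singularity at `t = 1`, which is at most an inverse square root of the distance, cut off at the
scale `δ`. -/
theorem norm_log_one_sub_bound {z : ℂ} {t δ : ℝ} (ht : 0 < t) (hz : ‖z‖ = 1 / t) (hδ : 0 < δ)
    (hδz : δ ≤ ‖1 - z‖) :
    t ^ 2 * ‖Complex.log (1 - z)‖ ^ 2 ≤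
      24 + if 1 / 2 < t ∧ t < 3 / 2 then
        6 * ((((t - 1) / (t + 1)) ^ 2 + δ ^ 2) ^ (-(1 / 4) : ℝ)) else 0 := by
  have hpos : ∀ u : ℝ, 0 ≤ u →
      u ≤ 24 → u ≤ 24 + if 1 / 2 < t ∧ t < 3 / 2 then
        6 * ((((t - 1) / (t + 1)) ^ 2 + δ ^ 2) ^ (-(1 / 4) : ℝ)) else 0 := by
    intro u _ hu
    split_ifs
    · have : (0 : ℝ) ≤ 6 * ((((t - 1) / (t + 1)) ^ 2 + δ ^ 2) ^ (-(1 / 4) : ℝ)) := by positivity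
      linarith
    · linarith
  rcases le_or_gt (3 / 2) t with h | h
  -- here `|z| ≤ 2 / 3`, and the Taylor expansion of the logarithm applies
  · refine hpos _ (by positivity) ?_
    have hlt : ‖-z‖ < 1 := by rw [norm_neg, hz, div_lt_one ht]; linarith
    have h1 := Complex.norm_log_one_add_le hlt
    rw [← sub_eq_add_neg, norm_neg, hz] at h1
    have h2 : t * ‖Complex.log (1 - z)‖ ≤ 2 := by
      calc _ ≤ t * ((1 / t) ^ 2 * (1 - 1 / t)⁻¹ / 2 + 1 / t) := by gcongr
        _ = 1 / (2 * (t - 1)) + 1 := by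
            have : t - 1 ≠ 0 := by linarith
            field_simp
        _ ≤ 2 := by
            have : 1 / (2 * (t - 1)) ≤ 1 := by rw [div_le_one (by linarith)]; linarith
            linarith
    rw [← mul_pow]
    nlinarith [mul_nonneg ht.le (norm_nonneg (Complex.log (1 - z)))]
  · have hsq : ‖Complex.log (1 - z)‖ ^ 2 = Real.log ‖1 - z‖ ^ 2 + Complex.arg (1 - z) ^ 2 := by
      rw [Complex.sq_norm, Complex.normSq_apply, Complex.log_re, Complex.log_im]; ring
    have harg : Complex.arg (1 - z) ^ 2 ≤ 10 := by
      have h1 := Complex.abs_arg_le_pi (1 - z)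
      have h2 := Real.pi_lt_d2
      rw [← sq_abs]
      nlinarith [abs_nonneg (Complex.arg (1 - z))]
    have ht2 : t ^ 2 ≤ 9 / 4 := by nlinarith
    have hw0 : 0 < ‖1 - z‖ := hδ.trans_le hδz
    rw [hsq, mul_add]
    have hA : t ^ 2 * Complex.arg (1 - z) ^ 2 ≤ 45 / 2 := by
      nlinarith [sq_nonneg (Complex.arg (1 - z)), sq_nonneg t]
    rcases le_or_gt 1 ‖1 - z‖ with h1 | h1
    · have h2 : Real.log ‖1 - z‖ ≤ 1 / t := by
        have h3 : ‖1 - z‖ ≤ 1 + 1 / t := by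
          rw [← hz]; exact (norm_sub_le _ _).trans (by simp)
        have := Real.log_le_sub_one_of_pos hw0
        linarith
      have h3 : 0 ≤ Real.log ‖1 - z‖ := Real.log_nonneg h1
      have h4 : t * Real.log ‖1 - z‖ ≤ 1 := by
        calc _ ≤ t * (1 / t) := by gcongr
          _ = 1 := by field_simp
      refine hpos _ (by positivity) ?_
      rw [← mul_pow]
      nlinarith [mul_nonneg ht.le h3]
    · have hy1 : |(t - 1) / (t + 1)| ≤ ‖1 - z‖ := by
        have h3 : |1 - 1 / t| ≤ ‖1 - z‖ := by
          have := abs_norm_sub_norm_le (1 : ℂ) z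
          rwa [norm_one, hz] at this
        refine le_trans ?_ h3
        rw [show 1 - 1 / t = (t - 1) / t by field_simp, abs_div, abs_div, abs_of_pos ht,
          abs_of_pos (by linarith : 0 < t + 1)]
        gcongr
        linarith
      have ht1 : 1 / 2 < t := by
        have h3 : 1 / t - 1 ≤ ‖1 - z‖ := by
          have := norm_sub_norm_le z 1
          rwa [norm_one, hz, norm_sub_rev] at this
        have h4 : 1 / t < 2 := by linarith
        rw [div_lt_iff₀ ht] at h4
        linarith
      rw [if_pos ⟨ht1, h⟩]
      set Y := ((t - 1) / (t + 1)) ^ 2 + δ ^ 2 with hY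
      have hY0 : 0 < Y := by positivity
      have hYle : Y ≤ 2 * ‖1 - z‖ ^ 2 := by
        have : ((t - 1) / (t + 1)) ^ 2 ≤ ‖1 - z‖ ^ 2 := by
          rw [← sq_abs]; gcongr
        have : δ ^ 2 ≤ ‖1 - z‖ ^ 2 := by gcongr
        linarith
      have hlog : Real.log ‖1 - z‖ ^ 2 ≤ (11 / 5) * (‖1 - z‖⁻¹) ^ (1 / 2 : ℝ) := by
        have := log_sq_le (x := ‖1 - z‖⁻¹) ((one_le_inv₀ hw0).2 h1.le)
        rwa [Real.log_inv, neg_sq] at this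
      have hr : (‖1 - z‖⁻¹) ^ (1 / 2 : ℝ) ≤ 2 ^ (1 / 4 : ℝ) * Y ^ (-(1 / 4) : ℝ) := by
        have e1 : (‖1 - z‖⁻¹) ^ (1 / 2 : ℝ) =
            2 ^ (1 / 4 : ℝ) * (2 * ‖1 - z‖ ^ 2) ^ (-(1 / 4) : ℝ) := by
          rw [Real.mul_rpow (by norm_num) (by positivity), ← mul_assoc,
            ← Real.rpow_add (by norm_num), ← Real.rpow_natCast, ← Real.rpow_mul hw0.le,
            Real.inv_rpow hw0.le, ← Real.rpow_neg hw0.le]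
          norm_num
        rw [e1]
        refine mul_le_mul_of_nonneg_left ?_ (by positivity)
        exact Real.rpow_le_rpow_of_nonpos hY0 hYle (by norm_num)
      have h14 : (2 : ℝ) ^ (1 / 4 : ℝ) ≤ 119 / 100 := by
        rw [← Real.rpow_le_rpow_iff (z := 4) (by positivity) (by norm_num) (by norm_num),
          ← Real.rpow_mul (by norm_num)]
        norm_num
      have hYr : 0 ≤ Y ^ (-(1 / 4) : ℝ) := by positivity
      have hl : Real.log ‖1 - z‖ ^ 2 ≤ 11 / 5 * (119 / 100 * Y ^ (-(1 / 4) : ℝ)) := by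
        refine hlog.trans ?_
        gcongr
        exact hr.trans (by gcongr)
      have hB : t ^ 2 * Real.log ‖1 - z‖ ^ 2 ≤
          9 / 4 * (11 / 5 * (119 / 100 * Y ^ (-(1 / 4) : ℝ))) := by gcongr
      linarith

/-- `weighted_hardy` for the vector field `β(|x|²) x / q^(k+1)` with `q = |x|² + ε` and an
increasing bounded profile `β`. The divergence is at least `q^(-k-1)` times
`(d - 2 - 2k) β + 2 s β'`, `s = |x|²`, so a steep increase of `β` makes room for a large weight
`w`. -/
theorem profile_hardy {d k : ℕ} (hd : 2 + 2 * k < d) (φ : 𝓢(Space d, ℂ)) {β β' : ℝ → ℝ}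
    {ε C m N : ℝ} (hε : 0 < ε) (hβ : ∀ s, 0 ≤ s → HasDerivAt β (β' s) s)
    (hβ' : ∀ s, 0 ≤ s → 0 ≤ β' s) (hC' : ∀ s, 0 ≤ s → β' s ≤ C) (hm : 0 < m)
    (hβm : ∀ s, 0 ≤ s → m ≤ ((d : ℝ) - 2 - 2 * k) * β s) (hβN : ∀ s, 0 ≤ s → β s ≤ N)
    {w : ℝ → ℝ} (hw : Measurable w) (hw0 : ∀ s, 0 ≤ s → 0 ≤ w s)
    (hwβ : ∀ s, 0 ≤ s → w s ≤ ((d : ℝ) - 2 - 2 * k) * β s + 2 * s * β' s) :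
    Integrable (fun x => w (‖x‖ ^ 2) / (‖x‖ ^ 2 + ε) ^ (k + 1) * ‖φ x‖ ^ 2) ∧
    Integrable (fun x => 1 / (‖x‖ ^ 2 + ε) ^ k * gradSqS φ x) ∧
    ∫ x, w (‖x‖ ^ 2) / (‖x‖ ^ 2 + ε) ^ (k + 1) * ‖φ x‖ ^ 2 ≤
      4 * (N ^ 2 / m) * ∫ x, 1 / (‖x‖ ^ 2 + ε) ^ k * gradSqS φ x := by
  have hD : (0 : ℝ) < (d : ℝ) - 2 - 2 * k := by
    have : ((2 + 2 * k : ℕ) : ℝ) < d := by exact_mod_cast hd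
    push_cast at this
    linarith
  have hβ0 : ∀ s, 0 ≤ s → 0 < β s := fun s hs => by
    by_contra h
    have := hβm s hs
    nlinarith
  have hN : 0 < N := (hβ0 0 le_rfl).trans_le (hβN 0 le_rfl)
  have hq : ∀ s : ℝ, 0 ≤ s → 0 < s + ε := fun s hs => by linarith
  have hqε : ∀ s : ℝ, 0 ≤ s → ∀ j : ℕ, 1 / (s + ε) ^ j ≤ 1 / ε ^ j := fun s hs j => by
    gcongr; linarith
  have hb : ∀ s, 0 ≤ s → HasDerivAt (fun s => β s * (1 / (s + ε) ^ (k + 1)))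
      (β' s * (1 / (s + ε) ^ (k + 1)) - (k + 1) * β s * (1 / (s + ε) ^ (k + 2))) s := by
    intro s hs
    have h1 : HasDerivAt (fun s : ℝ => (s + ε) ^ (k + 1)) ((k + 1) * (s + ε) ^ k) s := by
      simpa using ((hasDerivAt_id s).add_const ε).fun_pow (k + 1)
    have h2 := (hβ s hs).fun_mul ((hasDerivAt_const s (1 : ℝ)).fun_div h1
      (by have := hq s hs; positivity))
    refine h2.congr_deriv ?_
    have := (hq s hs).ne'
    field_simp
    ring
  have hdiv : ∀ s, 0 ≤ s → 1 / (s + ε) ^ (k + 1) *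
        (((d : ℝ) - 2 - 2 * k) * β s + 2 * s * β' s) ≤
      d * (β s * (1 / (s + ε) ^ (k + 1))) + 2 * s * (β' s * (1 / (s + ε) ^ (k + 1)) -
        (k + 1) * β s * (1 / (s + ε) ^ (k + 2))) := by
    intro s hs
    have h0 := hq s hs
    have h1 : s * (1 / (s + ε) ^ (k + 2)) ≤ 1 / (s + ε) ^ (k + 1) := by
      rw [pow_succ (s + ε) (k + 1), mul_one_div, div_le_div_iff₀ (by positivity) (by positivity)]
      have : 0 < (s + ε) ^ (k + 1) := by positivity
      nlinarith
    have h2 := mul_le_mul_of_nonneg_left h1 (by have := hβ0 s hs; positivity : 0 ≤ 2 * (k + 1) * β s)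
    linarith
  have hlow : ∀ s, 0 ≤ s → 1 / (s + ε) ^ (k + 1) * m ≤
      d * (β s * (1 / (s + ε) ^ (k + 1))) + 2 * s * (β' s * (1 / (s + ε) ^ (k + 1)) -
        (k + 1) * β s * (1 / (s + ε) ^ (k + 2))) := by
    intro s hs
    refine le_trans ?_ (hdiv s hs)
    have := hβm s hs
    have := hβ' s hs
    have := hq s hs
    gcongr
    nlinarith
  have hpI : Integrable (fun x : Space d => 1 / (‖x‖ ^ 2 + ε) ^ k * gradSqS φ x) := by
    refine integrable_bounded_mul_gradSqS (C := 1 / ε ^ k) ?_ φ fun x => ?_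
    · refine Measurable.aestronglyMeasurable (by fun_prop)
    · rw [abs_of_nonneg (by positivity)]
      exact hqε _ (by positivity) k
  obtain ⟨h1, h2⟩ := weighted_hardy φ (b := fun s => β s * (1 / (s + ε) ^ (k + 1)))
    (b' := fun s => β' s * (1 / (s + ε) ^ (k + 1)) - (k + 1) * β s * (1 / (s + ε) ^ (k + 2)))
    (p := fun s => 1 / (s + ε) ^ k) (M := N ^ 2 / m)
    (C := N * (1 / ε ^ (k + 1)) + C * (1 / ε ^ (k + 1)) + (k + 1) * N * (1 / ε ^ (k + 2))) hb
    (fun s hs => by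
      have := hβ0 s hs
      have := hβN s hs
      have := hq s hs
      have := hβ' s hs
      have := hC' s hs
      have := hqε s hs (k + 1)
      have hC0 : 0 ≤ C := by linarith
      rw [abs_of_nonneg (by positivity)]
      have : β s * (1 / (s + ε) ^ (k + 1)) ≤ N * (1 / ε ^ (k + 1)) := by gcongr
      have : 0 ≤ C * (1 / ε ^ (k + 1)) + (k + 1) * N * (1 / ε ^ (k + 2)) := by positivity
      linarith)
    (fun s hs => by
      have := hβ0 s hs
      have := hβN s hs
      have := hq s hs
      have := hβ' s hs
      have := hC' s hs
      have := hqε s hs (k + 1)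
      have := hqε s hs (k + 2)
      have hC0 : 0 ≤ C := by linarith
      refine (abs_sub _ _).trans ?_
      rw [abs_of_nonneg (by positivity), abs_of_nonneg (by positivity)]
      have h1 : β' s * (1 / (s + ε) ^ (k + 1)) ≤ C * (1 / ε ^ (k + 1)) := by gcongr
      have h2 : (k + 1) * β s * (1 / (s + ε) ^ (k + 2)) ≤ (k + 1) * N * (1 / ε ^ (k + 2)) := by
        gcongr
      have : 0 ≤ N * (1 / ε ^ (k + 1)) := by positivity
      linarith)
    hpI
    (fun s hs => lt_of_lt_of_le (by have := hq s hs; positivity) (hlow s hs))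
    (fun s hs => by
      have h0 := hq s hs
      have hb0 := hβ0 s hs
      have hbN := hβN s hs
      calc s * (β s * (1 / (s + ε) ^ (k + 1))) ^ 2
          ≤ (s + ε) * (N * (1 / (s + ε) ^ (k + 1))) ^ 2 := by gcongr; linarith
        _ = N ^ 2 / m * (1 / (s + ε) ^ k) * (1 / (s + ε) ^ (k + 1) * m) := by
            field_simp
            rw [pow_succ' _ k]
        _ ≤ _ := mul_le_mul_of_nonneg_left (hlow s hs) (by positivity))
  have hle : ∀ x : Space d, w (‖x‖ ^ 2) / (‖x‖ ^ 2 + ε) ^ (k + 1) * ‖φ x‖ ^ 2 ≤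
      (d * (β (‖x‖ ^ 2) * (1 / (‖x‖ ^ 2 + ε) ^ (k + 1))) + 2 * ‖x‖ ^ 2 *
        (β' (‖x‖ ^ 2) * (1 / (‖x‖ ^ 2 + ε) ^ (k + 1)) -
        (k + 1) * β (‖x‖ ^ 2) * (1 / (‖x‖ ^ 2 + ε) ^ (k + 2)))) * ‖φ x‖ ^ 2 := by
    intro x
    gcongr
    refine le_trans ?_ (hdiv _ (by positivity))
    rw [div_eq_mul_one_div, mul_comm]
    gcongr
    exact hwβ _ (by positivity)
  have hI : Integrable (fun x => w (‖x‖ ^ 2) / (‖x‖ ^ 2 + ε) ^ (k + 1) * ‖φ x‖ ^ 2) := by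
    refine h1.mono' ?_ (.of_forall fun x => ?_)
    · exact (((hw.comp (by fun_prop)).div (by fun_prop)).mul
        (by have := φ.continuous; fun_prop)).aestronglyMeasurable
    · rw [Real.norm_of_nonneg]
      · exact hle x
      · have := hw0 (‖x‖ ^ 2) (by positivity)
        positivity
  exact ⟨hI, hpI, (integral_mono hI h1 hle).trans h2⟩

/-- Hardy's inequality with a regularised weight. -/
theorem hardy_schwartz {d k : ℕ} (hd : 2 + 2 * k < d) (φ : 𝓢(Space d, ℂ)) {ε : ℝ} (hε : 0 < ε) :
    Integrable (fun x => 1 / (‖x‖ ^ 2 + ε) ^ (k + 1) * ‖φ x‖ ^ 2) ∧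
    Integrable (fun x => 1 / (‖x‖ ^ 2 + ε) ^ k * gradSqS φ x) ∧
    ∫ x, 1 / (‖x‖ ^ 2 + ε) ^ (k + 1) * ‖φ x‖ ^ 2 ≤
      (2 / ((d : ℝ) - 2 - 2 * k)) ^ 2 * ∫ x, 1 / (‖x‖ ^ 2 + ε) ^ k * gradSqS φ x := by
  have hD : (0 : ℝ) < (d : ℝ) - 2 - 2 * k := by
    have : ((2 + 2 * k : ℕ) : ℝ) < d := by exact_mod_cast hd
    push_cast at this
    linarith
  have := profile_hardy hd φ (β := fun _ => 1 / ((d : ℝ) - 2 - 2 * k)) (β' := fun _ => 0) (C := 0)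
    (m := 1) (N := 1 / ((d : ℝ) - 2 - 2 * k)) (w := fun _ => 1) hε
    (fun s _ => hasDerivAt_const _ _) (fun _ _ => le_rfl) (fun _ _ => le_rfl) one_pos
    (fun _ _ => by rw [mul_one_div_cancel hD.ne']) (fun _ _ => le_rfl) measurable_const
    (fun _ _ => zero_le_one) (fun _ _ => by rw [mul_one_div_cancel hD.ne']; simp)
  refine ⟨this.1, this.2.1, this.2.2.trans (le_of_eq ?_)⟩
  ring

/-- The square of `q² |log (1 - λ / q²)| / |λ|` with `q = s + ε`: the logarithmic weight of the
resolvent estimate, normalised to be bounded as `q → ∞`. -/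
def logWeight (lam : ℂ) (ε s : ℝ) : ℝ :=
  ((s + ε) ^ 2 / ‖lam‖) ^ 2 * ‖Complex.log (1 - lam / (((s + ε) ^ 2 : ℝ) : ℂ))‖ ^ 2

/-- The distance of `λ / r` from `1` is at least `|sin (arg λ)|`. -/
theorem norm_one_sub_div_ge {lam : ℂ} (h : lam.im ≠ 0) (r : ℝ) :
    |lam.im| / ‖lam‖ ≤ ‖1 - lam / (r : ℂ)‖ := by
  have h0 : lam ≠ 0 := fun h' => h (by rw [h']; rfl)
  have hn : 0 < ‖lam‖ := norm_pos_iff.2 h0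
  rw [div_le_iff₀ hn]
  have h1 : ‖1 - lam / (r : ℂ)‖ * ‖lam‖ = ‖(1 - lam / (r : ℂ)) * conj lam‖ := by
    rw [norm_mul, RCLike.norm_conj]
  rw [h1]
  refine le_trans (le_of_eq ?_) (Complex.abs_im_le_norm _)
  have : (1 - lam / (r : ℂ)) * conj lam = conj lam - (((‖lam‖ ^ 2 / r : ℝ)) : ℂ) := by
    rw [sub_mul, one_mul, div_mul_eq_mul_div, Complex.mul_conj']
    push_cast; ring
  rw [this, Complex.sub_im, Complex.ofReal_im, Complex.conj_im, sub_zero, abs_neg]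

/-- The derivative of `(q² - l) / (q² + l)` with respect to `q`, multiplied by `s`, is bounded below
near the zero `q² = l`. -/
theorem le_mul_div_sq_add_sq {l q s : ℝ} (hl : 0 < l) (hq : 0 < q) (hs : 7 * q ≤ 8 * s)
    (h1 : l ≤ 2 * q ^ 2) (h2 : 2 * q ^ 2 ≤ 3 * l) :
    3 / 4 ≤ s * (4 * l * q / (q ^ 2 + l) ^ 2) := by
  have h3 : 0 ≤ (2 * q ^ 2 - l) * (3 * l - 2 * q ^ 2) :=
    mul_nonneg (by linarith) (by linarith)
  have h4 := mul_le_mul_of_nonneg_right hs (by positivity : 0 ≤ 2 * l * q)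
  rw [mul_div_assoc', div_le_div_iff₀ (by norm_num) (by positivity)]
  nlinarith [sq_nonneg (q ^ 2)]

/-- Hardy inequality with a logarithmically singular weight on the sphere `|x|⁴ = |λ|`, uniformly
in the distance of `λ` from the half-line `[0, ∞)`. -/
theorem log_hardy {d k : ℕ} (hd : 2 + 2 * k < d) (φ : 𝓢(Space d, ℂ)) {lam : ℂ}
    (hlam : lam.im ≠ 0) {ε : ℝ} (hε : 0 < ε) (hεl : 128 * ε ^ 2 ≤ ‖lam‖) :
    Integrable (fun x => logWeight lam ε (‖x‖ ^ 2) / (‖x‖ ^ 2 + ε) ^ (k + 1) * ‖φ x‖ ^ 2) ∧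
    ∫ x, logWeight lam ε (‖x‖ ^ 2) / (‖x‖ ^ 2 + ε) ^ (k + 1) * ‖φ x‖ ^ 2 ≤
      (16 + 24 / ((d : ℝ) - 2 - 2 * k)) ^ 2 / 6 *
        ∫ x, 1 / (‖x‖ ^ 2 + ε) ^ k * gradSqS φ x := by
  have hD : (0 : ℝ) < (d : ℝ) - 2 - 2 * k := by
    have : ((2 + 2 * k : ℕ) : ℝ) < d := by exact_mod_cast hd
    push_cast at this
    linarith
  set D := (d : ℝ) - 2 - 2 * k with hDdef
  have h0 : lam ≠ 0 := fun h' => hlam (by rw [h']; rfl)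
  have hl : 0 < ‖lam‖ := norm_pos_iff.2 h0
  set l := ‖lam‖ with hldef
  set δ := |lam.im| / l with hδdef
  have hδ : 0 < δ := by have := abs_pos.2 hlam; positivity
  set y : ℝ → ℝ := fun s => ((s + ε) ^ 2 - l) / ((s + ε) ^ 2 + l) with hy
  have hyd : ∀ s, 0 ≤ s → HasDerivAt y (4 * l * (s + ε) / ((s + ε) ^ 2 + l) ^ 2) s := by
    intro s hs
    have h1 : HasDerivAt (fun s : ℝ => (s + ε) ^ 2) (2 * (s + ε)) s := by
      simpa using ((hasDerivAt_id s).add_const ε).fun_pow 2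
    refine ((h1.sub_const l).fun_div (h1.add_const l) (by positivity)).congr_deriv ?_
    congr 1
    ring
  have hy1 : ∀ s, |y s| ≤ 1 := by
    intro s
    have h1 : 0 < (s + ε) ^ 2 + l := by positivity
    rw [hy, abs_div, abs_of_pos h1, div_le_one h1, abs_le]
    constructor <;> nlinarith [sq_nonneg (s + ε)]
  have hyb : ∀ s, 0 ≤ s → 4 * l * (s + ε) / ((s + ε) ^ 2 + l) ^ 2 ≤ 1 / ε := by
    intro s hs
    rw [div_le_div_iff₀ (by positivity) hε]
    nlinarith [sq_nonneg ((s + ε) ^ 2 - l), mul_nonneg (mul_nonneg hl.le hs) (by positivity : 0 ≤ s + ε),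
      mul_nonneg (mul_nonneg hl.le hs) hε.le]
  -- `y` maps the radius of the sphere to `0`, and `β` increases steeply there; its constant part
  -- keeps `D β ≥ 24`, which is the bounded part of `norm_log_one_sub_bound`
  have key := profile_hardy hd φ (β := fun s => (8 + 24 / D) + 8 * spike δ (y s))
    (β' := fun s => 8 * (spikeDeriv δ (y s) * (4 * l * (s + ε) / ((s + ε) ^ 2 + l) ^ 2)))
    (C := 8 * ((δ ^ 2) ^ (-(1 / 4) : ℝ) * (1 / ε))) (m := 24) (N := 16 + 24 / D)
    (w := logWeight lam ε) hε
    (fun s hs => ((((hasDerivAt_spike hδ (y s)).comp s (hyd s hs)).const_mul 8).const_add _))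
    (fun s hs => by
      have h1 := (spikeDeriv_bounds hδ (y s)).1
      have h2 : 0 ≤ spikeDeriv δ (y s) := le_trans (by positivity) h1
      positivity)
    (fun s hs => by
      have h1 := (spikeDeriv_bounds hδ (y s)).2
      have := hyb s hs
      gcongr)
    (by norm_num)
    (fun s hs => by
      have h1 := (abs_le.1 (abs_spike_le hδ (hy1 s))).1
      have h2 : D * (8 + 24 / D) = 8 * D + 24 := by field_simp
      change (24 : ℝ) ≤ D * _
      nlinarith)
    (fun s hs => by
      have h1 := (abs_le.1 (abs_spike_le hδ (hy1 s))).2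
      linarith)
    (by unfold logWeight; fun_prop)
    (fun s hs => by unfold logWeight; positivity)
    (fun s hs => by
      have hq : 0 < s + ε := by linarith
      have hq2 : 0 < (s + ε) ^ 2 := by positivity
      have hb := norm_log_one_sub_bound (z := lam / (((s + ε) ^ 2 : ℝ) : ℂ))
        (t := (s + ε) ^ 2 / l) (δ := δ) (by positivity)
        (by rw [norm_div, Complex.norm_real, Real.norm_of_nonneg hq2.le, one_div_div])
        hδ (norm_one_sub_div_ge hlam _)
      have hyt : ((s + ε) ^ 2 / l - 1) / ((s + ε) ^ 2 / l + 1) = y s := by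
        rw [hy]; field_simp
      rw [hyt] at hb
      refine hb.trans ?_
      have h1 := (abs_le.1 (abs_spike_le hδ (hy1 s))).1
      have h2 : D * (8 + 24 / D) = 8 * D + 24 := by field_simp
      have h3 := (spikeDeriv_bounds hδ (y s)).1
      set Y := (y s ^ 2 + δ ^ 2) ^ (-(1 / 4) : ℝ) with hYdef
      have hY : 0 ≤ Y := by positivity
      have h4 : 24 ≤ D * (8 + 24 / D + 8 * spike δ (y s)) := by nlinarith
      set Y' := 4 * l * (s + ε) / ((s + ε) ^ 2 + l) ^ 2 with hY'
      have hY0 : 0 ≤ Y' := by positivity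
      refine add_le_add h4 ?_
      have h5 : 8 * (s * Y') * Y ≤ 2 * s * (8 * (spikeDeriv δ (y s) * Y')) := by
        have := mul_le_mul_of_nonneg_left h3 (by positivity : 0 ≤ 16 * (s * Y'))
        linarith
      split_ifs with ht
      · refine le_trans ?_ h5
        have h6 : 3 / 4 ≤ s * Y' := by
          obtain ⟨ht1, ht2⟩ := ht
          rw [lt_div_iff₀ hl] at ht1
          rw [div_lt_iff₀ hl] at ht2
          have h7 : 8 * ε ≤ s + ε := by
            have : (8 * ε) ^ 2 ≤ (s + ε) ^ 2 := by nlinarith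
            exact (pow_le_pow_iff_left₀ (by positivity) hq.le two_ne_zero).1 this
          exact le_mul_div_sq_add_sq hl hq (by linarith) (by linarith) (by linarith)
        have := mul_le_mul_of_nonneg_right h6 hY
        linarith
      · exact le_trans (by positivity) h5)
  refine ⟨key.1, key.2.2.trans (le_of_eq ?_)⟩
  ring

/-! ### The resolvent estimate on the Fourier side -/

/-- Multiplication of a Schwartz function by the `j`-th coordinate. -/
def coordMul {d : ℕ} (j : Fin d) (η : 𝓢(Space d, ℂ)) : 𝓢(Space d, ℂ) :=
  SchwartzMap.smulLeftCLM ℂ (fun x : Space d => inner ℝ x (stdVec d j)) η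

theorem coordMul_apply {d : ℕ} (j : Fin d) (η : 𝓢(Space d, ℂ)) (x : Space d) :
    coordMul j η x = (x j : ℂ) * η x := by
  have h : (fun x : Space d => inner ℝ x (stdVec d j)).HasTemperateGrowth := by fun_prop
  rw [coordMul, SchwartzMap.smulLeftCLM_apply_apply h]
  simp [EuclideanSpace.inner_single_right]

theorem lineDeriv_coordMul {d : ℕ} (j : Fin d) (η : 𝓢(Space d, ℂ)) (m x : Space d) :
    (∂_{m} (coordMul j η)) x = (m j : ℂ) * η x + (x j : ℂ) * (∂_{m} η) x := by
  simp only [SchwartzMap.lineDerivOp_apply_eq_fderiv]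
  have h3 : HasFDerivAt (fun x : Space d => ((x j : ℝ) : ℂ))
      (Complex.ofRealCLM.comp (EuclideanSpace.proj j : Space d →L[ℝ] ℝ)) x :=
    (Complex.ofRealCLM.comp (EuclideanSpace.proj j : Space d →L[ℝ] ℝ)).hasFDerivAt
  have h2 := h3.mul (η.hasFDerivAt x)
  have e : (coordMul j η : Space d → ℂ) = fun x => (x j : ℂ) * η x :=
    funext fun x => coordMul_apply j η x
  rw [e]
  erw [h2.fderiv]
  simp
  ring

/-- The product `φ̄ (ξ · η)`. -/
def pairS {d : ℕ} (φ : 𝓢(Space d, ℂ)) (η : Fin d → 𝓢(Space d, ℂ)) : 𝓢(Space d, ℂ) :=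
  ∑ j, mulS (conjS φ) (coordMul j (η j))

theorem pairS_apply {d : ℕ} (φ : 𝓢(Space d, ℂ)) (η : Fin d → 𝓢(Space d, ℂ)) (x : Space d) :
    pairS φ η x = conj (φ x) * ∑ j, (x j : ℂ) * η j x := by
  simp [pairS, coordMul_apply, Finset.mul_sum]

/-- The radial derivative `x · ∇φ`. -/
def eulerS {d : ℕ} (φ : 𝓢(Space d, ℂ)) (x : Space d) : ℂ :=
  ∑ i, (x i : ℂ) * (∂_{stdVec d i} φ) x

theorem norm_eulerS_le {d : ℕ} (φ : 𝓢(Space d, ℂ)) (x : Space d) :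
    ‖eulerS φ x‖ ≤ ‖x‖ * √(gradSqS φ x) := by
  unfold eulerS gradSqS
  exact norm_sum_coord_mul_le x _

theorem eulerS_sum {d : ℕ} {ι : Type*} (s : Finset ι) (f : ι → 𝓢(Space d, ℂ)) (x : Space d) :
    eulerS (∑ j ∈ s, f j) x = ∑ j ∈ s, eulerS (f j) x := by
  simp only [eulerS, lineDerivOp_sum, sum_apply, Finset.mul_sum]
  exact Finset.sum_comm

theorem eulerS_conjS {d : ℕ} (φ : 𝓢(Space d, ℂ)) (x : Space d) :
    eulerS (conjS φ) x = conj (eulerS φ x) := by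
  simp only [eulerS, lineDeriv_conjS, map_sum, map_mul, Complex.conj_ofReal]

theorem eulerS_mulS {d : ℕ} (φ ψ : 𝓢(Space d, ℂ)) (x : Space d) :
    eulerS (mulS φ ψ) x = eulerS φ x * ψ x + φ x * eulerS ψ x := by
  simp only [eulerS, lineDeriv_mulS, Finset.mul_sum, Finset.sum_mul, ← Finset.sum_add_distrib]
  exact Finset.sum_congr rfl fun i _ => by ring

theorem eulerS_coordMul {d : ℕ} (j : Fin d) (η : 𝓢(Space d, ℂ)) (x : Space d) :
    eulerS (coordMul j η) x = x j * (η x + eulerS η x) := by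
  have h2 : ∑ i, (x i : ℂ) * ((stdVec d i) j : ℂ) = x j := by
    simp [PiLp.single_apply, apply_ite Complex.ofReal]
  simp only [eulerS, lineDeriv_coordMul, mul_add, Finset.sum_add_distrib, ← mul_assoc,
    ← Finset.sum_mul, h2, Finset.mul_sum]
  congr 1
  exact Finset.sum_congr rfl fun i _ => by ring

theorem eulerS_pairS {d : ℕ} (φ : 𝓢(Space d, ℂ)) (η : Fin d → 𝓢(Space d, ℂ)) (x : Space d) :
    eulerS (pairS φ η) x =
      conj (eulerS φ x) * (∑ j, (x j : ℂ) * η j x) +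
        conj (φ x) * ((∑ j, (x j : ℂ) * η j x) + ∑ j, (x j : ℂ) * eulerS (η j) x) := by
  rw [pairS, eulerS_sum]
  simp only [eulerS_mulS, eulerS_conjS, eulerS_coordMul, coordMul_apply, conjS_apply, mul_add,
    Finset.sum_add_distrib, Finset.mul_sum]

/-- The constant in the weighted resolvent estimate. Its three summands stem from the three terms
of `norm_eulerS_pairS_add_le`; `2 / (d - 2)` and `2 / (d - 4)` are the constants of Hardy's
inequality and of its weighted version, and `10` and `17` bound the square roots of the
constants of `log_hardy` for `k = 0` and `k = 1` when `d ≥ 5`. -/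
def resolventConst (d : ℕ) : ℝ :=
  1 / 4 * (2 / ((d : ℝ) - 2) * 10 + (d + 1) * (2 / ((d : ℝ) - 2) * (2 / ((d : ℝ) - 4))) * 10 +
    2 / ((d : ℝ) - 2) * 17)

/-- Young's inequality for `u² ≤ a² X` and `v² ≤ b² Y`, with the weights for which both terms on the
right become `a b` times `t X` and `Y / t`. -/
theorem young_scaled {a b u v t : ℝ} (ha : 0 < a) (hb : 0 < b) (ht : 0 < t) :
    u * v ≤ 1 / 2 * (t * b / a * u ^ 2 + a / (t * b) * v ^ 2) := by
  have h : 0 ≤ (t * b * u - a * v) ^ 2 := sq_nonneg _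
  have e : 1 / 2 * (t * b / a * u ^ 2 + a / (t * b) * v ^ 2) - u * v =
      (t * b * u - a * v) ^ 2 / (2 * a * (t * b)) := by
    field_simp
    ring
  have : 0 ≤ (t * b * u - a * v) ^ 2 / (2 * a * (t * b)) := by positivity
  linarith

theorem hasDerivAt_log_one_sub {lam : ℂ} (hlam : lam.im ≠ 0) {ε : ℝ} (hε : 0 < ε) {s : ℝ}
    (hs : 0 ≤ s) :
    HasDerivAt (fun s : ℝ => Complex.log (1 - lam / (((s + ε) ^ 2 : ℝ) : ℂ)))
      (2 * lam / ((s + ε : ℝ) * ((((s + ε) ^ 2 : ℝ) : ℂ) - lam))) s := by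
  have hq : 0 < s + ε := by linarith
  have hqc : ((s + ε : ℝ) : ℂ) ≠ 0 := by exact_mod_cast hq.ne'
  have h1 : HasDerivAt (fun s : ℝ => (((s + ε) ^ 2 : ℝ) : ℂ)) ((2 * (s + ε) : ℝ) : ℂ) s := by
    refine HasDerivAt.ofReal_comp ?_
    simpa using ((hasDerivAt_id s).add_const ε).fun_pow 2
  have h2 : HasDerivAt (fun s : ℝ => 1 - lam / (((s + ε) ^ 2 : ℝ) : ℂ)) _ s :=
    ((hasDerivAt_const s lam).fun_div h1
    (by exact_mod_cast (pow_pos hq 2).ne')).const_sub 1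
  have him : (1 - lam / (((s + ε) ^ 2 : ℝ) : ℂ)).im ≠ 0 := by
    rw [Complex.sub_im, Complex.div_ofReal_im]
    simp only [Complex.one_im, zero_sub, ne_eq, neg_eq_zero]
    exact div_ne_zero hlam (by positivity)
  have h0 : (((s + ε : ℝ) : ℂ) ^ 2 - lam) ≠ 0 := by
    intro h
    apply him
    rw [sub_eq_zero] at h
    push_cast at h ⊢
    rw [← h, div_self]
    · simp
    · exact_mod_cast (pow_pos hq 2).ne'
  refine (h2.clog_real (Complex.mem_slitPlane_iff.2 (Or.inr him))).congr_deriv ?_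
  push_cast at h0 hqc ⊢
  field_simp
  ring

theorem norm_ofReal_sub_ge (lam : ℂ) (r : ℝ) : |lam.im| ≤ ‖(r : ℂ) - lam‖ := by
  refine le_trans (le_of_eq ?_) (Complex.abs_im_le_norm _)
  simp

theorem integrable_sum_gradSqS {d : ℕ} (η : Fin d → 𝓢(Space d, ℂ)) :
    Integrable (fun x => ∑ j, gradSqS (η j) x) :=
  integrable_finsetSum _ fun j _ => by
    simpa using integrable_bounded_mul_gradSqS (c := fun _ => 1) (C := 1)
      aestronglyMeasurable_const (η j) (by simp)

/-- The divergence of `x φ̄ (x · η)`, bounded term by term. -/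
theorem norm_eulerS_pairS_add_le {d : ℕ} (φ : 𝓢(Space d, ℂ)) (η : Fin d → 𝓢(Space d, ℂ))
    (x : Space d) :
    ‖eulerS (pairS φ η) x + d * pairS φ η x‖ ≤
      ‖x‖ ^ 2 * (√(gradSqS φ x) * √(∑ j, ‖η j x‖ ^ 2)) +
        (d + 1) * (‖φ x‖ * (‖x‖ * √(∑ j, ‖η j x‖ ^ 2))) +
        ‖x‖ ^ 2 * (‖φ x‖ * √(∑ j, gradSqS (η j) x)) := by
  have h1 := norm_sum_coord_mul_le x fun j => η j x
  have h2 : ‖∑ j, (x j : ℂ) * eulerS (η j) x‖ ≤ ‖x‖ * (‖x‖ * √(∑ j, gradSqS (η j) x)) := by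
    refine (norm_sum_coord_mul_le x fun j => eulerS (η j) x).trans ?_
    gcongr
    refine Real.sqrt_le_iff.2 ⟨by positivity, ?_⟩
    rw [mul_pow, Real.sq_sqrt (Finset.sum_nonneg fun j _ => gradSqS_nonneg _ _), Finset.mul_sum]
    refine Finset.sum_le_sum fun j _ => ?_
    rw [← Real.sq_sqrt (gradSqS_nonneg (η j) x), ← mul_pow]
    gcongr
    exact norm_eulerS_le _ _
  have h3 := norm_eulerS_le φ x
  have e : eulerS (pairS φ η) x + d * pairS φ η x =
      conj (eulerS φ x) * (∑ j, (x j : ℂ) * η j x) +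
        (d + 1 : ℝ) * (conj (φ x) * ∑ j, (x j : ℂ) * η j x) +
        conj (φ x) * ∑ j, (x j : ℂ) * eulerS (η j) x := by
    rw [eulerS_pairS, pairS_apply]
    push_cast
    ring
  rw [e]
  refine (norm_add₃_le).trans ?_
  simp only [norm_mul, RCLike.norm_conj, Complex.norm_real]
  rw [Real.norm_of_nonneg (by positivity)]
  calc _ ≤ (‖x‖ * √(gradSqS φ x)) * (‖x‖ * √(∑ j, ‖η j x‖ ^ 2)) +
        (d + 1) * (‖φ x‖ * (‖x‖ * √(∑ j, ‖η j x‖ ^ 2))) +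
        ‖φ x‖ * (‖x‖ * (‖x‖ * √(∑ j, gradSqS (η j) x))) := by gcongr
    _ = _ := by ring

/-- The integration by parts behind the resolvent estimate: the resolvent symbol is a radial
derivative of a logarithm. -/
theorem resolvent_integration_by_parts {d : ℕ} (Φ : 𝓢(Space d, ℂ)) {lam : ℂ}
    (hlam : lam.im ≠ 0) {ε : ℝ} (hε : 0 < ε) :
    4 * lam * (∫ x, ((‖x‖ ^ 2 : ℝ) : ℂ) /
      ((‖x‖ ^ 2 + ε : ℝ) * ((((‖x‖ ^ 2 + ε) ^ 2 : ℝ) : ℂ) - lam)) * Φ x) =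
      - ∫ x, Complex.log (1 - lam / (((‖x‖ ^ 2 + ε) ^ 2 : ℝ) : ℂ)) * (eulerS Φ x + d * Φ x) := by
  have hl0 : 0 < |lam.im| := abs_pos.2 hlam
  have hlam0 : lam ≠ 0 := fun h' => hlam (by rw [h']; rfl)
  have hl : 0 < ‖lam‖ := norm_pos_iff.2 hlam0
  set b : ℝ → ℂ := fun s => Complex.log (1 - lam / (((s + ε) ^ 2 : ℝ) : ℂ)) with hb
  set b' : ℝ → ℂ := fun s => 2 * lam / ((s + ε : ℝ) * ((((s + ε) ^ 2 : ℝ) : ℂ) - lam)) with hb'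
  have hbC : ∀ s, 0 ≤ s → ‖b s‖ ≤ (|Real.log (|lam.im| / ‖lam‖)| + (1 + ‖lam‖ / ε ^ 2) + Real.pi) +
      2 * ‖lam‖ / (ε * |lam.im|) := by
    intro s hs
    have h1 := norm_one_sub_div_ge hlam ((s + ε) ^ 2)
    have h2 : ‖1 - lam / (((s + ε) ^ 2 : ℝ) : ℂ)‖ ≤ 1 + ‖lam‖ / ε ^ 2 := by
      refine (norm_sub_le _ _).trans ?_
      rw [norm_one, norm_div, Complex.norm_real, Real.norm_of_nonneg (by positivity)]
      gcongr
      linarith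
    have h0 : 0 < |lam.im| / ‖lam‖ := by positivity
    have h3 : |Real.log ‖1 - lam / (((s + ε) ^ 2 : ℝ) : ℂ)‖| ≤
        |Real.log (|lam.im| / ‖lam‖)| + (1 + ‖lam‖ / ε ^ 2) := by
      rw [abs_le]
      have h4 := Real.log_le_log h0 h1
      have h5 := neg_abs_le (Real.log (|lam.im| / ‖lam‖))
      have h6 := Real.log_le_sub_one_of_pos (h0.trans_le h1)
      have h7 : 0 ≤ 1 + ‖lam‖ / ε ^ 2 := by positivity
      have h8 := abs_nonneg (Real.log (|lam.im| / ‖lam‖))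
      constructor <;> linarith
    have h9 : ‖b s‖ ≤ |(b s).re| + |(b s).im| := Complex.norm_le_abs_re_add_abs_im _
    rw [hb] at h9 ⊢
    simp only [Complex.log_re, Complex.log_im] at h9
    have h10 := Complex.abs_arg_le_pi (1 - lam / (((s + ε) ^ 2 : ℝ) : ℂ))
    have h11 : 0 ≤ 2 * ‖lam‖ / (ε * |lam.im|) := by positivity
    linarith
  have hbC' : ∀ s, 0 ≤ s → ‖b' s‖ ≤ (|Real.log (|lam.im| / ‖lam‖)| + (1 + ‖lam‖ / ε ^ 2) +
      Real.pi) + 2 * ‖lam‖ / (ε * |lam.im|) := by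
    intro s hs
    have h1 : 0 ≤ |Real.log (|lam.im| / ‖lam‖)| + (1 + ‖lam‖ / ε ^ 2) + Real.pi := by
      have := Real.pi_pos
      positivity
    have h2 : ‖b' s‖ ≤ 2 * ‖lam‖ / (ε * |lam.im|) := by
      rw [hb', norm_div, norm_mul, norm_mul, Complex.norm_real, Real.norm_of_nonneg (by positivity)]
      have := norm_ofReal_sub_ge lam ((s + ε) ^ 2)
      have h3 : ε ≤ s + ε := by linarith
      rw [Complex.norm_ofNat]
      gcongr
    linarith
  obtain ⟨e1, e2, e3⟩ := integral_radial_euler Φ (b := b) (b' := b')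
    (fun s hs => hasDerivAt_log_one_sub hlam hε hs) hbC hbC'
  have hbm : Measurable fun x : Space d => b (‖x‖ ^ 2) := by
    rw [hb]; fun_prop
  have e4 : Integrable fun x => d * (b (‖x‖ ^ 2) * Φ x) :=
    (integrable_bounded_mul hbm.aestronglyMeasurable _ fun x => hbC _ (by positivity)).const_mul _
  have h1 : ∫ x, b (‖x‖ ^ 2) * (eulerS Φ x + d * Φ x) =
      (∫ x, b (‖x‖ ^ 2) * ∑ i, (x i : ℂ) * (∂_{stdVec d i} Φ) x) +
        ∫ x, d * (b (‖x‖ ^ 2) * Φ x) := by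
    rw [← integral_add e1 e4]
    refine integral_congr_ae (.of_forall fun x => ?_)
    simp only [eulerS]
    ring
  change _ = - ∫ x, b (‖x‖ ^ 2) * (eulerS Φ x + d * Φ x)
  rw [h1, e3, neg_add, neg_neg, ← sub_eq_add_neg, ← integral_sub e2 e4, ← integral_const_mul]
  refine integral_congr_ae (.of_forall fun x => ?_)
  simp only [hb']
  push_cast
  ring

/-- Three instances of `young_scaled`, one for each term of `norm_eulerS_pairS_add_le`, in the form
needed under the integral sign. -/
theorem young_three {a₁ a₂ a₃ t L q r g e f h w D : ℝ} (ha₁ : 0 < a₁) (ha₂ : 0 < a₂) (ha₃ : 0 < a₃)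
    (ht : 0 < t) (hL : 0 ≤ L) (hq : 0 < q) (hrq : r ^ 2 ≤ q) (hg : 0 ≤ g)
    (he : 0 ≤ e) (hf : 0 ≤ f) (hh : 0 ≤ h) (hw : 0 ≤ w) (hD : 0 ≤ D) :
    L * w / q ^ 2 * (r ^ 2 * (g * e) + D * (f * (r * e)) + r ^ 2 * (f * h)) ≤
      L * (1 / 2) *
        ((t * 10 / a₁ * (1 / q ^ 1 * g ^ 2) + a₁ / (t * 10) * (w ^ 2 / q * e ^ 2)) +
        D * (t * 10 / a₂ * (1 / q ^ 2 * f ^ 2) + a₂ / (t * 10) * (w ^ 2 / q * e ^ 2)) +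
        (t * 1 / a₃ * (w ^ 2 / q ^ 2 * f ^ 2) + a₃ / (t * 1) * h ^ 2)) := by
  have hrq' : r ^ 2 / q ≤ 1 := (div_le_one hq).2 hrq
  have y1 : w / q ^ 2 * (r ^ 2 * (g * e)) ≤
      1 / 2 * (t * 10 / a₁ * (1 / q ^ 1 * g ^ 2) + a₁ / (t * 10) * (w ^ 2 / q * e ^ 2)) := by
    have h1 := young_scaled (u := g) (v := w * e) ha₁ (by norm_num : (0 : ℝ) < 10) ht
    calc w / q ^ 2 * (r ^ 2 * (g * e)) = r ^ 2 / q * (1 / q * (g * (w * e))) := by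
          field_simp
      _ ≤ 1 * (1 / q * (g * (w * e))) := by gcongr
      _ ≤ 1 * (1 / q * (1 / 2 * (t * 10 / a₁ * g ^ 2 + a₁ / (t * 10) * (w * e) ^ 2))) := by gcongr
      _ = _ := by field_simp
  have y2 : w / q ^ 2 * (f * (r * e)) ≤
      1 / 2 * (t * 10 / a₂ * (1 / q ^ 2 * f ^ 2) + a₂ / (t * 10) * (w ^ 2 / q * e ^ 2)) := by
    have h1 := young_scaled (u := f / q) (v := w * r * e / q) ha₂ (by norm_num : (0 : ℝ) < 10) ht
    calc w / q ^ 2 * (f * (r * e)) = f / q * (w * r * e / q) := by field_simp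
      _ ≤ _ := h1
      _ = 1 / 2 * (t * 10 / a₂ * (1 / q ^ 2 * f ^ 2) + a₂ / (t * 10) *
            (w ^ 2 / q * e ^ 2 * (r ^ 2 / q))) := by field_simp
      _ ≤ 1 / 2 * (t * 10 / a₂ * (1 / q ^ 2 * f ^ 2) + a₂ / (t * 10) *
            (w ^ 2 / q * e ^ 2 * 1)) := by gcongr
      _ = _ := by ring
  have y3 : w / q ^ 2 * (r ^ 2 * (f * h)) ≤
      1 / 2 * (t * 1 / a₃ * (w ^ 2 / q ^ 2 * f ^ 2) + a₃ / (t * 1) * h ^ 2) := by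
    have h1 := young_scaled (u := w / q * f) (v := h) ha₃ (by norm_num : (0 : ℝ) < 1) ht
    calc w / q ^ 2 * (r ^ 2 * (f * h)) = r ^ 2 / q * (w / q * f * h) := by field_simp
      _ ≤ 1 * (w / q * f * h) := by gcongr
      _ ≤ 1 * (1 / 2 * (t * 1 / a₃ * (w / q * f) ^ 2 + a₃ / (t * 1) * h ^ 2)) := by gcongr
      _ = _ := by field_simp
  have y2' := mul_le_mul_of_nonneg_left y2 hD
  have := mul_le_mul_of_nonneg_left (add_le_add (add_le_add y1 y2') y3) hL
  calc _ = L * (w / q ^ 2 * (r ^ 2 * (g * e)) + D * (w / q ^ 2 * (f * (r * e))) +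
        w / q ^ 2 * (r ^ 2 * (f * h))) := by ring
    _ ≤ _ := this
    _ = _ := by ring

/-- Linearity of the integral for the right-hand side of `young_three`. -/
theorem integral_combination {d : ℕ} {f₁ f₂ f₃ f₄ f₅ : Space d → ℝ} (h₁ : Integrable f₁)
    (h₂ : Integrable f₂) (h₃ : Integrable f₃) (h₄ : Integrable f₄) (h₅ : Integrable f₅)
    (L D c₁ c₂ c₃ c₄ c₅ c₆ : ℝ) :
    Integrable (fun x => L * ((c₁ * f₁ x + c₂ * f₂ x) + D * (c₃ * f₃ x + c₄ * f₂ x) +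
      (c₅ * f₄ x + c₆ * f₅ x))) ∧
    ∫ x, L * ((c₁ * f₁ x + c₂ * f₂ x) + D * (c₃ * f₃ x + c₄ * f₂ x) +
      (c₅ * f₄ x + c₆ * f₅ x)) =
      L * ((c₁ * (∫ x, f₁ x) + c₂ * ∫ x, f₂ x) + D * (c₃ * (∫ x, f₃ x) + c₄ * ∫ x, f₂ x) +
      (c₅ * (∫ x, f₄ x) + c₆ * ∫ x, f₅ x)) := by
  have r1 : Integrable fun x => c₁ * f₁ x + c₂ * f₂ x := (h₁.const_mul _).add (h₂.const_mul _)
  have r2 : Integrable fun x => D * (c₃ * f₃ x + c₄ * f₂ x) :=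
    ((h₃.const_mul _).add (h₂.const_mul _)).const_mul _
  have r3 : Integrable fun x => c₅ * f₄ x + c₆ * f₅ x := (h₄.const_mul _).add (h₅.const_mul _)
  have r12 : Integrable fun x => (c₁ * f₁ x + c₂ * f₂ x) + D * (c₃ * f₃ x + c₄ * f₂ x) := r1.add r2
  refine ⟨(r12.add r3).const_mul _, ?_⟩
  rw [integral_const_mul, integral_add r12 r3, integral_add r1 r2, integral_const_mul D,
    integral_add (h₁.const_mul _) (h₂.const_mul _), integral_add (h₃.const_mul _) (h₂.const_mul _),
    integral_add (h₄.const_mul _) (h₅.const_mul _)]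
  simp only [integral_const_mul]

/-- The resolvent estimate on the Fourier side, with regularised weights. The parameter `t` is free,
so the right-hand side amounts to a product of two square roots. -/
theorem resolvent_bilinear_regularised {d : ℕ} (hd : 5 ≤ d) (φ : 𝓢(Space d, ℂ))
    (η : Fin d → 𝓢(Space d, ℂ)) {lam : ℂ} (hlam : lam.im ≠ 0) {ε : ℝ} (hε : 0 < ε)
    (hεl : 128 * ε ^ 2 ≤ ‖lam‖) {t : ℝ} (ht : 0 < t) :
    ‖∫ x, ((‖x‖ ^ 2 : ℝ) : ℂ) / ((‖x‖ ^ 2 + ε : ℝ) * ((((‖x‖ ^ 2 + ε) ^ 2 : ℝ) : ℂ) - lam)) *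
        pairS φ η x‖ ≤
      resolventConst d / 2 * (t * (∫ x, ∑ i, gradSqS (∂_{stdVec d i} φ) x) +
        (∫ x, ∑ j, gradSqS (η j) x) / t) := by
  have hd5 : (5 : ℝ) ≤ d := by exact_mod_cast hd
  have hl0 : 0 < |lam.im| := abs_pos.2 hlam
  have hlam0 : lam ≠ 0 := fun h' => hlam (by rw [h']; rfl)
  have hl : 0 < ‖lam‖ := norm_pos_iff.2 hlam0
  set X := ∫ x, ∑ i, gradSqS (∂_{stdVec d i} φ) x with hX
  set Y := ∫ x, ∑ j, gradSqS (η j) x with hY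
  -- the weighted Hardy inequalities
  have gradSum : ∀ x, ∑ i, 1 / (‖x‖ ^ 2 + ε) ^ (0 + 1) * ‖(∂_{stdVec d i} φ) x‖ ^ 2 =
      1 / (‖x‖ ^ 2 + ε) ^ 1 * gradSqS φ x := fun x => by
    rw [gradSqS, Finset.mul_sum]
  have hp1 : Integrable (fun x => 1 / (‖x‖ ^ 2 + ε) ^ 1 * gradSqS φ x) ∧
      ∫ x, 1 / (‖x‖ ^ 2 + ε) ^ 1 * gradSqS φ x ≤ (2 / ((d : ℝ) - 2)) ^ 2 * X := by
    have h := fun i => hardy_schwartz (k := 0) (by omega) (∂_{stdVec d i} φ) hε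
    simp only [← gradSum]
    refine ⟨integrable_finsetSum _ fun i _ => (h i).1, ?_⟩
    rw [hX, integral_finsetSum _ fun i _ => (h i).1, integral_finsetSum, Finset.mul_sum]
    · refine Finset.sum_le_sum fun i _ => (h i).2.2.trans (le_of_eq ?_)
      simp
    · intro i _
      simpa using (h i).2.1
  have hp2 : Integrable (fun x => 1 / (‖x‖ ^ 2 + ε) ^ 2 * ‖φ x‖ ^ 2) ∧
      ∫ x, 1 / (‖x‖ ^ 2 + ε) ^ 2 * ‖φ x‖ ^ 2 ≤
        (2 / ((d : ℝ) - 2) * (2 / ((d : ℝ) - 4))) ^ 2 * X := by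
    have h := hardy_schwartz (k := 1) (by omega) φ hε
    refine ⟨h.1, h.2.2.trans ?_⟩
    calc _ ≤ (2 / ((d : ℝ) - 2 - 2 * (1 : ℕ))) ^ 2 * ((2 / ((d : ℝ) - 2)) ^ 2 * X) := by
          gcongr; exact hp1.2
      _ = _ := by rw [Nat.cast_one, show (d : ℝ) - 2 - 2 * 1 = d - 4 by ring]; ring
  have hn1 : Integrable (fun x => logWeight lam ε (‖x‖ ^ 2) / (‖x‖ ^ 2 + ε) ^ 2 * ‖φ x‖ ^ 2) ∧
      ∫ x, logWeight lam ε (‖x‖ ^ 2) / (‖x‖ ^ 2 + ε) ^ 2 * ‖φ x‖ ^ 2 ≤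
        (2 / ((d : ℝ) - 2) * 17) ^ 2 * X := by
    have h := log_hardy (k := 1) (by omega) φ hlam hε hεl
    refine ⟨h.1, h.2.trans ?_⟩
    have hc : (16 + 24 / ((d : ℝ) - 2 - 2 * (1 : ℕ))) ^ 2 / 6 ≤ 17 ^ 2 := by
      rw [Nat.cast_one, show (d : ℝ) - 2 - 2 * 1 = d - 4 by ring]
      have h1 : 24 / ((d : ℝ) - 4) ≤ 24 := by
        rw [div_le_iff₀ (by linarith)]; linarith
      have h2 : 0 ≤ 24 / ((d : ℝ) - 4) := div_nonneg (by norm_num) (by linarith)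
      nlinarith
    have h0 : 0 ≤ ∫ x, 1 / (‖x‖ ^ 2 + ε) ^ 1 * gradSqS φ x :=
      integral_nonneg fun x => mul_nonneg (by positivity) (gradSqS_nonneg _ _)
    calc _ ≤ 17 ^ 2 * ((2 / ((d : ℝ) - 2)) ^ 2 * X) := by gcongr; exact hp1.2
      _ = _ := by ring
  have hn0 : Integrable (fun x => logWeight lam ε (‖x‖ ^ 2) / (‖x‖ ^ 2 + ε) *
        ∑ j, ‖η j x‖ ^ 2) ∧
      ∫ x, logWeight lam ε (‖x‖ ^ 2) / (‖x‖ ^ 2 + ε) * ∑ j, ‖η j x‖ ^ 2 ≤ 10 ^ 2 * Y := by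
    have h := fun j => log_hardy (k := 0) (by omega) (η j) hlam hε hεl
    simp only [zero_add, pow_one] at h
    simp only [Finset.mul_sum]
    refine ⟨integrable_finsetSum _ fun i _ => (h i).1, ?_⟩
    rw [hY, integral_finsetSum _ fun i _ => (h i).1, integral_finsetSum, Finset.mul_sum]
    · refine Finset.sum_le_sum fun j _ => (h j).2.trans ?_
      have hc : (16 + 24 / ((d : ℝ) - 2 - 2 * (0 : ℕ))) ^ 2 / 6 ≤ 10 ^ 2 := by
        rw [Nat.cast_zero, mul_zero, sub_zero]
        have h1 : 24 / ((d : ℝ) - 2) ≤ 8 := by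
          rw [div_le_iff₀ (by linarith)]; linarith
        have h2 : 0 ≤ 24 / ((d : ℝ) - 2) := div_nonneg (by norm_num) (by linarith)
        nlinarith
      have h0 : 0 ≤ ∫ x, gradSqS (η j) x := integral_nonneg fun x => gradSqS_nonneg _ _
      simp only [pow_zero, ne_eq, one_ne_zero, not_false_eq_true, div_self, one_mul]
      gcongr
    · intro j _
      simpa using integrable_bounded_mul_gradSqS (c := fun _ => 1) (C := 1)
        aestronglyMeasurable_const (η j) (by simp)
  have hYi : Integrable (fun x => ∑ j, gradSqS (η j) x) := integrable_sum_gradSqS η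
  have e5 := resolvent_integration_by_parts (pairS φ η) hlam hε
  -- pointwise bound
  have hpt : ∀ x, ‖Complex.log (1 - lam / (((‖x‖ ^ 2 + ε) ^ 2 : ℝ) : ℂ)) *
        (eulerS (pairS φ η) x + d * pairS φ η x)‖ ≤ ‖lam‖ * (1 / 2) *
      ((t * 10 / (2 / ((d : ℝ) - 2)) * (1 / (‖x‖ ^ 2 + ε) ^ 1 * gradSqS φ x) +
        2 / ((d : ℝ) - 2) / (t * 10) *
          (logWeight lam ε (‖x‖ ^ 2) / (‖x‖ ^ 2 + ε) * ∑ j, ‖η j x‖ ^ 2)) +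
      (d + 1) * (t * 10 / (2 / ((d : ℝ) - 2) * (2 / ((d : ℝ) - 4))) *
          (1 / (‖x‖ ^ 2 + ε) ^ 2 * ‖φ x‖ ^ 2) +
        2 / ((d : ℝ) - 2) * (2 / ((d : ℝ) - 4)) / (t * 10) *
          (logWeight lam ε (‖x‖ ^ 2) / (‖x‖ ^ 2 + ε) * ∑ j, ‖η j x‖ ^ 2)) +
      (t * 1 / (2 / ((d : ℝ) - 2) * 17) *
          (logWeight lam ε (‖x‖ ^ 2) / (‖x‖ ^ 2 + ε) ^ 2 * ‖φ x‖ ^ 2) +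
        2 / ((d : ℝ) - 2) * 17 / (t * 1) * ∑ j, gradSqS (η j) x)) := by
    intro x
    have hq : 0 < ‖x‖ ^ 2 + ε := by positivity
    have h1 := norm_eulerS_pairS_add_le φ η x
    have hp : 0 < 2 / ((d : ℝ) - 2) := div_pos two_pos (by linarith)
    have hp' : 0 < 2 / ((d : ℝ) - 4) := div_pos two_pos (by linarith)
    have h2 := young_three (a₁ := 2 / ((d : ℝ) - 2)) (a₂ := 2 / ((d : ℝ) - 2) * (2 / ((d : ℝ) - 4)))
      (a₃ := 2 / ((d : ℝ) - 2) * 17) (t := t) (L := ‖lam‖) (q := ‖x‖ ^ 2 + ε) (r := ‖x‖)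
      (g := √(gradSqS φ x)) (e := √(∑ j, ‖η j x‖ ^ 2)) (f := ‖φ x‖) (h := √(∑ j, gradSqS (η j) x))
      (w := (‖x‖ ^ 2 + ε) ^ 2 / ‖lam‖ *
        ‖Complex.log (1 - lam / (((‖x‖ ^ 2 + ε) ^ 2 : ℝ) : ℂ))‖) (D := d + 1)
      hp (by positivity) (by positivity) ht hl.le hq (by linarith) (Real.sqrt_nonneg _)
      (Real.sqrt_nonneg _) (norm_nonneg _) (Real.sqrt_nonneg _) (by positivity) (by positivity)
    rw [Real.sq_sqrt (gradSqS_nonneg _ _), Real.sq_sqrt (Finset.sum_nonneg fun j _ => by positivity),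
      Real.sq_sqrt (Finset.sum_nonneg fun j _ => gradSqS_nonneg _ _), mul_pow _ ‖Complex.log _‖] at h2
    refine le_trans ?_ h2
    rw [norm_mul]
    have h3 : ‖lam‖ * ((‖x‖ ^ 2 + ε) ^ 2 / ‖lam‖ *
        ‖Complex.log (1 - lam / (((‖x‖ ^ 2 + ε) ^ 2 : ℝ) : ℂ))‖) / (‖x‖ ^ 2 + ε) ^ 2 =
        ‖Complex.log (1 - lam / (((‖x‖ ^ 2 + ε) ^ 2 : ℝ) : ℂ))‖ := by
      field_simp
    rw [h3]
    gcongr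
  have hp : 0 < 2 / ((d : ℝ) - 2) := div_pos two_pos (by linarith)
  have hp' : 0 < 2 / ((d : ℝ) - 4) := div_pos two_pos (by linarith)
  obtain ⟨r1, r2⟩ := integral_combination hp1.1 hn0.1 hp2.1 hn1.1 hYi (‖lam‖ * (1 / 2)) (d + 1)
    (t * 10 / (2 / ((d : ℝ) - 2))) (2 / ((d : ℝ) - 2) / (t * 10))
    (t * 10 / (2 / ((d : ℝ) - 2) * (2 / ((d : ℝ) - 4))))
    (2 / ((d : ℝ) - 2) * (2 / ((d : ℝ) - 4)) / (t * 10))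
    (t * 1 / (2 / ((d : ℝ) - 2) * 17)) (2 / ((d : ℝ) - 2) * 17 / (t * 1))
  have hle := norm_integral_le_of_norm_le r1 (.of_forall hpt)
  rw [r2] at hle
  have e6 := congrArg norm e5
  rw [norm_neg, norm_mul, norm_mul, Complex.norm_ofNat] at e6
  rw [← e6] at hle
  refine le_of_mul_le_mul_left (hle.trans ?_) (by positivity : 0 < 4 * ‖lam‖)
  set p := 2 / ((d : ℝ) - 2) with hpdef
  set p' := 2 / ((d : ℝ) - 4) with hpdef'
  have b1 := hp1.2
  have b2 := hp2.2
  have b3 := hn1.2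
  have b4 := hn0.2
  calc _ ≤ ‖lam‖ * (1 / 2) * ((t * 10 / p * (p ^ 2 * X) + p / (t * 10) * (10 ^ 2 * Y)) +
        (d + 1) * (t * 10 / (p * p') * ((p * p') ^ 2 * X) + p * p' / (t * 10) * (10 ^ 2 * Y)) +
        (t * 1 / (p * 17) * ((p * 17) ^ 2 * X) + p * 17 / (t * 1) * Y)) := by gcongr
    _ = _ := by
      rw [resolventConst, ← hpdef, ← hpdef']
      field_simp

/-- The resolvent estimate on the Fourier side, obtained from `resolvent_bilinear_regularised` as
`ε → 0`. -/
theorem resolvent_bilinear {d : ℕ} (hd : 5 ≤ d) (φ : 𝓢(Space d, ℂ))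
    (η : Fin d → 𝓢(Space d, ℂ)) {lam : ℂ} (hlam : lam.im ≠ 0) {t : ℝ} (ht : 0 < t) :
    ‖∫ x, ((((‖x‖ ^ 2) ^ 2 : ℝ) : ℂ) - lam)⁻¹ * pairS φ η x‖ ≤
      resolventConst d / 2 * (t * (∫ x, ∑ i, gradSqS (∂_{stdVec d i} φ) x) +
        (∫ x, ∑ j, gradSqS (η j) x) / t) := by
  have hlam0 : lam ≠ 0 := fun h' => hlam (by rw [h']; rfl)
  have hl : 0 < ‖lam‖ := norm_pos_iff.2 hlam0
  have hl0 : 0 < |lam.im| := abs_pos.2 hlam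
  have h0 : ∀ r : ℝ, (r : ℂ) - lam ≠ 0 := fun r =>
    norm_pos_iff.1 (hl0.trans_le (norm_ofReal_sub_ge lam r))
  have hpos : ∀ᶠ ε : ℝ in nhdsWithin 0 (Set.Ioi 0), 0 < ε := self_mem_nhdsWithin
  have hsmall : ∀ᶠ ε : ℝ in nhdsWithin 0 (Set.Ioi 0), 128 * ε ^ 2 ≤ ‖lam‖ := by
    have : Filter.Tendsto (fun ε : ℝ => 128 * ε ^ 2) (nhdsWithin 0 (Set.Ioi 0)) (nhds 0) := by
      have h : Filter.Tendsto (fun ε : ℝ => 128 * ε ^ 2) (nhds 0) (nhds (128 * 0 ^ 2)) :=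
        Continuous.tendsto (by fun_prop) 0
      simpa using h.mono_left nhdsWithin_le_nhds
    exact this.eventually_le_const hl
  have hlim : Filter.Tendsto (fun ε : ℝ => ∫ x, ((‖x‖ ^ 2 : ℝ) : ℂ) /
      ((‖x‖ ^ 2 + ε : ℝ) * ((((‖x‖ ^ 2 + ε) ^ 2 : ℝ) : ℂ) - lam)) * pairS φ η x)
      (nhdsWithin 0 (Set.Ioi 0))
      (nhds (∫ x, ((((‖x‖ ^ 2) ^ 2 : ℝ) : ℂ) - lam)⁻¹ * pairS φ η x)) := by
    refine tendsto_integral_filter_of_dominated_convergence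
      (fun x => 1 / |lam.im| * ‖pairS φ η x‖) ?_ ?_ ?_ ?_
    · refine .of_forall fun ε => Measurable.aestronglyMeasurable ?_
      have := (pairS φ η).continuous
      fun_prop
    · filter_upwards [hpos] with ε hε
      refine .of_forall fun x => ?_
      rw [norm_mul, norm_div, norm_mul, Complex.norm_real, Complex.norm_real,
        Real.norm_of_nonneg (by positivity), Real.norm_of_nonneg (by positivity)]
      refine mul_le_mul_of_nonneg_right ?_ (norm_nonneg _)
      have h1 := norm_ofReal_sub_ge lam ((‖x‖ ^ 2 + ε) ^ 2)
      rw [div_le_div_iff₀ (mul_pos (by positivity) (hl0.trans_le h1)) hl0, one_mul]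
      gcongr
      linarith
    · exact (pairS φ η).integrable.norm.const_mul _
    · refine .of_forall fun x => ?_
      rcases eq_or_ne x 0 with rfl | hx
      · have : pairS φ η 0 = 0 := by rw [pairS_apply]; simp
        simp [this]
      · have hx2 : ((‖x‖ ^ 2 : ℝ) : ℂ) ≠ 0 := by
          have : ‖x‖ ^ 2 ≠ 0 := by simpa using hx
          exact_mod_cast this
        have hc : ContinuousAt (fun ε : ℝ => ((‖x‖ ^ 2 : ℝ) : ℂ) /
            ((‖x‖ ^ 2 + ε : ℝ) * ((((‖x‖ ^ 2 + ε) ^ 2 : ℝ) : ℂ) - lam)) * pairS φ η x) 0 := by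
          refine ContinuousAt.mul (ContinuousAt.div (by fun_prop) (by fun_prop) ?_) (by fun_prop)
          rw [add_zero]
          exact mul_ne_zero hx2 (h0 _)
        have hc' := hc.tendsto.mono_left (nhdsWithin_le_nhds (s := Set.Ioi 0))
        simp only [add_zero] at hc'
        rwa [← div_div, div_self hx2, one_div] at hc'
  refine le_of_tendsto hlim.norm ?_
  filter_upwards [hpos, hsmall] with ε hε hε'
  exact resolvent_bilinear_regularised hd φ η hlam hε hε' ht

/-! ### The resolvent of the bilaplacian on Schwartz functions -/

open scoped FourierTransform

theorem iteratedDeriv_inv_ofReal_sub {μ : ℂ} (hμ : μ.im ≠ 0) (n : ℕ) :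
    iteratedDeriv n (fun s : ℝ => ((s : ℂ) - μ)⁻¹) =
      fun s : ℝ => (-1) ^ n * n.factorial * (((s : ℂ) - μ)⁻¹) ^ (n + 1) := by
  have h0 : ∀ s : ℝ, (s : ℂ) - μ ≠ 0 := fun s =>
    norm_pos_iff.1 ((abs_pos.2 hμ).trans_le (norm_ofReal_sub_ge μ s))
  induction n with
  | zero => ext s; simp
  | succ n ih =>
    rw [iteratedDeriv_succ, ih]
    ext s
    have h1 : HasDerivAt (fun s : ℝ => ((s : ℂ) - μ)⁻¹) (-1 / ((s : ℂ) - μ) ^ 2) s := by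
      have := (Complex.ofRealCLM.hasDerivAt (x := s)).sub_const μ
      exact this.fun_inv (h0 s)
    have h2 := ((h1.fun_pow (n + 1)).const_mul ((-1) ^ n * (n.factorial : ℂ))).deriv
    rw [h2, Nat.factorial_succ]
    have e : -1 / ((s : ℂ) - μ) ^ 2 = -(((s : ℂ) - μ)⁻¹) ^ 2 := by
      rw [inv_pow, neg_div, one_div]
    rw [e, Nat.add_sub_cancel]
    push_cast
    ring

/-- The resolvent symbol `s ↦ (s - μ)⁻¹` on the real line has temperate growth. -/
theorem hasTemperateGrowth_inv_ofReal_sub {μ : ℂ} (hμ : μ.im ≠ 0) :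
    (fun s : ℝ => ((s : ℂ) - μ)⁻¹).HasTemperateGrowth := by
  have hpos := abs_pos.2 hμ
  have h0 : ∀ s : ℝ, (s : ℂ) - μ ≠ 0 := fun s =>
    norm_pos_iff.1 (hpos.trans_le (norm_ofReal_sub_ge μ s))
  refine ⟨?_, fun n => ⟨0, n.factorial * (|μ.im|⁻¹) ^ (n + 1), fun s => ?_⟩⟩
  · exact (Complex.ofRealCLM.contDiff.sub contDiff_const).inv fun s => h0 s
  · rw [norm_iteratedFDeriv_eq_norm_iteratedDeriv, iteratedDeriv_inv_ofReal_sub hμ]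
    have := norm_ofReal_sub_ge μ s
    simp only [norm_mul, norm_pow, norm_neg, norm_one, one_pow, one_mul, norm_inv, pow_zero,
      mul_one, Complex.norm_natCast]
    gcongr

/-- The symbol `((2π)⁴ |ξ|⁴ - μ)⁻¹`, with Mathlib's normalisation of the Fourier transform, of
the resolvent of `Δ²`. -/
def resolventSymbol (d : ℕ) (μ : ℂ) (ξ : Space d) : ℂ :=
  ((((2 * Real.pi) ^ 4 * (‖ξ‖ ^ 2) ^ 2 : ℝ) : ℂ) - μ)⁻¹

theorem hasTemperateGrowth_resolventSymbol {d : ℕ} {μ : ℂ} (hμ : μ.im ≠ 0) :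
    (resolventSymbol d μ).HasTemperateGrowth := by
  have h : (fun ξ : Space d => (2 * Real.pi) ^ 4 * (‖ξ‖ ^ 2) ^ 2).HasTemperateGrowth := by
    fun_prop
  exact (hasTemperateGrowth_inv_ofReal_sub hμ).comp h

/-- The resolvent `(Δ² - μ)⁻¹` on Schwartz functions, a Fourier multiplier. Meaningful for
non-real `μ` only: otherwise the symbol need not have temperate growth, and the multiplier takes a
junk value. -/
def resolventS {d : ℕ} (μ : ℂ) (f : 𝓢(Space d, ℂ)) : 𝓢(Space d, ℂ) :=
  SchwartzMap.fourierMultiplierCLM ℂ (resolventSymbol d μ) f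

theorem fourier_resolventS {d : ℕ} {μ : ℂ} (hμ : μ.im ≠ 0) (f : 𝓢(Space d, ℂ)) (ξ : Space d) :
    (𝓕 (resolventS μ f)) ξ = resolventSymbol d μ ξ * (𝓕 f) ξ := by
  rw [resolventS, SchwartzMap.fourierMultiplierCLM_apply, FourierTransform.fourier_fourierInv_eq,
    SchwartzMap.smulLeftCLM_apply_apply (hasTemperateGrowth_resolventSymbol hμ), smul_eq_mul]

theorem fourier_laplacian_apply {d : ℕ} (f : 𝓢(Space d, ℂ)) (ξ : Space d) :
    (𝓕 (Δ f)) ξ = -(((2 * Real.pi) ^ 2 * ‖ξ‖ ^ 2 : ℝ) : ℂ) * (𝓕 f) ξ := by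
  have h : (fun x : Space d => ‖x‖ ^ 2).HasTemperateGrowth := by fun_prop
  rw [SchwartzMap.laplacian_eq_fourierMultiplierCLM, FourierTransform.fourier_smul,
    SchwartzMap.fourierMultiplierCLM_apply, FourierTransform.fourier_fourierInv_eq]
  simp only [smul_apply, SchwartzMap.smulLeftCLM_apply_apply h]
  simp
  ring

theorem fourier_lineDeriv_apply {d : ℕ} (f : 𝓢(Space d, ℂ)) (i : Fin d) (ξ : Space d) :
    (𝓕 (∂_{stdVec d i} f)) ξ = 2 * Real.pi * Complex.I * ((ξ i : ℂ) * (𝓕 f) ξ) := by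
  rw [SchwartzMap.fourier_lineDerivOp_eq, smul_apply, smul_eq_mul, ← coordMul_apply]
  rfl

theorem lineDeriv_fourier {d : ℕ} (f : 𝓢(Space d, ℂ)) (i : Fin d) :
    ∂_{stdVec d i} (𝓕 f) = 𝓕 (-(2 * Real.pi * Complex.I) • coordMul i f) :=
  SchwartzMap.lineDerivOp_fourier_eq f (stdVec d i)

/-- `v = (Δ² - μ)⁻¹ f` solves `Δ² v - μ v = f`. -/
theorem laplacian_laplacian_resolventS {d : ℕ} {μ : ℂ} (hμ : μ.im ≠ 0) (f : 𝓢(Space d, ℂ)) :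
    Δ (Δ (resolventS μ f)) = f + μ • resolventS μ f := by
  have h : 𝓕 (Δ (Δ (resolventS μ f))) = 𝓕 (f + μ • resolventS μ f) := by
    ext ξ
    rw [fourier_laplacian_apply, fourier_laplacian_apply, FourierTransform.fourier_add,
      FourierTransform.fourier_smul, add_apply, smul_apply, smul_eq_mul, fourier_resolventS hμ,
      resolventSymbol]
    have h0 : (((2 * Real.pi) ^ 4 * (‖ξ‖ ^ 2) ^ 2 : ℝ) : ℂ) - μ ≠ 0 :=
      norm_pos_iff.1 ((abs_pos.2 hμ).trans_le (norm_ofReal_sub_ge μ _))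
    have h1 := mul_inv_cancel₀ h0
    push_cast at h1 ⊢
    linear_combination (𝓕 f) ξ * h1
  have := congrArg (fun g : 𝓢(Space d, ℂ) => 𝓕⁻ g) h
  simpa only [FourierTransform.fourierInv_fourier_eq] using this

/-- The weight `(|x|² + ε)^(-k)` has temperate growth. -/
theorem hasTemperateGrowth_weight {d : ℕ} {ε : ℝ} (hε : 0 < ε) (k : ℕ) :
    (fun x : Space d => 1 / (‖x‖ ^ 2 + ε) ^ k).HasTemperateGrowth := by
  have h1 := Function.hasTemperateGrowth_one_add_norm_sq_rpow (Space d) (-(k : ℝ))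
  have h2 : (fun x : Space d => (√ε)⁻¹ • x).HasTemperateGrowth := by fun_prop
  have h3 : (fun x : Space d => (ε ^ k)⁻¹ * (1 + ‖(√ε)⁻¹ • x‖ ^ 2) ^ (-(k : ℝ))).HasTemperateGrowth :=
    (Function.HasTemperateGrowth.const _).mul (h1.comp h2)
  convert h3 using 2 with x
  have hs : √ε ^ 2 = ε := Real.sq_sqrt hε.le
  have e : 1 + ‖(√ε)⁻¹ • x‖ ^ 2 = (‖x‖ ^ 2 + ε) / ε := by
    rw [norm_smul, norm_inv, Real.norm_of_nonneg (Real.sqrt_nonneg _), mul_pow, inv_pow, hs]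
    field_simp
    ring
  rw [e, Real.rpow_neg (by positivity), Real.rpow_natCast, div_pow]
  field_simp

/-- The Schwartz function `f / (|x|² + ε)^k`, for `ε > 0`. -/
def weightS {d : ℕ} (ε : ℝ) (k : ℕ) (f : 𝓢(Space d, ℂ)) : 𝓢(Space d, ℂ) :=
  SchwartzMap.smulLeftCLM ℂ (fun x : Space d => 1 / (‖x‖ ^ 2 + ε) ^ k) f

theorem weightS_apply {d : ℕ} {ε : ℝ} (hε : 0 < ε) (k : ℕ) (f : 𝓢(Space d, ℂ)) (x : Space d) :
    weightS ε k f x = ((1 / (‖x‖ ^ 2 + ε) ^ k : ℝ) : ℂ) * f x := by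
  rw [weightS, SchwartzMap.smulLeftCLM_apply_apply (hasTemperateGrowth_weight hε k)]
  exact Complex.real_smul

theorem integrable_norm_sq {d : ℕ} (f : 𝓢(Space d, ℂ)) : Integrable (fun x => ‖f x‖ ^ 2) :=
  (f.memLp 2 (volume : Measure (Space d))).integrable_norm_pow (by norm_num)

/-- Plancherel's theorem: derivatives of `𝓕 f` correspond to the weight `|x|²` on `f`. -/
theorem integral_gradSqS_fourier {d : ℕ} (f : 𝓢(Space d, ℂ)) :
    ∫ x, gradSqS (𝓕 f) x = (2 * Real.pi) ^ 2 * ∫ x, ‖x‖ ^ 2 * ‖f x‖ ^ 2 := by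
  simp only [gradSqS, lineDeriv_fourier]
  rw [integral_finsetSum _ fun i _ => integrable_norm_sq _]
  simp only [integral_norm_sq_fourier]
  rw [← integral_finsetSum _ fun i _ => integrable_norm_sq _, ← integral_const_mul]
  refine integral_congr_ae (.of_forall fun x => ?_)
  simp only [smul_apply, coordMul_apply, smul_eq_mul, norm_mul, mul_pow, norm_neg,
    Complex.norm_real, Complex.norm_I, Complex.norm_ofNat, Real.norm_eq_abs, sq_abs]
  rw [← Finset.mul_sum, ← Finset.sum_mul, sum_coord_sq]
  ring

theorem integral_gradSqS_lineDeriv_fourier {d : ℕ} (f : 𝓢(Space d, ℂ)) :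
    ∫ x, ∑ i, gradSqS (∂_{stdVec d i} (𝓕 f)) x =
      (2 * Real.pi) ^ 4 * ∫ x, (‖x‖ ^ 2) ^ 2 * ‖f x‖ ^ 2 := by
  have hi : ∀ i : Fin d, Integrable (fun x => gradSqS (∂_{stdVec d i} (𝓕 f)) x) := fun i => by
    simpa using integrable_bounded_mul_gradSqS (c := fun _ => 1) (C := 1)
      aestronglyMeasurable_const (∂_{stdVec d i} (𝓕 f)) (by simp)
  have hj : ∀ i : Fin d, Integrable fun x : Space d =>
      ‖x‖ ^ 2 * ‖(-(2 * Real.pi * Complex.I) • coordMul i f) x‖ ^ 2 := fun i => by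
    have : (fun x : Space d => ‖x‖ ^ 2 * ‖(-(2 * Real.pi * Complex.I) • coordMul i f) x‖ ^ 2) =
        fun x => ∑ j, ‖coordMul j (-(2 * Real.pi * Complex.I) • coordMul i f) x‖ ^ 2 := by
      ext x
      simp only [coordMul_apply, norm_mul, mul_pow, Complex.norm_real, Real.norm_eq_abs, sq_abs]
      rw [← Finset.sum_mul, sum_coord_sq]
    rw [this]
    exact integrable_finsetSum _ fun j _ => integrable_norm_sq _
  rw [integral_finsetSum _ fun i _ => hi i]
  simp only [lineDeriv_fourier, integral_gradSqS_fourier]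
  rw [← Finset.mul_sum, ← integral_finsetSum _ fun i _ => hj i, ← integral_const_mul,
    ← integral_const_mul]
  refine integral_congr_ae (.of_forall fun x => ?_)
  simp only [smul_apply, coordMul_apply, smul_eq_mul, norm_mul, mul_pow, norm_neg,
    Complex.norm_real, Complex.norm_I, Complex.norm_ofNat, Real.norm_eq_abs, sq_abs]
  rw [← Finset.mul_sum, ← Finset.mul_sum, ← Finset.sum_mul, sum_coord_sq]
  ring

theorem integrable_weight_mul_norm_sq {d : ℕ} {ε : ℝ} (hε : 0 < ε) (k : ℕ) (f : 𝓢(Space d, ℂ)) :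
    Integrable (fun x => 1 / (‖x‖ ^ 2 + ε) ^ k * ‖f x‖ ^ 2) := by
  refine integrable_bounded_mul_sq (C := 1 / ε ^ k) ?_ f fun x => ?_
  · exact Measurable.aestronglyMeasurable (by fun_prop)
  · rw [abs_of_nonneg (by positivity)]
    gcongr
    nlinarith [sq_nonneg ‖x‖]

theorem resolventConst_pos {d : ℕ} (hd : 5 ≤ d) : 0 < resolventConst d := by
  have hd5 : (5 : ℝ) ≤ d := by exact_mod_cast hd
  have hp : 0 < 2 / ((d : ℝ) - 2) := div_pos two_pos (by linarith)
  have hp' : 0 < 2 / ((d : ℝ) - 4) := div_pos two_pos (by linarith)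
  unfold resolventConst
  positivity

/-- The weighted resolvent estimate `‖|x|⁻² (Δ² - μ)⁻¹ div g‖ ≤ C ‖|x| g‖`, uniform in `μ`. -/
theorem resolvent_estimate {d : ℕ} (hd : 5 ≤ d) {μ : ℂ} (hμ : μ.im ≠ 0)
    (g : Fin d → 𝓢(Space d, ℂ)) {ε : ℝ} (hε : 0 < ε) :
    ∫ x, 1 / (‖x‖ ^ 2 + ε) ^ 2 * ‖resolventS μ (∑ j, ∂_{stdVec d j} (g j)) x‖ ^ 2 ≤
      resolventConst d ^ 2 * ∑ j, ∫ x, ‖x‖ ^ 2 * ‖g j x‖ ^ 2 := by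
  set v := resolventS μ (∑ j, ∂_{stdVec d j} (g j)) with hv
  set f := weightS ε 2 v with hf
  set K := ∫ x, 1 / (‖x‖ ^ 2 + ε) ^ 2 * ‖v x‖ ^ 2 with hK
  set Z := ∑ j, ∫ x, ‖x‖ ^ 2 * ‖g j x‖ ^ 2 with hZ
  have hC := resolventConst_pos hd
  set C := resolventConst d with hCdef
  have hpi := Real.pi_pos
  -- the quadratic form as a bilinear expression
  have h1 : (K : ℂ) = ∫ x, inner ℂ (f x) (v x) := by
    rw [hK, ← integral_complex_ofReal]
    refine integral_congr_ae (.of_forall fun x => ?_)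
    simp only [hf, weightS_apply hε, RCLike.inner_apply, map_mul, Complex.conj_ofReal]
    rw [← mul_assoc, mul_comm (v x), mul_assoc, Complex.mul_conj']
    push_cast
    ring
  have h2 : (K : ℂ) = (2 * (Real.pi : ℂ) * Complex.I) / (2 * (Real.pi : ℂ)) ^ 4 *
      ∫ ξ, ((((‖ξ‖ ^ 2) ^ 2 : ℝ) : ℂ) - μ / (2 * (Real.pi : ℂ)) ^ 4)⁻¹ *
        pairS (𝓕 f) (fun j => 𝓕 (g j)) ξ := by
    rw [h1, ← integral_inner_fourier_fourier f v, ← integral_const_mul]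
    refine integral_congr_ae (.of_forall fun ξ => ?_)
    simp only [RCLike.inner_apply, hv, fourier_resolventS hμ, pairS_apply]
    have e1 : (𝓕 (∑ j, ∂_{stdVec d j} (g j))) ξ =
        2 * Real.pi * Complex.I * ∑ j, (ξ j : ℂ) * (𝓕 (g j)) ξ := by
      rw [FourierTransform.fourier_sum, sum_apply, Finset.mul_sum]
      exact Finset.sum_congr rfl fun j _ => fourier_lineDeriv_apply _ _ _
    have e2 : resolventSymbol d μ ξ = ((2 * (Real.pi : ℂ)) ^ 4)⁻¹ *
        ((((‖ξ‖ ^ 2) ^ 2 : ℝ) : ℂ) - μ / (2 * (Real.pi : ℂ)) ^ 4)⁻¹ := by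
      rw [resolventSymbol, ← mul_inv]
      congr 1
      have : (2 * (Real.pi : ℂ)) ^ 4 ≠ 0 := by
        have : (Real.pi : ℂ) ≠ 0 := by exact_mod_cast hpi.ne'
        exact pow_ne_zero 4 (mul_ne_zero two_ne_zero this)
      push_cast
      field_simp
    rw [e1, e2]
    ring
  have h3 : (μ / (2 * (Real.pi : ℂ)) ^ 4).im ≠ 0 := by
    have : ((2 * (Real.pi : ℂ)) ^ 4) = (((2 * Real.pi) ^ 4 : ℝ) : ℂ) := by push_cast; rfl
    rw [this, Complex.div_ofReal_im]
    exact div_ne_zero hμ (by positivity)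
  have hK0 : 0 ≤ K := integral_nonneg fun x => by positivity
  -- this `t` balances the two terms so that half of `K` can be absorbed
  have h4 := resolvent_bilinear hd (𝓕 f) (fun j => 𝓕 (g j)) h3
    (t := 1 / (2 * Real.pi * C)) (by positivity)
  have h5 : ∫ x, ∑ j, gradSqS (𝓕 (g j)) x = (2 * Real.pi) ^ 2 * Z := by
    rw [integral_finsetSum _ fun j _ => by
      simpa using integrable_bounded_mul_gradSqS (c := fun _ => 1) (C := 1)
        aestronglyMeasurable_const (𝓕 (g j)) (by simp), hZ, Finset.mul_sum]
    exact Finset.sum_congr rfl fun j _ => integral_gradSqS_fourier _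
  have h6 : ∫ x, ∑ i, gradSqS (∂_{stdVec d i} (𝓕 f)) x ≤ (2 * Real.pi) ^ 4 * K := by
    rw [integral_gradSqS_lineDeriv_fourier]
    gcongr
    refine integral_mono_of_nonneg (.of_forall fun x => by positivity)
      (integrable_weight_mul_norm_sq hε 2 v) (.of_forall fun x => ?_)
    have hq : 0 < ‖x‖ ^ 2 + ε := by positivity
    simp only [hf, weightS_apply hε, norm_mul, mul_pow, Complex.norm_real, Real.norm_eq_abs, sq_abs]
    rw [← mul_assoc]
    gcongr
    have : ‖x‖ ^ 2 ≤ ‖x‖ ^ 2 + ε := by linarith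
    rw [div_pow, one_pow, mul_one_div, div_le_div_iff₀ (by positivity) (by positivity), one_mul]
    calc (‖x‖ ^ 2) ^ 2 * (‖x‖ ^ 2 + ε) ^ 2 ≤ (‖x‖ ^ 2 + ε) ^ 2 * (‖x‖ ^ 2 + ε) ^ 2 := by gcongr
      _ = _ := by ring
  have h7 := congrArg norm h2
  rw [Complex.norm_real, Real.norm_of_nonneg hK0, norm_mul] at h7
  have h8 : ‖(2 * (Real.pi : ℂ) * Complex.I) / (2 * (Real.pi : ℂ)) ^ 4‖ = 1 / (2 * Real.pi) ^ 3 := by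
    simp only [norm_div, norm_mul, norm_pow, Complex.norm_real, Complex.norm_I, Complex.norm_ofNat,
      Real.norm_of_nonneg hpi.le]
    field_simp
  rw [h8] at h7
  rw [h5] at h4
  have h9 : K ≤ 1 / (2 * Real.pi) ^ 3 * (C / 2 * (1 / (2 * Real.pi * C) * ((2 * Real.pi) ^ 4 * K) +
      (2 * Real.pi) ^ 2 * Z / (1 / (2 * Real.pi * C)))) := by
    rw [h7]
    refine mul_le_mul_of_nonneg_left (h4.trans ?_) (by positivity)
    rw [← h7]
    gcongr
  have h10 : 1 / (2 * Real.pi) ^ 3 * (C / 2 * (1 / (2 * Real.pi * C) * ((2 * Real.pi) ^ 4 * K) +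
      (2 * Real.pi) ^ 2 * Z / (1 / (2 * Real.pi * C)))) = K / 2 + C ^ 2 * Z / 2 := by
    field_simp
  linarith

/-! ### Density of Schwartz functions in `H²` -/

open Filter Topology

theorem toDist_sub {d : ℕ} (u v : L2 d) : toDist (u - v) = toDist u - toDist v :=
  map_sub (Lp.toTemperedDistributionCLM ℂ (volume : Measure (Space d)) 2) u v

theorem lap_sub {d : ℕ} (u v : H2 d) : lap (u - v) = lap u - lap v := by
  have := lap_add (u - v) v
  rw [sub_add_cancel] at this
  rw [this, add_sub_cancel_right]

theorem partialDeriv_sub {d : ℕ} (u v : H2 d) (i : Fin d) :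
    partialDeriv (u - v) i = partialDeriv u i - partialDeriv v i := by
  apply toDist_injective
  rw [toDist_partialDeriv, toDist_sub, toDist_partialDeriv, toDist_partialDeriv,
    AddSubgroupClass.coe_sub, toDist_sub]
  simp only [← lineDerivOpCLM_apply (R := ℂ)]
  exact map_sub _ _ _

/-- A Schwartz function as an element of `L²`. -/
abbrev toL2 {d : ℕ} (φ : 𝓢(Space d, ℂ)) : L2 d := φ.toLp 2 volume

theorem toL2_sub {d : ℕ} (φ ψ : 𝓢(Space d, ℂ)) : toL2 (φ - ψ) = toL2 φ - toL2 ψ :=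
  map_sub (SchwartzMap.toLpCLM ℂ ℂ 2 (volume : Measure (Space d))) φ ψ

theorem denseRange_toL2 {d : ℕ} : DenseRange (toL2 (d := d)) :=
  SchwartzMap.denseRange_toLpCLM (E := Space d) (F := ℂ) (p := 2) (μ := volume) (by norm_num)

/-- A Schwartz function as an element of `H²`. -/
def schwartzH2 {d : ℕ} (φ : 𝓢(Space d, ℂ)) : H2 d :=
  ⟨toL2 φ, by
    change MemSobolev 2 2 (toDist (φ.toLp 2 volume))
    rw [toDist, Lp.toTemperedDistribution_toLp_eq]
    exact φ.memSobolev⟩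

theorem coe_schwartzH2 {d : ℕ} (φ : 𝓢(Space d, ℂ)) : (schwartzH2 φ : L2 d) = toL2 φ := rfl

theorem lap_schwartzH2 {d : ℕ} (φ : 𝓢(Space d, ℂ)) : lap (schwartzH2 φ) = toL2 (Δ φ) := by
  apply toDist_injective
  rw [toDist_lap, coe_schwartzH2, toDist, toDist, Lp.toTemperedDistribution_toLp_eq,
    Lp.toTemperedDistribution_toLp_eq, laplacian_toTemperedDistributionCLM_eq]

theorem partialDeriv_schwartzH2 {d : ℕ} (φ : 𝓢(Space d, ℂ)) (i : Fin d) :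
    partialDeriv (schwartzH2 φ) i = toL2 (∂_{stdVec d i} φ) := by
  apply toDist_injective
  rw [toDist_partialDeriv, coe_schwartzH2, toDist, toDist, Lp.toTemperedDistribution_toLp_eq,
    Lp.toTemperedDistribution_toLp_eq, lineDerivOp_toTemperedDistributionCLM_eq]

theorem toDist_lap_apply {d : ℕ} (u : H2 d) (k : 𝓢(Space d, ℂ)) :
    toDist (lap u) k = toDist (u : L2 d) (Δ k) := by
  rw [toDist_lap, TemperedDistribution.laplacian_apply_apply]

theorem toDist_partialDeriv_apply {d : ℕ} (u : H2 d) (i : Fin d) (k : 𝓢(Space d, ℂ)) :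
    toDist (partialDeriv u i) k = -toDist (u : L2 d) (∂_{stdVec d i} k) := by
  rw [toDist_partialDeriv, TemperedDistribution.lineDerivOp_apply_apply, map_neg]

theorem conjS_conjS {d : ℕ} (k : 𝓢(Space d, ℂ)) : conjS (conjS k) = k := by
  ext x; simp

/-- The pairing of an `L²` function with a Schwartz function, as an inner product: the
distributional pairing is bilinear, hence the conjugate. -/
theorem inner_toL2_eq {d : ℕ} (k : 𝓢(Space d, ℂ)) (u : L2 d) :
    inner ℂ (toL2 k) u = toDist u (conjS k) := by
  rw [toDist, Lp.toTemperedDistribution_apply, L2.inner_def]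
  refine integral_congr_ae ?_
  filter_upwards [k.coeFn_toLp 2 (volume : Measure (Space d))] with x hx
  rw [hx, RCLike.inner_apply, smul_eq_mul, conjS_apply, mul_comm]

theorem norm_toL2_sq {d : ℕ} (k : 𝓢(Space d, ℂ)) :
    ‖toL2 k‖ ^ 2 = ∫ x, ‖k x‖ ^ 2 := by
  have h2 : ∫ x, inner ℂ (k x) (k x) = ((∫ x, ‖k x‖ ^ 2 : ℝ) : ℂ) := by
    rw [← integral_complex_ofReal]
    refine integral_congr_ae (.of_forall fun x => ?_)
    simp only [inner_self_eq_norm_sq_to_K]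
    push_cast; rfl
  rw [toL2, norm_sq_eq_re_inner (𝕜 := ℂ), SchwartzMap.inner_toL2_toL2_eq k k volume, h2]
  exact Complex.ofReal_re _

theorem norm_toL2_conjS {d : ℕ} (k : 𝓢(Space d, ℂ)) :
    ‖toL2 (conjS k)‖ = ‖toL2 k‖ := by
  rw [← sq_eq_sq₀ (norm_nonneg _) (norm_nonneg _), norm_toL2_sq, norm_toL2_sq]
  simp

theorem norm_toDist_apply_le {d : ℕ} (u : L2 d) (k : 𝓢(Space d, ℂ)) :
    ‖toDist u k‖ ≤ ‖u‖ * ‖toL2 k‖ := by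
  have h := norm_inner_le_norm (𝕜 := ℂ) (toL2 (conjS k)) u
  rw [inner_toL2_eq, conjS_conjS, norm_toL2_conjS, mul_comm] at h
  exact h

/-- The `L²` norm of a Schwartz function is monotone in the modulus of its Fourier transform. -/
theorem norm_toL2_le_of_fourier_le {d : ℕ} {f g : 𝓢(Space d, ℂ)}
    (h : ∀ ξ, ‖(𝓕 f) ξ‖ ≤ ‖(𝓕 g) ξ‖) : ‖toL2 f‖ ≤ ‖toL2 g‖ := by
  rw [← sq_le_sq₀ (norm_nonneg _) (norm_nonneg _), norm_toL2_sq, norm_toL2_sq,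
    ← integral_norm_sq_fourier f, ← integral_norm_sq_fourier g]
  refine integral_mono (integrable_norm_sq _) (integrable_norm_sq _) fun ξ => ?_
  have := h ξ
  simp only
  gcongr

/-- Duality: an `L²` function is bounded by its pairings with Schwartz functions. -/
theorem norm_le_of_toDist_le {d : ℕ} {u : L2 d} {C : ℝ} (hC : 0 ≤ C)
    (h : ∀ k : 𝓢(Space d, ℂ), ‖toDist u k‖ ≤ C * ‖toL2 k‖) : ‖u‖ ≤ C := by
  have key : ∀ v : L2 d, ‖inner ℂ v u‖ ≤ C * ‖v‖ := by
    intro v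
    refine isClosed_property denseRange_toL2 (p := fun v => ‖inner ℂ v u‖ ≤ C * ‖v‖)
      (isClosed_le (by fun_prop) (by fun_prop)) (fun k => ?_) v
    have := h (conjS k)
    rw [norm_toL2_conjS, ← inner_toL2_eq] at this
    exact this
  have h1 := key u
  rw [inner_self_eq_norm_sq_to_K, norm_pow] at h1
  simp only [RCLike.norm_ofReal, abs_norm] at h1
  by_contra hc
  push Not at hc
  nlinarith [norm_nonneg u]

theorem hasTemperateGrowth_besselSymbol (d : ℕ) :
    (fun ξ : Space d => 1 / (1 + (2 * Real.pi) ^ 2 * ‖ξ‖ ^ 2)).HasTemperateGrowth := by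
  have hpi := Real.pi_pos
  have h := (Function.HasTemperateGrowth.const (1 / (2 * Real.pi) ^ 2)).mul
    (hasTemperateGrowth_weight (d := d) (ε := 1 / (2 * Real.pi) ^ 2) (by positivity) 1)
  have e : (fun ξ : Space d => 1 / (1 + (2 * Real.pi) ^ 2 * ‖ξ‖ ^ 2)) = fun ξ : Space d =>
      1 / (2 * Real.pi) ^ 2 * (1 / (‖ξ‖ ^ 2 + 1 / (2 * Real.pi) ^ 2) ^ 1) := by
    funext ξ
    field_simp
    ring
  rw [e]
  exact h

/-- The operator `(1 - Δ)⁻¹` on Schwartz functions. -/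
def besselS {d : ℕ} (f : 𝓢(Space d, ℂ)) : 𝓢(Space d, ℂ) :=
  SchwartzMap.fourierMultiplierCLM ℂ
    (fun ξ : Space d => 1 / (1 + (2 * Real.pi) ^ 2 * ‖ξ‖ ^ 2)) f

theorem fourier_besselS {d : ℕ} (f : 𝓢(Space d, ℂ)) (ξ : Space d) :
    (𝓕 (besselS f)) ξ = ((1 / (1 + (2 * Real.pi) ^ 2 * ‖ξ‖ ^ 2) : ℝ) : ℂ) * (𝓕 f) ξ := by
  rw [besselS, SchwartzMap.fourierMultiplierCLM_apply, FourierTransform.fourier_fourierInv_eq,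
    SchwartzMap.smulLeftCLM_apply_apply (hasTemperateGrowth_besselSymbol d)]
  exact Complex.real_smul

theorem besselS_sub_laplacian {d : ℕ} (f : 𝓢(Space d, ℂ)) : besselS f - Δ (besselS f) = f := by
  have h : 𝓕 (besselS f - Δ (besselS f)) = 𝓕 f := by
    ext ξ
    rw [sub_eq_add_neg, FourierTransform.fourier_add, FourierTransform.fourier_neg, add_apply,
      neg_apply, fourier_laplacian_apply, fourier_besselS]
    have h0 : ((1 + (2 * Real.pi) ^ 2 * ‖ξ‖ ^ 2 : ℝ) : ℂ) ≠ 0 := by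
      rw [Complex.ofReal_ne_zero]; positivity
    have h1 := mul_inv_cancel₀ h0
    rw [Complex.ofReal_div, div_eq_mul_inv]
    push_cast at h1 ⊢
    linear_combination (𝓕 f) ξ * h1
  have := congrArg (fun g : 𝓢(Space d, ℂ) => 𝓕⁻ g) h
  simpa only [FourierTransform.fourierInv_fourier_eq] using this

theorem sq_coord_le {d : ℕ} (x : Space d) (i : Fin d) : (x i) ^ 2 ≤ ‖x‖ ^ 2 := by
  rw [← sum_coord_sq x]
  exact Finset.single_le_sum (f := fun i => (x i) ^ 2) (fun _ _ => sq_nonneg _) (Finset.mem_univ i)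

theorem norm_besselS_le {d : ℕ} (f : 𝓢(Space d, ℂ)) :
    ‖toL2 (besselS f)‖ ≤ ‖toL2 f‖ := by
  refine norm_toL2_le_of_fourier_le fun ξ => ?_
  rw [fourier_besselS, norm_mul, Complex.norm_real, Real.norm_of_nonneg (by positivity)]
  refine mul_le_of_le_one_left (norm_nonneg _) ?_
  rw [div_le_one (by positivity)]
  nlinarith [sq_nonneg (2 * Real.pi * ‖ξ‖)]

theorem norm_besselS_lineDeriv_le {d : ℕ} (f : 𝓢(Space d, ℂ)) (i : Fin d) :
    ‖toL2 (besselS (∂_{stdVec d i} f))‖ ≤ ‖toL2 f‖ := by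
  refine norm_toL2_le_of_fourier_le fun ξ => ?_
  have hpi := Real.pi_pos
  rw [fourier_besselS, fourier_lineDeriv_apply]
  have e : ‖((1 / (1 + (2 * Real.pi) ^ 2 * ‖ξ‖ ^ 2) : ℝ) : ℂ) *
      (2 * (Real.pi : ℂ) * Complex.I * ((ξ i : ℂ) * (𝓕 f) ξ))‖ =
      2 * Real.pi * |ξ i| / (1 + (2 * Real.pi) ^ 2 * ‖ξ‖ ^ 2) * ‖(𝓕 f) ξ‖ := by
    rw [norm_mul, Complex.norm_real, Real.norm_of_nonneg (by positivity)]
    simp only [norm_mul, Complex.norm_real, Complex.norm_I, Complex.norm_ofNat,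
      Real.norm_of_nonneg hpi.le, Real.norm_eq_abs]
    ring
  rw [e]
  refine mul_le_of_le_one_left (norm_nonneg _) ?_
  rw [div_le_one (by positivity)]
  nlinarith [sq_abs (ξ i), sq_nonneg (2 * Real.pi * |ξ i| - 1),
    mul_le_mul_of_nonneg_left (sq_coord_le ξ i) (sq_nonneg (2 * Real.pi))]

theorem norm_lineDeriv_lineDeriv_besselS_le {d : ℕ} (f : 𝓢(Space d, ℂ)) (i j : Fin d) :
    ‖toL2 (∂_{stdVec d i} (∂_{stdVec d j} (besselS f)))‖ ≤ ‖toL2 f‖ := by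
  refine norm_toL2_le_of_fourier_le fun ξ => ?_
  have hpi := Real.pi_pos
  rw [fourier_lineDeriv_apply, fourier_lineDeriv_apply, fourier_besselS]
  have e : ‖2 * (Real.pi : ℂ) * Complex.I * ((ξ i : ℂ) * (2 * (Real.pi : ℂ) * Complex.I *
      ((ξ j : ℂ) * (((1 / (1 + (2 * Real.pi) ^ 2 * ‖ξ‖ ^ 2) : ℝ) : ℂ) * (𝓕 f) ξ))))‖ =
      (2 * Real.pi) ^ 2 * (|ξ i| * |ξ j|) / (1 + (2 * Real.pi) ^ 2 * ‖ξ‖ ^ 2) * ‖(𝓕 f) ξ‖ := by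
    have h : ‖((1 / (1 + (2 * Real.pi) ^ 2 * ‖ξ‖ ^ 2) : ℝ) : ℂ)‖ =
        1 / (1 + (2 * Real.pi) ^ 2 * ‖ξ‖ ^ 2) := by
      rw [Complex.norm_real, Real.norm_of_nonneg (by positivity)]
    simp only [norm_mul, h]
    simp only [Complex.norm_real, Complex.norm_I, Complex.norm_ofNat,
      Real.norm_of_nonneg hpi.le, Real.norm_eq_abs]
    ring
  rw [e]
  refine mul_le_of_le_one_left (norm_nonneg _) ?_
  rw [div_le_one (by positivity)]
  have h : |ξ i| * |ξ j| ≤ ‖ξ‖ ^ 2 := by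
    nlinarith [sq_coord_le ξ i, sq_coord_le ξ j, sq_abs (ξ i), sq_abs (ξ j),
      sq_nonneg (|ξ i| - |ξ j|)]
  nlinarith [mul_le_mul_of_nonneg_left h (sq_nonneg (2 * Real.pi))]

/-- `u` is recovered from `u - Δu`, since `(1 - Δ)⁻¹` is symmetric for the bilinear pairing. -/
theorem toDist_sub_lap {d : ℕ} (u : H2 d) (k : 𝓢(Space d, ℂ)) :
    toDist (u : L2 d) k = toDist ((u : L2 d) - lap u) (besselS k) := by
  conv_lhs => rw [← besselS_sub_laplacian k, map_sub, ← toDist_lap_apply]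
  rw [toDist_sub]
  rfl

theorem norm_le_norm_sub_lap {d : ℕ} (u : H2 d) : ‖(u : L2 d)‖ ≤ ‖(u : L2 d) - lap u‖ := by
  refine norm_le_of_toDist_le (norm_nonneg _) fun k => ?_
  rw [toDist_sub_lap]
  exact (norm_toDist_apply_le _ _).trans
    (mul_le_mul_of_nonneg_left (norm_besselS_le k) (norm_nonneg _))

theorem norm_partialDeriv_le_norm_sub_lap {d : ℕ} (u : H2 d) (i : Fin d) :
    ‖partialDeriv u i‖ ≤ ‖(u : L2 d) - lap u‖ := by
  refine norm_le_of_toDist_le (norm_nonneg _) fun k => ?_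
  rw [toDist_partialDeriv_apply, norm_neg, toDist_sub_lap]
  exact (norm_toDist_apply_le _ _).trans
    (mul_le_mul_of_nonneg_left (norm_besselS_lineDeriv_le k i) (norm_nonneg _))

/-- Schwartz functions approximate `u ∈ H²` together with its gradient, with a uniform bound on
the second derivatives: take `(1 - Δ)⁻¹ wₙ` with Schwartz functions `wₙ → u - Δu` in `L²`. -/
theorem exists_schwartz_approx {d : ℕ} (u : H2 d) :
    ∃ (ψ : ℕ → 𝓢(Space d, ℂ)) (C : ℝ),
      Tendsto (fun n => toL2 (ψ n)) atTop (𝓝 (u : L2 d)) ∧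
      (∀ i, Tendsto (fun n => (toL2 (∂_{stdVec d i} (ψ n)))) atTop
        (𝓝 (partialDeriv u i))) ∧
      ∀ n i j, ‖toL2 (∂_{stdVec d i} (∂_{stdVec d j} (ψ n)))‖ ≤ C := by
  obtain ⟨w, hw⟩ : ∃ w : ℕ → 𝓢(Space d, ℂ),
      Tendsto (fun n => toL2 (w n)) atTop (𝓝 ((u : L2 d) - lap u)) := by
    have hx := denseRange_toL2 ((u : L2 d) - lap u)
    obtain ⟨x, hx1, hx2⟩ := mem_closure_iff_seq_limit.1 hx
    choose w hw using hx1
    exact ⟨w, by simpa only [hw] using hx2⟩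
  have hd : ∀ n, ((u - schwartzH2 (besselS (w n)) : H2 d) : L2 d) -
      lap (u - schwartzH2 (besselS (w n))) = ((u : L2 d) - lap u) - toL2 (w n) := by
    intro n
    have h1 : toL2 (besselS (w n)) - toL2 (Δ (besselS (w n))) = toL2 (w n) := by
      rw [← toL2_sub, besselS_sub_laplacian]
    rw [lap_sub, AddSubgroupClass.coe_sub, lap_schwartzH2, coe_schwartzH2, ← h1]
    abel
  have hlim : Tendsto (fun n => ‖((u : L2 d) - lap u) - toL2 (w n)‖) atTop (𝓝 0) := by
    have := (tendsto_const_nhds (x := (u : L2 d) - lap u)).sub hw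
    rw [sub_self] at this
    exact tendsto_zero_iff_norm_tendsto_zero.1 this
  obtain ⟨C, hC⟩ := hw.norm.bddAbove_range
  refine ⟨fun n => besselS (w n), C, ?_, fun i => ?_, fun n i j => ?_⟩
  · rw [tendsto_iff_norm_sub_tendsto_zero]
    refine squeeze_zero (fun _ => norm_nonneg _) (fun n => ?_) hlim
    rw [← hd, norm_sub_rev]
    exact norm_le_norm_sub_lap (u - schwartzH2 (besselS (w n)))
  · rw [tendsto_iff_norm_sub_tendsto_zero]
    refine squeeze_zero (fun _ => norm_nonneg _) (fun n => ?_) hlim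
    rw [← hd, norm_sub_rev, ← partialDeriv_schwartzH2, ← partialDeriv_sub]
    exact norm_partialDeriv_le_norm_sub_lap (u - schwartzH2 (besselS (w n))) i
  · exact (norm_lineDeriv_lineDeriv_besselS_le (w n) i j).trans (hC ⟨n, rfl⟩)

/-! ### Hardy and Rellich inequalities in `H²` -/

theorem memLp_top_weight {d : ℕ} {ε : ℝ} (hε : 0 < ε) (k : ℕ) :
    MemLp (fun x : Space d => ((1 / (‖x‖ ^ 2 + ε) ^ k : ℝ) : ℂ)) ∞ volume := by
  refine memLp_top_of_bound (Measurable.aestronglyMeasurable (by fun_prop)) (1 / ε ^ k)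
    (.of_forall fun x => ?_)
  rw [Complex.norm_real, Real.norm_of_nonneg (by positivity)]
  gcongr
  nlinarith [sq_nonneg ‖x‖]

/-- Multiplication by `(|x|² + ε)^(-k)` on `L²`. -/
def weightL {d : ℕ} {ε : ℝ} (hε : 0 < ε) (k : ℕ) : L2 d →L[ℂ] L2 d :=
  (ContinuousLinearMap.mul ℂ ℂ).holderL volume ∞ 2 2 ((memLp_top_weight hε k).toLp _)

theorem coeFn_weightL {d : ℕ} {ε : ℝ} (hε : 0 < ε) (k : ℕ) (f : L2 d) :
    weightL hε k f =ᵐ[volume] fun x => ((1 / (‖x‖ ^ 2 + ε) ^ k : ℝ) : ℂ) * f x := by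
  have h := (ContinuousLinearMap.mul ℂ ℂ).coeFn_holder (r := 2)
    ((memLp_top_weight (d := d) hε k).toLp _) f
  filter_upwards [h, (memLp_top_weight (d := d) hε k).coeFn_toLp] with x hx hx'
  rw [hx'] at hx
  exact hx

theorem inner_weightL {d : ℕ} {ε : ℝ} (hε : 0 < ε) (k : ℕ) (f g : L2 d) :
    inner ℂ g (weightL hε k f) = ∫ x, ((1 / (‖x‖ ^ 2 + ε) ^ k : ℝ) : ℂ) * (conj (g x) * f x) := by
  rw [L2.inner_def]
  refine integral_congr_ae ?_
  filter_upwards [coeFn_weightL hε k f] with x hx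
  rw [hx, RCLike.inner_apply]
  ring

/-- The quadratic form `∫ |f|² / (|x|² + ε)^k`. -/
def weightForm {d : ℕ} {ε : ℝ} (hε : 0 < ε) (k : ℕ) (f : L2 d) : ℝ :=
  (inner ℂ f (weightL hε k f)).re

theorem continuous_weightForm {d : ℕ} {ε : ℝ} (hε : 0 < ε) (k : ℕ) :
    Continuous (weightForm (d := d) hε k) :=
  Complex.continuous_re.comp (continuous_id.inner (weightL hε k).continuous)

theorem weightForm_eq {d : ℕ} {ε : ℝ} (hε : 0 < ε) (k : ℕ) (f : L2 d) :
    weightForm hε k f = ∫ x, 1 / (‖x‖ ^ 2 + ε) ^ k * ‖f x‖ ^ 2 := by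
  have h : inner ℂ f (weightL hε k f) =
      ((∫ x, 1 / (‖x‖ ^ 2 + ε) ^ k * ‖f x‖ ^ 2 : ℝ) : ℂ) := by
    rw [inner_weightL, ← integral_complex_ofReal]
    refine integral_congr_ae (.of_forall fun x => ?_)
    simp only [Complex.conj_mul']
    push_cast
    ring
  rw [weightForm, h, Complex.ofReal_re]

theorem weightForm_toL2 {d : ℕ} {ε : ℝ} (hε : 0 < ε) (k : ℕ) (φ : 𝓢(Space d, ℂ)) :
    weightForm hε k (toL2 φ) = ∫ x, 1 / (‖x‖ ^ 2 + ε) ^ k * ‖φ x‖ ^ 2 := by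
  rw [weightForm_eq]
  refine integral_congr_ae ?_
  filter_upwards [φ.coeFn_toLp 2 (volume : Measure (Space d))] with x hx
  rw [hx]

theorem ofReal_weightForm {d : ℕ} {ε : ℝ} (hε : 0 < ε) (k : ℕ) (f : L2 d) :
    ENNReal.ofReal (weightForm hε k f) =
      ∫⁻ x, ENNReal.ofReal (‖f x‖ ^ 2 / (‖x‖ ^ 2 + ε) ^ k) := by
  have hi : Integrable (fun x => 1 / (‖x‖ ^ 2 + ε) ^ k * ‖f x‖ ^ 2) := by
    refine ((Lp.memLp f).integrable_norm_pow (p := 2) (by norm_num)).bdd_mul (c := 1 / ε ^ k)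
      (Measurable.aestronglyMeasurable (by fun_prop)) (.of_forall fun x => ?_)
    rw [Real.norm_of_nonneg (by positivity)]
    gcongr
    nlinarith [sq_nonneg ‖x‖]
  rw [weightForm_eq, ofReal_integral_eq_lintegral_ofReal hi (.of_forall fun x => by positivity)]
  refine lintegral_congr fun x => ?_
  rw [one_div_mul_eq_div]

/-- Removal of the regularisation `ε` by Fatou's lemma. -/
theorem lintegral_div_norm_pow_le {d : ℕ} {f : Space d → ℝ} (hf : AEMeasurable f volume)
    {k : ℕ} (hk : k ≠ 0) {M : ℝ≥0∞}
    (h : ∀ ε : ℝ, 0 < ε → ∫⁻ x, ENNReal.ofReal (f x / (‖x‖ ^ 2 + ε) ^ k) ≤ M) :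
    ∫⁻ x, ENNReal.ofReal (f x / (‖x‖ ^ 2) ^ k) ≤ M := by
  have hlim : ∀ x, ENNReal.ofReal (f x / (‖x‖ ^ 2) ^ k) ≤
      liminf (fun n : ℕ => ENNReal.ofReal (f x / (‖x‖ ^ 2 + 1 / ((n : ℝ) + 1)) ^ k)) atTop := by
    intro x
    -- at the origin the left-hand side is `0`, by division by zero
    by_cases hx : x = 0
    · simp [hx, hk]
    · have h0 : (‖x‖ ^ 2 + 0) ^ k ≠ 0 := by
        have := norm_pos_iff.2 hx
        positivity
      have h1 : Tendsto (fun n : ℕ => f x / (‖x‖ ^ 2 + 1 / ((n : ℝ) + 1)) ^ k) atTop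
          (𝓝 (f x / (‖x‖ ^ 2 + 0) ^ k)) :=
        tendsto_const_nhds.div ((tendsto_const_nhds.add tendsto_one_div_add_atTop_nhds_zero_nat).pow k)
          h0
      rw [add_zero] at h1
      exact (ENNReal.tendsto_ofReal h1).liminf_eq.ge
  refine (lintegral_mono hlim).trans ((lintegral_liminf_le' fun n => ?_).trans ?_)
  · exact (hf.div (Measurable.aemeasurable (by fun_prop))).ennreal_ofReal
  · refine liminf_le_of_le (by isBoundedDefault) fun b hb => ?_
    obtain ⟨n, hn⟩ := hb.exists
    exact hn.trans (h _ (by positivity))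

theorem aemeasurable_gradSq {d : ℕ} (u : H2 d) : AEMeasurable (gradSq u) volume :=
  Finset.aemeasurable_fun_sum _ fun i _ =>
    ((Lp.aestronglyMeasurable (partialDeriv u i)).norm.aemeasurable.pow_const 2)

theorem gradSq_nonneg {d : ℕ} (u : H2 d) (x : Space d) : 0 ≤ gradSq u x :=
  Finset.sum_nonneg fun _ _ => by positivity

theorem ofReal_sum_weightForm {d : ℕ} {ε : ℝ} (hε : 0 < ε) (k : ℕ) (u : H2 d) :
    ENNReal.ofReal (∑ i, weightForm hε k (partialDeriv u i)) =
      ∫⁻ x, ENNReal.ofReal (gradSq u x / (‖x‖ ^ 2 + ε) ^ k) := by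
  have h0 : ∀ i, 0 ≤ weightForm hε k (partialDeriv u i) := fun i => by
    rw [weightForm_eq]
    exact integral_nonneg fun x => by positivity
  rw [ENNReal.ofReal_sum_of_nonneg fun i _ => h0 i]
  simp only [ofReal_weightForm]
  rw [← lintegral_finsetSum' _ fun i _ => ?_]
  · refine lintegral_congr fun x => ?_
    rw [gradSq, Finset.sum_div, ENNReal.ofReal_sum_of_nonneg fun i _ => by positivity]
  · exact (((Lp.aestronglyMeasurable (partialDeriv u i)).norm.aemeasurable.pow_const 2).div
      (Measurable.aemeasurable (by fun_prop))).ennreal_ofReal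

/-- By Hardy's inequality for each `∂ᵢu`, the integrals `∫ |∇u|² / (|x|² + ε)` are bounded uniformly
in `ε`. Only finiteness matters, so the constant is left implicit. -/
theorem exists_hardy_bound {d : ℕ} (hd : 5 ≤ d) (u : H2 d) :
    ∃ M : ℝ, ∀ (ε : ℝ) (hε : 0 < ε), ∑ i, weightForm hε 1 (partialDeriv u i) ≤ M := by
  obtain ⟨ψ, C, -, h1, h2⟩ := exists_schwartz_approx u
  refine ⟨∑ _i : Fin d, (2 / ((d : ℝ) - 2)) ^ 2 * ∑ _j : Fin d, C ^ 2, fun ε hε => ?_⟩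
  refine Finset.sum_le_sum fun i _ => ?_
  refine le_of_tendsto ((continuous_weightForm hε 1).tendsto _ |>.comp (h1 i))
    (.of_forall fun n => ?_)
  simp only [Function.comp, weightForm_toL2]
  have h := (hardy_schwartz (d := d) (k := 0) (by omega) (∂_{stdVec d i} (ψ n)) hε).2.2
  simp only [zero_add, pow_zero, Nat.cast_zero, mul_zero, sub_zero, div_one, one_mul] at h
  refine h.trans ?_
  gcongr
  simp only [gradSqS]
  rw [integral_finsetSum _ fun j _ => integrable_norm_sq _]
  refine Finset.sum_le_sum fun j _ => ?_
  rw [← norm_toL2_sq]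
  exact pow_le_pow_left₀ (norm_nonneg _) (h2 n j i) 2

theorem rellich_weightForm {d : ℕ} (hd : 5 ≤ d) (u : H2 d) {ε : ℝ} (hε : 0 < ε) :
    weightForm hε 2 (u : L2 d) ≤
      (2 / ((d : ℝ) - 4)) ^ 2 * ∑ i, weightForm hε 1 (partialDeriv u i) := by
  obtain ⟨ψ, C, h0, h1, -⟩ := exists_schwartz_approx u
  refine le_of_tendsto_of_tendsto ((continuous_weightForm hε 2).tendsto _ |>.comp h0)
    ((tendsto_finsetSum _ fun i _ =>
      (continuous_weightForm hε 1).tendsto _ |>.comp (h1 i)).const_mul _)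
    (.of_forall fun n => ?_)
  simp only [Function.comp, weightForm_toL2]
  have h := (hardy_schwartz (d := d) (k := 1) (by omega) (ψ n) hε).2.2
  norm_num only [Nat.cast_one] at h
  have e : (d : ℝ) - 2 - 2 = d - 4 := by ring
  refine h.trans_eq ?_
  rw [e]
  congr 1
  simp only [gradSqS, Finset.mul_sum]
  exact integral_finsetSum _ fun i _ => integrable_weight_mul_norm_sq hε 1 _

/-- `∫ |∇u|² / |x|²` is finite for `u ∈ H²`. -/
theorem lintegral_gradSq_div_lt_top {d : ℕ} (hd : 5 ≤ d) (u : H2 d) :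
    ∫⁻ x, ENNReal.ofReal (gradSq u x / ‖x‖ ^ 2) < ∞ := by
  obtain ⟨M, hM⟩ := exists_hardy_bound hd u
  refine lt_of_le_of_lt ?_ (ENNReal.ofReal_lt_top (r := M))
  simpa only [pow_one] using lintegral_div_norm_pow_le (aemeasurable_gradSq u) one_ne_zero
    (M := ENNReal.ofReal M) fun ε hε => by
      rw [← ofReal_sum_weightForm hε]
      exact ENNReal.ofReal_le_ofReal (hM ε hε)

theorem ae_ne_zero {d : ℕ} (hd : 0 < d) : ∀ᵐ x : Space d, x ≠ 0 := by
  have : Nonempty (Fin d) := ⟨⟨0, hd⟩⟩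
  exact compl_mem_ae_iff.2 (measure_singleton 0)

theorem lintegral_gradSq_div_add_le {d : ℕ} (hd : 0 < d) (u : H2 d) {ε : ℝ} (hε : 0 < ε) :
    ∫⁻ x, ENNReal.ofReal (gradSq u x / (‖x‖ ^ 2 + ε) ^ 1) ≤
      ∫⁻ x, ENNReal.ofReal (gradSq u x / ‖x‖ ^ 2) := by
  refine lintegral_mono_ae ?_
  filter_upwards [ae_ne_zero hd] with x hx
  have := norm_pos_iff.2 hx
  rw [pow_one]
  refine ENNReal.ofReal_le_ofReal (div_le_div_of_nonneg_left (gradSq_nonneg u x) (by positivity) ?_)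
  linarith

/-- The weighted Rellich inequality `∫ |u|² / |x|⁴ ≤ (2 / (d - 4))² ∫ |∇u|² / |x|²`. -/
theorem rellich_H2 {d : ℕ} (hd : 5 ≤ d) (u : H2 d) :
    ∫⁻ x, ENNReal.ofReal (‖(u : L2 d) x‖ ^ 2 / (‖x‖ ^ 2) ^ 2) ≤
      ENNReal.ofReal ((2 / ((d : ℝ) - 4)) ^ 2) *
        ∫⁻ x, ENNReal.ofReal (gradSq u x / ‖x‖ ^ 2) := by
  refine lintegral_div_norm_pow_le
    ((Lp.aestronglyMeasurable (u : L2 d)).norm.aemeasurable.pow_const 2) two_ne_zero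
    fun ε hε => ?_
  rw [← ofReal_weightForm hε]
  refine (ENNReal.ofReal_le_ofReal (rellich_weightForm hd u hε)).trans ?_
  rw [ENNReal.ofReal_mul (by positivity), ofReal_sum_weightForm hε]
  refine mul_le_mul_right ?_ _
  exact lintegral_gradSq_div_add_le (by omega) u hε

/-! ### The eigenvalue equation -/

/-- `resolvent_estimate` without the regularisation. -/
theorem lintegral_resolventS_le {d : ℕ} (hd : 5 ≤ d) {μ : ℂ} (hμ : μ.im ≠ 0)
    (g : Fin d → 𝓢(Space d, ℂ)) :
    ∫⁻ x, ENNReal.ofReal (‖resolventS μ (∑ j, ∂_{stdVec d j} (g j)) x‖ ^ 2 / (‖x‖ ^ 2) ^ 2) ≤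
      ENNReal.ofReal (resolventConst d ^ 2 * ∑ j, ∫ x, ‖x‖ ^ 2 * ‖g j x‖ ^ 2) := by
  refine lintegral_div_norm_pow_le (Continuous.aemeasurable (by fun_prop)) two_ne_zero
    fun ε hε => ?_
  refine le_trans (le_of_eq ?_) (ENNReal.ofReal_le_ofReal (resolvent_estimate hd hμ g hε))
  rw [ofReal_integral_eq_lintegral_ofReal (integrable_weight_mul_norm_sq hε 2 _)
    (.of_forall fun x => by positivity)]
  refine lintegral_congr fun x => ?_
  rw [one_div_mul_eq_div]

/-- The potential term, split by Young's inequality between the bound on `V` and the weighted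
resolvent estimate. -/
theorem norm_integral_potential_le {d : ℕ} (hd : 5 ≤ d) {V : Space d → ℂ} {a : ℝ}
    (hV : GradientBound d a V) (u : H2 d) {μ : ℂ} (hμ : μ.im ≠ 0) (g : Fin d → 𝓢(Space d, ℂ)) :
    ‖∫ x, V x * (u : L2 d) x * resolventS μ (∑ j, ∂_{stdVec d j} (g j)) x‖ ≤
      ((resolventConst d * a) ^ 2 * (∫⁻ x, ENNReal.ofReal (gradSq u x / ‖x‖ ^ 2)).toReal +
        ∑ j, ∫ x, ‖x‖ ^ 2 * ‖g j x‖ ^ 2) / 2 := by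
  have hR := lintegral_resolventS_le hd hμ g
  have hL := (lintegral_gradSq_div_lt_top hd u).ne
  have hC := resolventConst_pos hd
  have hVu := hV u
  set w := resolventS μ (∑ j, ∂_{stdVec d j} (g j))
  set C := resolventConst d
  set Z := ∑ j, ∫ x, ‖x‖ ^ 2 * ‖g j x‖ ^ 2
  set L := ∫⁻ x, ENNReal.ofReal (gradSq u x / ‖x‖ ^ 2)
  have hZ : 0 ≤ Z := Finset.sum_nonneg fun j _ => integral_nonneg fun x => by positivity
  have h1 : ∫⁻ x, ‖V x * (u : L2 d) x * w x‖ₑ ≤ ∫⁻ x,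
      (ENNReal.ofReal (C ^ 2 / 2) * ENNReal.ofReal (‖x‖ ^ 4 * ‖V x‖ ^ 2 * ‖(u : L2 d) x‖ ^ 2) +
        ENNReal.ofReal (1 / (2 * C ^ 2)) * ENNReal.ofReal (‖w x‖ ^ 2 / (‖x‖ ^ 2) ^ 2)) := by
    refine lintegral_mono_ae ?_
    filter_upwards [ae_ne_zero (d := d) (by omega)] with x hx
    have hr := norm_pos_iff.2 hx
    rw [← ofReal_norm, ← ENNReal.ofReal_mul (by positivity), ← ENNReal.ofReal_mul (by positivity),
      ← ENNReal.ofReal_add (by positivity) (by positivity), norm_mul, norm_mul]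
    refine ENNReal.ofReal_le_ofReal ?_
    -- Young's inequality with the weight for which the constant `C²` of the resolvent estimate
    -- cancels
    have e : C ^ 2 / 2 * (‖x‖ ^ 4 * ‖V x‖ ^ 2 * ‖(u : L2 d) x‖ ^ 2) +
        1 / (2 * C ^ 2) * (‖w x‖ ^ 2 / (‖x‖ ^ 2) ^ 2) - ‖V x‖ * ‖(u : L2 d) x‖ * ‖w x‖ =
        (C * ‖x‖ ^ 2 * ‖V x‖ * ‖(u : L2 d) x‖ - ‖w x‖ / (C * ‖x‖ ^ 2)) ^ 2 / 2 := by
      field_simp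
      ring
    nlinarith [sq_nonneg (C * ‖x‖ ^ 2 * ‖V x‖ * ‖(u : L2 d) x‖ - ‖w x‖ / (C * ‖x‖ ^ 2))]
  have hm : AEMeasurable (fun x => ENNReal.ofReal (1 / (2 * C ^ 2)) *
      ENNReal.ofReal (‖w x‖ ^ 2 / (‖x‖ ^ 2) ^ 2)) volume := by
    have : Measurable fun x => ‖w x‖ ^ 2 := Continuous.measurable (by fun_prop)
    exact ((this.div (by fun_prop)).ennreal_ofReal.const_mul _).aemeasurable
  rw [lintegral_add_right' _ hm, lintegral_const_mul' _ _ ENNReal.ofReal_ne_top,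
    lintegral_const_mul' _ _ ENNReal.ofReal_ne_top] at h1
  have h2 : ∫⁻ x, ‖V x * (u : L2 d) x * w x‖ₑ ≤
      ENNReal.ofReal (((C * a) ^ 2 * L.toReal + Z) / 2) := by
    refine h1.trans ((add_le_add (mul_le_mul_right hVu _)
      (mul_le_mul_right hR _)).trans_eq ?_)
    conv_lhs => rw [← ENNReal.ofReal_toReal hL]
    have hL0 : 0 ≤ L.toReal := ENNReal.toReal_nonneg
    rw [← ENNReal.ofReal_mul (by positivity), ← ENNReal.ofReal_mul (by positivity),
      ← ENNReal.ofReal_mul (by positivity), ← ENNReal.ofReal_add (by positivity) (by positivity)]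
    congr 1
    field_simp
  have h3 := (enorm_integral_le_lintegral_enorm _).trans h2
  rw [← ofReal_norm] at h3
  refine (ENNReal.ofReal_le_ofReal_iff ?_).1 h3
  have hL0 : 0 ≤ L.toReal := ENNReal.toReal_nonneg
  positivity

/-- As `μ` tends to `z` off the real axis, `(z - μ) (Δ² - μ)⁻¹ f` tends to `0` in `L²`: `Δ²` has
no eigenvalues. -/
theorem exists_norm_resolventS_le {d : ℕ} (hd : 0 < d) (z : ℂ) (f : 𝓢(Space d, ℂ)) {δ : ℝ}
    (hδ : 0 < δ) : ∃ μ : ℂ, μ.im ≠ 0 ∧ ‖z - μ‖ * ‖toL2 (resolventS μ f)‖ ≤ δ := by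
  have : Nonempty (Fin d) := ⟨⟨0, hd⟩⟩
  by_cases hz : z.im = 0
  swap
  -- non-real `z` is itself admissible
  · exact ⟨z, hz, by simpa using hδ.le⟩
  -- real `z` is approached vertically, so that `|z - μ|` is the distance of `μ` from the real axis
  set μ : ℕ → ℂ := fun n => z + ((1 / ((n : ℝ) + 1) : ℝ) : ℂ) * Complex.I with hμdef
  have him : ∀ n, (μ n).im = 1 / ((n : ℝ) + 1) := fun n => by
    simp only [hμdef, Complex.add_im, Complex.im_ofReal_mul, Complex.I_im, mul_one, hz, zero_add]
  have hμ : ∀ n, (μ n).im ≠ 0 := fun n => by rw [him]; positivity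
  have hnorm : ∀ n, ‖z - μ n‖ = 1 / ((n : ℝ) + 1) := fun n => by
    have : z - μ n = -(((1 / ((n : ℝ) + 1) : ℝ) : ℂ) * Complex.I) := by simp only [hμdef]; ring
    rw [this, norm_neg, norm_mul, Complex.norm_I, mul_one, Complex.norm_real,
      Real.norm_of_nonneg (by positivity)]
  have hμlim : Tendsto μ atTop (𝓝 z) := by
    rw [tendsto_iff_norm_sub_tendsto_zero]
    simp only [fun n => norm_sub_rev (μ n) z, hnorm]
    exact tendsto_one_div_add_atTop_nhds_zero_nat
  have hle : ∀ n ξ, ‖z - μ n‖ * ‖resolventSymbol d (μ n) ξ‖ ≤ 1 := fun n ξ => by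
    have h1 := norm_ofReal_sub_ge (μ n) ((2 * Real.pi) ^ 4 * (‖ξ‖ ^ 2) ^ 2)
    have h2 : ‖z - μ n‖ = |(μ n).im| := by rw [hnorm, him, abs_of_nonneg (by positivity)]
    rw [h2, resolventSymbol, norm_inv, ← div_eq_mul_inv]
    exact div_le_one_of_le₀ h1 (norm_nonneg _)
  have heq : ∀ n, (‖z - μ n‖ * ‖toL2 (resolventS (μ n) f)‖) ^ 2 =
      ∫ ξ, (‖z - μ n‖ * ‖resolventSymbol d (μ n) ξ‖) ^ 2 * ‖(𝓕 f) ξ‖ ^ 2 := fun n => by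
    rw [mul_pow, norm_toL2_sq, ← integral_norm_sq_fourier, ← integral_const_mul]
    refine integral_congr_ae (.of_forall fun ξ => ?_)
    simp only [fourier_resolventS (hμ n), norm_mul]
    ring
  have hnull : ∀ᵐ ξ : Space d, (((2 * Real.pi) ^ 4 * (‖ξ‖ ^ 2) ^ 2 : ℝ) : ℂ) ≠ z := by
    have h0 := Measure.addHaar_sphere (volume : Measure (Space d)) 0
      (√(√(z.re / (2 * Real.pi) ^ 4)))
    filter_upwards [compl_mem_ae_iff.2 h0] with ξ hξ hc
    apply hξ
    have hpi := Real.pi_pos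
    rw [mem_sphere_zero_iff_norm, ← hc, Complex.ofReal_re, mul_div_cancel_left₀ _ (by positivity),
      Real.sqrt_sq (by positivity), Real.sqrt_sq (norm_nonneg _)]
  have hlim : Tendsto (fun n => (‖z - μ n‖ * ‖toL2 (resolventS (μ n) f)‖) ^ 2) atTop (𝓝 0) := by
    simp only [heq]
    rw [← integral_zero (Space d) ℝ]
    refine tendsto_integral_of_dominated_convergence (fun ξ => ‖(𝓕 f) ξ‖ ^ 2) (fun n => ?_)
      (integrable_norm_sq _) (fun n => .of_forall fun ξ => ?_) ?_
    · have := (hasTemperateGrowth_resolventSymbol (d := d) (hμ n)).1.continuous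
      exact Continuous.aestronglyMeasurable (by fun_prop)
    · rw [Real.norm_of_nonneg (by positivity)]
      exact mul_le_of_le_one_left (by positivity) (pow_le_one₀ (by positivity) (hle n ξ))
    · filter_upwards [hnull] with ξ hξ
      have h1 : Tendsto (fun n => ‖z - μ n‖) atTop (𝓝 0) := by
        have := (tendsto_const_nhds (x := z)).sub hμlim
        rw [sub_self] at this
        exact tendsto_zero_iff_norm_tendsto_zero.1 this
      have h2 : Tendsto (fun n => ‖resolventSymbol d (μ n) ξ‖) atTop
          (𝓝 ‖((((2 * Real.pi) ^ 4 * (‖ξ‖ ^ 2) ^ 2 : ℝ) : ℂ) - z)⁻¹‖) :=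
        ((tendsto_const_nhds.sub hμlim).inv₀ (sub_ne_zero.2 hξ)).norm
      have h3 := ((h1.mul h2).pow 2).mul_const (‖(𝓕 f) ξ‖ ^ 2)
      simpa using h3
  obtain ⟨n, hn⟩ := (hlim.eventually (gt_mem_nhds (pow_pos hδ 2))).exists
  exact ⟨μ n, hμ n, (abs_le_of_sq_le_sq' hn.le hδ.le).2⟩

theorem laplacian_conjS {d : ℕ} (k : 𝓢(Space d, ℂ)) : conjS (Δ (conjS k)) = Δ k := by
  have h : ∀ m : Space d, ∂_{m} (conjS k) = conjS (∂_{m} k) := fun m => by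
    ext x
    rw [lineDeriv_conjS, conjS_apply]
  ext x
  rw [conjS_apply, SchwartzMap.laplacian_eq_sum (EuclideanSpace.basisFun (Fin d) ℝ),
    SchwartzMap.laplacian_eq_sum (EuclideanSpace.basisFun (Fin d) ℝ), sum_apply, sum_apply, map_sum]
  refine Finset.sum_congr rfl fun i _ => ?_
  rw [h, lineDeriv_conjS, Complex.conj_conj]

/-- The eigenvalue equation tested with the resolvent of `Δ²` applied to a divergence. -/
theorem eigen_identity {d : ℕ} {V : Space d → ℂ} {u : H2 d} {z μ : ℂ}
    (h : IsImage V u (z • (u : L2 d))) (hμ : μ.im ≠ 0) (g : Fin d → 𝓢(Space d, ℂ)) :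
    ∑ j, toDist (partialDeriv u j) (g j) =
      (∫ x, V x * (u : L2 d) x * resolventS μ (∑ j, ∂_{stdVec d j} (g j)) x) -
        (z - μ) * toDist (u : L2 d) (resolventS μ (∑ j, ∂_{stdVec d j} (g j))) := by
  set f := ∑ j, ∂_{stdVec d j} (g j) with hf
  set w := resolventS μ f with hw
  -- the form is conjugate-linear in the test function
  have key := (h (schwartzH2 (conjS w))).2
  rw [lap_schwartzH2, coe_schwartzH2, inner_smul_right, inner_toL2_eq, inner_toL2_eq, conjS_conjS,
    laplacian_conjS, toDist_lap_apply, laplacian_laplacian_resolventS hμ, map_add, map_smul,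
    smul_eq_mul, ← hw, hf, map_sum] at key
  have e : ∫ x, V x * (u : L2 d) x * conj (toL2 (conjS w) x) =
      ∫ x, V x * (u : L2 d) x * w x := by
    refine integral_congr_ae ?_
    filter_upwards [(conjS w).coeFn_toLp 2 (volume : Measure (Space d))] with x hx
    rw [hx, conjS_apply, Complex.conj_conj]
  rw [e] at key
  have e2 : ∑ j, toDist (partialDeriv u j) (g j) =
      -∑ j, toDist (u : L2 d) (∂_{stdVec d j} (g j)) := by
    rw [← Finset.sum_neg_distrib]
    exact Finset.sum_congr rfl fun j _ => toDist_partialDeriv_apply u j (g j)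
  rw [e2]
  linear_combination -key

/-- The limit `μ → z` in `eigen_identity`. -/
theorem norm_sum_toDist_le {d : ℕ} (hd : 5 ≤ d) {V : Space d → ℂ} {a : ℝ}
    (hV : GradientBound d a V) {u : H2 d} {z : ℂ} (h : IsImage V u (z • (u : L2 d)))
    (g : Fin d → 𝓢(Space d, ℂ)) :
    ‖∑ j, toDist (partialDeriv u j) (g j)‖ ≤
      ((resolventConst d * a) ^ 2 * (∫⁻ x, ENNReal.ofReal (gradSq u x / ‖x‖ ^ 2)).toReal +
        ∑ j, ∫ x, ‖x‖ ^ 2 * ‖g j x‖ ^ 2) / 2 := by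
  refine le_of_forall_pos_le_add fun δ hδ => ?_
  obtain ⟨μ, hμ, hle⟩ := exists_norm_resolventS_le (d := d) (by omega) z
    (∑ j, ∂_{stdVec d j} (g j)) (δ := δ / (‖(u : L2 d)‖ + 1)) (by positivity)
  rw [eigen_identity h hμ g]
  refine (norm_sub_le _ _).trans (add_le_add (norm_integral_potential_le hd hV u hμ g) ?_)
  rw [norm_mul]
  calc ‖z - μ‖ * ‖toDist (u : L2 d) (resolventS μ (∑ j, ∂_{stdVec d j} (g j)))‖
      ≤ ‖z - μ‖ * (‖(u : L2 d)‖ * ‖toL2 (resolventS μ (∑ j, ∂_{stdVec d j} (g j)))‖) := by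
        gcongr
        exact norm_toDist_apply_le _ _
    _ = ‖(u : L2 d)‖ * (‖z - μ‖ * ‖toL2 (resolventS μ (∑ j, ∂_{stdVec d j} (g j)))‖) := by ring
    _ ≤ (‖(u : L2 d)‖ + 1) * (δ / (‖(u : L2 d)‖ + 1)) := by gcongr; linarith
    _ = δ := mul_div_cancel₀ _ (by positivity)

/-- The bound on the gradient of an eigenfunction, regularised at the origin. The test fields
`gⱼ = p̄ⱼ / (|x|² + ε)` with Schwartz functions `pⱼ` close to `∂ⱼu` give `∫ |∇u|² / (|x|² + ε)`. -/
theorem sum_weightForm_partialDeriv_le {d : ℕ} (hd : 5 ≤ d) {V : Space d → ℂ} {a : ℝ}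
    (hV : GradientBound d a V) {u : H2 d} {z : ℂ} (h : IsImage V u (z • (u : L2 d))) {ε : ℝ}
    (hε : 0 < ε) :
    ∑ j, weightForm hε 1 (partialDeriv u j) ≤
      (resolventConst d * a) ^ 2 *
        (∫⁻ x, ENNReal.ofReal (gradSq u x / ‖x‖ ^ 2)).toReal := by
  set A := (resolventConst d * a) ^ 2 * (∫⁻ x, ENNReal.ofReal (gradSq u x / ‖x‖ ^ 2)).toReal
    with hA
  -- an inequality between continuous functions of `p ∈ (L²)^d`, so it suffices to have it for
  -- Schwartz fields `p`
  have key : ∀ p : Fin d → L2 d, ‖∑ j, inner ℂ (p j) (weightL hε 1 (partialDeriv u j))‖ ≤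
      (A + ∑ j, weightForm hε 1 (p j)) / 2 := by
    have hdense : DenseRange (Pi.map fun _ : Fin d => toL2 (d := d)) :=
      DenseRange.piMap fun _ => denseRange_toL2
    refine isClosed_property hdense (isClosed_le ?_ ?_) fun P => ?_
    · fun_prop
    · have := continuous_weightForm (d := d) hε 1
      fun_prop
    have h1 := norm_sum_toDist_le hd hV h fun j => weightS ε 1 (conjS (P j))
    have e1 : ∀ j, toDist (partialDeriv u j) (weightS ε 1 (conjS (P j))) =
        inner ℂ (toL2 (P j)) (weightL hε 1 (partialDeriv u j)) := fun j => by
      rw [inner_weightL, toDist, Lp.toTemperedDistribution_apply]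
      refine integral_congr_ae ?_
      filter_upwards [(P j).coeFn_toLp 2 (volume : Measure (Space d))] with x hx
      rw [hx, weightS_apply hε, smul_eq_mul, conjS_apply, mul_assoc]
    simp only [e1] at h1
    refine h1.trans ?_
    gcongr with j
    simp only [Pi.map_apply, weightForm_toL2]
    refine integral_mono_of_nonneg (.of_forall fun x => by positivity)
      (integrable_weight_mul_norm_sq hε 1 (P j)) (.of_forall fun x => ?_)
    have hq : 0 < ‖x‖ ^ 2 + ε := by positivity
    simp only [weightS_apply hε, norm_mul, mul_pow, Complex.norm_real, Real.norm_eq_abs, sq_abs,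
      conjS_apply, Complex.norm_conj, pow_one]
    rw [← mul_assoc]
    gcongr
    rw [div_pow, one_pow, mul_one_div, div_le_div_iff₀ (by positivity) hq]
    nlinarith
  have h1 := key (partialDeriv u)
  have h2 : ∑ j, weightForm hε 1 (partialDeriv u j) ≤
      ‖∑ j, inner ℂ (partialDeriv u j) (weightL hε 1 (partialDeriv u j))‖ := by
    refine le_trans (le_of_eq ?_) (Complex.re_le_norm _)
    rw [Complex.re_sum]
    rfl
  linarith

/-- Eigenfunctions vanish as soon as `a` is smaller than the inverse of the constant in the
weighted resolvent estimate. -/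
theorem eq_zero_of_isImage {d : ℕ} (hd : 5 ≤ d) {V : Space d → ℂ} {a : ℝ} (ha : 0 ≤ a)
    (hV : GradientBound d a V) (hsmall : resolventConst d * a < 1) {u : H2 d} {z : ℂ}
    (h : IsImage V u (z • (u : L2 d))) : (u : L2 d) = 0 := by
  have hL := (lintegral_gradSq_div_lt_top hd u).ne
  have hR := rellich_H2 hd u
  have hC := resolventConst_pos hd
  have h1 : ∫⁻ x, ENNReal.ofReal (gradSq u x / ‖x‖ ^ 2) ≤ ENNReal.ofReal ((resolventConst d * a) ^ 2 *
      (∫⁻ x, ENNReal.ofReal (gradSq u x / ‖x‖ ^ 2)).toReal) := by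
    simpa only [pow_one] using lintegral_div_norm_pow_le (aemeasurable_gradSq u) one_ne_zero
      (M := ENNReal.ofReal ((resolventConst d * a) ^ 2 *
        (∫⁻ x, ENNReal.ofReal (gradSq u x / ‖x‖ ^ 2)).toReal)) fun ε hε => by
        rw [← ofReal_sum_weightForm hε]
        exact ENNReal.ofReal_le_ofReal (sum_weightForm_partialDeriv_le hd hV h hε)
  set L := ∫⁻ x, ENNReal.ofReal (gradSq u x / ‖x‖ ^ 2)
  have hL0 : 0 ≤ L.toReal := ENNReal.toReal_nonneg
  have h2 : L.toReal ≤ (resolventConst d * a) ^ 2 * L.toReal :=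
    ENNReal.toReal_le_of_le_ofReal (by positivity) h1
  have h3 : (resolventConst d * a) ^ 2 < 1 := pow_lt_one₀ (by positivity) hsmall two_ne_zero
  have h4 : L.toReal = 0 := by nlinarith
  have h5 : L = 0 := ((ENNReal.toReal_eq_zero_iff L).1 h4).resolve_right hL
  rw [h5, mul_zero, nonpos_iff_eq_zero, lintegral_eq_zero_iff'] at hR
  · rw [Lp.eq_zero_iff_ae_eq_zero]
    filter_upwards [hR, ae_ne_zero (d := d) (by omega)] with x hx hx0
    have hr := norm_pos_iff.2 hx0
    have h6 : ‖(u : L2 d) x‖ ^ 2 / (‖x‖ ^ 2) ^ 2 ≤ 0 := ENNReal.ofReal_eq_zero.1 hx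
    have h7 : ‖(u : L2 d) x‖ ^ 2 ≤ 0 := by
      by_contra hc
      push Not at hc
      exact absurd h6 (not_le.2 (by positivity))
    simpa using le_antisymm h7 (by positivity)
  · exact (((Lp.aestronglyMeasurable (u : L2 d)).norm.aemeasurable.pow_const 2).div
      (Measurable.aemeasurable (by fun_prop))).ennreal_ofReal

/-! ### The smallness condition and Rellich potentials -/

theorem sqrt_hardyConst {d : ℕ} (hd : 5 ≤ d) : √(hardyConst d) = ((d : ℝ) - 2) / 2 := by
  have hd5 : (5 : ℝ) ≤ d := by exact_mod_cast hd
  have : hardyConst d = (((d : ℝ) - 2) / 2) ^ 2 := by rw [hardyConst]; ring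
  rw [this, Real.sqrt_sq (by linarith)]

/-- The first summand of the smallness condition already dominates `a` times the constant in the
weighted resolvent estimate. -/
theorem resolventConst_mul_lt_one {d : ℕ} (hd : 5 ≤ d) {a : ℝ} (ha : 0 ≤ a) (h : IsSmall d a) :
    resolventConst d * a < 1 := by
  have hd5 : (5 : ℝ) ≤ d := by exact_mod_cast hd
  rw [IsSmall, sqrt_hardyConst hd] at h
  have h2 : (0 : ℝ) < d - 2 := by linarith
  have h4 : (0 : ℝ) < d - 4 := by linarith
  have hnn : 0 ≤ 4 * (d : ℝ) * √(d : ℝ) / (((d : ℝ) - 4) * √(((d : ℝ) - 2) * ((d : ℝ) - 4)))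
      * (a ^ (3 / 2 : ℝ) / (((d : ℝ) - 2) / 2) ^ (3 / 2 : ℝ)) := by positivity
  have hle : resolventConst d * a ≤
      4 * (d : ℝ) ^ 2 * ((d : ℝ) - 3) / (((d : ℝ) - 2) * ((d : ℝ) - 4)) *
        (a / (((d : ℝ) - 2) / 2)) := by
    have e1 : resolventConst d = (47 * (d : ℝ) - 88) * (d - 2) / (2 * (d - 2) ^ 2 * (d - 4)) := by
      rw [resolventConst]
      field_simp
      ring
    have e2 : 4 * (d : ℝ) ^ 2 * ((d : ℝ) - 3) / (((d : ℝ) - 2) * ((d : ℝ) - 4)) *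
        (a / (((d : ℝ) - 2) / 2)) =
        16 * (d : ℝ) ^ 2 * (d - 3) / (2 * (d - 2) ^ 2 * (d - 4)) * a := by
      field_simp
      ring
    rw [e1, e2]
    refine mul_le_mul_of_nonneg_right (div_le_div_of_nonneg_right ?_ (by positivity)) ha
    -- a cubic inequality in `d`, with positive coefficients in terms of `t = d - 5`
    obtain ⟨t, ht⟩ : ∃ t : ℝ, (d : ℝ) = 5 + t := ⟨d - 5, by ring⟩
    have ht0 : 0 ≤ t := by linarith
    rw [ht]
    nlinarith [pow_nonneg ht0 2, pow_nonneg ht0 3]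
  linarith

/-- The left-hand side of the smallness condition is continuous in `a` and vanishes at `a = 0`. -/
theorem exists_isSmall (d : ℕ) : ∃ δ : ℝ, 0 < δ ∧ ∀ a : ℝ, 0 ≤ a → a < δ →
    IsSmall d a := by
  set F : ℝ → ℝ := fun a =>
    4 * (d : ℝ) ^ 2 * ((d : ℝ) - 3) / (((d : ℝ) - 2) * ((d : ℝ) - 4)) * (a / √(hardyConst d))
    + 4 * (d : ℝ) * √(d : ℝ) / (((d : ℝ) - 4) * √(((d : ℝ) - 2) * ((d : ℝ) - 4)))
      * (a ^ (3 / 2 : ℝ) / √(hardyConst d) ^ (3 / 2 : ℝ)) with hF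
  have hr : Continuous fun a : ℝ => a ^ (3 / 2 : ℝ) := Real.continuous_rpow_const (by norm_num)
  have hc : Continuous F := by
    refine ((continuous_id.div_const _).const_mul _).add ((hr.div_const _).const_mul _)
  have h0 : F 0 < 1 := by
    have : (0 : ℝ) ^ (3 / 2 : ℝ) = 0 := Real.zero_rpow (by norm_num)
    simp [hF, this]
  obtain ⟨δ, hδ, h⟩ := Metric.eventually_nhds_iff.1 (hc.tendsto 0 |>.eventually (gt_mem_nhds h0))
  refine ⟨δ, hδ, fun a ha0 ha => h ?_⟩
  rwa [Real.dist_eq, sub_zero, abs_of_nonneg ha0]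

theorem norm_rellichPotential (d : ℕ) (α : ℂ) (x : Space d) :
    ‖rellichPotential d α x‖ = ‖α‖ / ‖x‖ ^ 4 := by
  rw [rellichPotential, norm_div, Complex.norm_real, norm_pow, norm_norm]

theorem measurable_rellichPotential (d : ℕ) (α : ℂ) : Measurable (rellichPotential d α) := by
  unfold rellichPotential
  fun_prop

/-- For `V = α / |x|⁴` the bound on `V` is Rellich's inequality. -/
theorem gradientBound_rellichPotential {d : ℕ} (hd : 5 ≤ d) (α : ℂ) :
    GradientBound d (‖α‖ * (2 / ((d : ℝ) - 4))) (rellichPotential d α) := by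
  intro ψ
  rw [mul_pow, ENNReal.ofReal_mul (by positivity), mul_assoc]
  refine le_trans ?_ (mul_le_mul_right (rellich_H2 hd ψ) _)
  rw [← lintegral_const_mul' _ _ ENNReal.ofReal_ne_top]
  refine lintegral_mono fun x => ?_
  rw [← ENNReal.ofReal_mul (by positivity), norm_rellichPotential]
  refine ENNReal.ofReal_le_ofReal (le_of_eq ?_)
  -- at the origin both sides are `0`, by division by zero
  by_cases hx : x = 0
  · simp [hx]
  · have := norm_pos_iff.2 hx
    field_simp

theorem locallyIntegrable_of_norm_le_inv_pow_four {d : ℕ} (hd : 5 ≤ d) {F : Type*}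
    [NormedAddCommGroup F] {f : Space d → F} {C : ℝ} (hf : AEStronglyMeasurable f volume)
    (h : ∀ᵐ x : Space d, ‖f x‖ ≤ C / ‖x‖ ^ 4) : LocallyIntegrable f volume := by
  have hfin : Module.finrank ℝ (Space d) = d := by simp
  refine locallyIntegrable_of_norm_le_rpow (C := C) (α := 4) (by omega) ?_ ?_ hf
  · rw [hfin]
    exact_mod_cast hd
  · filter_upwards [h] with x hx
    rw [Real.rpow_neg (norm_nonneg _), ← div_eq_mul_inv]
    exact_mod_cast hx

theorem locallyIntegrable_rellichPotential {d : ℕ} (hd : 5 ≤ d) (α : ℂ) :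
    LocallyIntegrable (rellichPotential d α) volume :=
  locallyIntegrable_of_norm_le_inv_pow_four hd (measurable_rellichPotential d α).aestronglyMeasurable
    (.of_forall fun x => (norm_rellichPotential d α x).le)

theorem memL2Loc_rellichPotential {d : ℕ} (hd : 5 ≤ d) (α : ℂ) :
    MemL2Loc (fun x => ((‖x‖ ^ 2 : ℝ) : ℂ) * rellichPotential d α x) := by
  intro K hK
  have hm : Measurable (fun x : Space d => ((‖x‖ ^ 2 : ℝ) : ℂ) * rellichPotential d α x) :=
    Measurable.mul (by fun_prop) (measurable_rellichPotential d α)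
  rw [memLp_two_iff_integrable_sq_norm hm.aestronglyMeasurable]
  have hloc : LocallyIntegrable
      (fun x : Space d => ‖((‖x‖ ^ 2 : ℝ) : ℂ) * rellichPotential d α x‖ ^ 2) volume := by
    refine locallyIntegrable_of_norm_le_inv_pow_four hd (C := ‖α‖ ^ 2)
      (hm.norm.pow_const 2).aestronglyMeasurable ?_
    filter_upwards [ae_ne_zero (d := d) (by omega)] with x hx
    have hr := norm_pos_iff.2 hx
    rw [Real.norm_of_nonneg (by positivity), norm_mul, Complex.norm_real, norm_rellichPotential,
      Real.norm_of_nonneg (by positivity)]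
    refine le_of_eq ?_
    field_simp
  exact hloc.integrableOn_isCompact hK

end Biharmonic

end

theorem theorem1p1 (d : ℕ) (hd : 5 ≤ d) :
    (∀ (V : Biharmonic.Space d → ℂ) (a : ℝ),
      MeasureTheory.LocallyIntegrable V MeasureTheory.MeasureSpace.volume →
      Biharmonic.MemL2Loc (fun x => ((‖x‖ ^ 2 : ℝ) : ℂ) * V x) →
      0 ≤ a →
      Biharmonic.GradientBound d a V →
      Biharmonic.IsSmall d a →
      Biharmonic.pointSpectrum (Biharmonic.biharmonicOp V) = ∅) ∧
    (∃ ε : ℝ, 0 < ε ∧ ∀ α : ℂ, ‖α‖ < ε →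
      MeasureTheory.LocallyIntegrable (Biharmonic.rellichPotential d α)
        MeasureTheory.MeasureSpace.volume ∧
      Biharmonic.MemL2Loc
        (fun x => ((‖x‖ ^ 2 : ℝ) : ℂ) * Biharmonic.rellichPotential d α x) ∧
      ∃ a : ℝ, 0 ≤ a ∧
        Biharmonic.GradientBound d a (Biharmonic.rellichPotential d α) ∧
        Biharmonic.IsSmall d a) := by
  refine ⟨fun V a _ _ ha hV hsmall => ?_, ?_⟩
  · refine Set.eq_empty_iff_forall_notMem.2 fun z hz => ?_
    obtain ⟨u, hu, h⟩ := (Biharmonic.mem_pointSpectrum_biharmonicOp V z).1 hz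
    exact hu (Biharmonic.eq_zero_of_isImage hd ha hV
      (Biharmonic.resolventConst_mul_lt_one hd ha hsmall) h)
  · obtain ⟨δ, hδ, hsmall⟩ := Biharmonic.exists_isSmall d
    have hd5 : (5 : ℝ) ≤ d := by exact_mod_cast hd
    have h4 : (0 : ℝ) < d - 4 := by linarith
    refine ⟨δ * ((d - 4) / 2), by positivity, fun α hα =>
      ⟨Biharmonic.locallyIntegrable_rellichPotential hd α,
        Biharmonic.memL2Loc_rellichPotential hd α, ‖α‖ * (2 / ((d : ℝ) - 4)), by positivity,
        Biharmonic.gradientBound_rellichPotential hd α, hsmall _ (by positivity) ?_⟩⟩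
    calc ‖α‖ * (2 / ((d : ℝ) - 4)) < δ * ((d - 4) / 2) * (2 / ((d : ℝ) - 4)) := by gcongr
      _ = δ := by field_simp
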